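/- Let $X,U_1,U_2,Y$ be complex Hilbert spaces and consider the bilinear feedback system $$\dot z(t)=Az(t)+B_1u_1(t)+B_2u_2(t),\quad z(0)=z_0,\quad y(t)=Cz(t),\quad u_2(t)=N(z(t),y(t)),\qquad(\Sigma)$$ under the following standing assumptions. $A$ generates a $C_0$-semigroup $(T(t))_{t\ge0}$ on $X$ with growth bound $\omega_0(T)$. For a fixed $\beta\in\rho(A)$, $X_1$ is $D(A)$ with the norm $\|(\beta-A)x\|_X$, $X_{-1}$ is the completion of $X$ in the norm $\|(\beta-A)^{-1}x\|_X$, and $T_{-1}(t)$ and $(\alpha-A_{-1})^{-1}:X_{-1}\to X$ are the continuous extensions of $T(t)$ and $(\alpha-A)^{-1}$ to $X_{-1}$. Further, $B_i\in\mathcal L(U_i,X_{-1})$ for $i=1,2$; $Y\subseteq X$ with continuous embedding; $C\in\mathcal L(X_1,Y)$ has an extension $C\in\mathcal L(X)$; and $N:X\times Y\to U_2$ is continuous and bilinear with $\|N(z,y)\|_{U_2}\le K\|z\|_X\|y\|_X^{1-p}\|y\|_Y^p$ for some $K>0$, $p\in(0,1)$ and all $z\in X$, $y\in Y$. Put $\Phi^i_tu=\int_0^tT_{-1}(t-s)B_iu(s)\,ds$.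 Let $\Psi_t\in\mathcal L(X,L^2(0,t;Y))$ be the extension of $x\mapsto CT(\cdot)x$, $x\in D(A)$. A transfer function of $(A,B_i,C)$ is a function $G_i:\{\operatorname{Re}\alpha>\omega_0(T)\}\to\mathcal L(U_i,Y)$ with $G_i(\alpha)-G_i(\gamma)=C[(\alpha-A_{-1})^{-1}-(\gamma-A_{-1})^{-1}]B_i$. Let $\mathbb F^i_t\in\mathcal L(L^2(0,t;U_i),L^2(0,t;Y))$ be the extension of $$(\mathbb F^i_tu)(s)=C\Big[\int_0^sT_{-1}(s-r)B_iu(r)\,dr-(\alpha-A_{-1})^{-1}B_iu(s)\Big]+G_i(\alpha)u(s),\qquad u\in W^{1,2}_{\rm loc}(0,\infty;U_i),\ u(0)=0,$$ where $G_i(\alpha)=C(\alpha-A_{-1})^{-1}B_i$ (with $C$ extended to $X$) is the transfer function belonging to $y=Cz$. The linear system belonging to $(\Sigma)$ is well-posed if, for all $t>0$, $\Phi^i_t$ is bounded from $L^2(0,\infty;U_i)$ to $X$ and $x\mapsto CT(\cdot)x$ extends to $\Psi_t\in\mathcal L(X,L^2(0,t;Y))$, and if $(A,B_i,C)$ has a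 transfer function that is bounded on some right half-plane ($i=1,2$). A solution and output of $(\Sigma)$ with data $z_0\in X$, $u_1\in L^2(0,\infty;U_1)$ are $z\in C([0,\infty);X)$ and $y\in L^2_{\rm loc}(0,\infty;Y)$ (square integrable on every $(0,t)$) with $$z(t)=T(t)z_0+\Phi^1_tu_1+\Phi^2_tN(z,y),\qquad y|_{[0,t]}=\Psi_tz_0+\mathbb F^1_tu_1+\mathbb F^2_tN(z,y)\qquad\text{for all }t.$$ For $\omega>0$ let $L^2_\omega(0,t;U)=\{f\in L^2(0,t;U): e^{\omega\cdot}f\in L^2(0,t;U)\}$ with the norm $\|f\|_{L^2_\omega(0,t;U)}=\|e^{\omega\cdot}f\|_{L^2(0,t;U)}$, $t\in(0,\infty]$. **Theorem.** In addition, assume that one of the following holds. 1. $A$ is self-adjoint and there is $w_A<0$ with $\langle Az,z\rangle\le w_A\|z\|^2$ for all $z\in D(A)$; $B_i\in\mathcal L(U_i,X_{-1/2})$, $i=1,2$, and $C\in\mathcal L(X_{1/2},Y)$. Here $X_{1/2}$ is the completion of $D(A)$ in the norm $\sqrt{\langle-Az,z\rangle}$, and $X_{-1/2}\hookrightarrow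 X_{-1}$ is its dual with respect to the pivot space $X$. 2. $A=A_0+L$ with $A_0$ skew-adjoint and $L\in\mathcal L(X)$ such that $\operatorname{Re}\langle Lz,z\rangle\le w_A\|z\|^2$ for all $z\in X$ and some $w_A<0$; $B_i\in\mathcal L(U_i,X)$, $i=1,2$, and $C\in\mathcal L(X,Y)$. Then the linear system belonging to $(\Sigma)$ is well-posed, and there are constants $\varepsilon,\omega,\nu,c>0$ with $\omega\le\nu$ such that for all $z_0\in X$ and $u_1\in L^2_\omega(0,\infty;U_1)$ with $\|z_0\|_X+\|u_1\|_{L^2_\omega(0,\infty;U_1)}\le\varepsilon$ the system $(\Sigma)$ has a unique solution $z$ (with a unique output $y$), and $$\|z(t)\|_X\le\|z_0\|_Xe^{-\nu t}+c\,e^{-\nu t}\|e^{\nu\cdot}u_1\|_{L^2(0,t;U_1)}\qquad\text{for all }t\ge0.$$ Moreover, for this $\omega$ the system is locally $L^2_\omega$-ISS: there are $\varepsilon'>0$ and continuous functions $b:[0,\infty)^2\to[0,\infty)$ and $g:[0,\infty)\to[0,\infty)$, where $b(\cdot,t)$ is strictly increasing with $b(0,t)=0$ for all $t\ge0$, $b(s,\cdot)$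 is strictly decreasing to $0$ for all $s>0$, and $g$ is strictly increasing to $\infty$ with $g(0)=0$, such that for all $z_0\in X$ and $u_1\in L^2_\omega(0,\infty;U_1)$ with $\|z_0\|_X+\|u_1\|_{L^2_\omega(0,\infty;U_1)}\le\varepsilon'$ there is a solution $z$ with $\|z(t)\|_X\le b(\|z_0\|_X,t)+g(\|u_1\|_{L^2_\omega(0,t;U_1)})$ for all $t\ge0$. -/

import Mathlib

open Set Filter Topology MeasureTheory
open scoped NNReal ENNReal

noncomputable section

namespace BilinearFeedback

/-! ### Semigroups, generators, resolvents -/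

section Semigroups

variable {X : Type*} [NormedAddCommGroup X] [NormedSpace ℂ X]

/-- A `C₀`-semigroup of bounded linear operators on `X`. -/
structure C0Semigroup (X : Type*) [NormedAddCommGroup X] [NormedSpace ℂ X] where
  op : ℝ≥0 → X →L[ℂ] X
  map_zero : op 0 = ContinuousLinearMap.id ℂ X
  map_add : ∀ s t, op (s + t) = (op s).comp (op t)
  strongly_continuous : ∀ x, Continuous fun t => op t x

/-- `A` is the infinitesimal generator of `T`: one has `x ∈ D(A)` and `A x = y` exactly when
`h⁻¹ (T(h) x - x) → y` as `h ↓ 0`. -/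
def C0Semigroup.IsGenerator (T : C0Semigroup X) (A : X →ₗ.[ℂ] X) : Prop :=
  ∀ x y : X, (x, y) ∈ A.graph ↔
    Tendsto (fun h : ℝ≥0 => ((h : ℝ)⁻¹ : ℂ) • (T.op h x - x)) (𝓝[>] 0) (𝓝 y)

/-- The open half-plane `{α | Re α > ω₀(T)}`, where `ω₀(T)` is the growth bound of `T`, the infimum
of all `w` with `‖T(t)‖ ≤ M e^{w t}` for some `M` and all `t ≥ 0`. -/
def C0Semigroup.growthHalfPlane (T : C0Semigroup X) : Set ℂ :=
  {α | ∃ w < α.re, ∃ M : ℝ, ∀ t : ℝ≥0, ‖T.op t‖ ≤ M * Real.exp (w * t)}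

/-- `R` is a bounded two-sided inverse of `α - A : D(A) → X`. -/
def IsResolventAt (A : X →ₗ.[ℂ] X) (α : ℂ) (R : X →L[ℂ] X) : Prop :=
  (∀ x, ∃ w : A.domain, (w : X) = R x ∧ α • (w : X) - A w = x) ∧
    ∀ w : A.domain, R (α • (w : X) - A w) = w

/-- The resolvent set `ρ(A)`. -/
def resolventSet (A : X →ₗ.[ℂ] X) : Set ℂ := {α | ∃ R, IsResolventAt A α R}

open Classical in
/-- The resolvent `(α - A)⁻¹` for `α ∈ ρ(A)` (and `0` otherwise). -/
def resolvent (A : X →ₗ.[ℂ] X) (α : ℂ) : X →L[ℂ] X :=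
  if h : ∃ R, IsResolventAt A α R then h.choose else 0

lemma isResolventAt_resolvent {A : X →ₗ.[ℂ] X} {α : ℂ} (h : α ∈ resolventSet A) :
    IsResolventAt A α (resolvent A α) := by
  have h' : ∃ R, IsResolventAt A α R := h
  simp only [resolvent, dif_pos h']
  exact h'.choose_spec

/-- The semigroup commutes with its generator. -/
lemma C0Semigroup.IsGenerator.graph_op {T : C0Semigroup X} {A : X →ₗ.[ℂ] X}
    (hA : T.IsGenerator A) (t : ℝ≥0) {x y : X} (h : (x, y) ∈ A.graph) :
    (T.op t x, T.op t y) ∈ A.graph := by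
  rw [hA] at h ⊢
  have := ((T.op t).continuous.tendsto y).comp h
  refine this.congr fun s => ?_
  have e : T.op s (T.op t x) = T.op t (T.op s x) := by
    rw [← ContinuousLinearMap.comp_apply, ← T.map_add, add_comm, T.map_add,
      ContinuousLinearMap.comp_apply]
  simp [e]

/-- The semigroup commutes with the resolvents of its generator. -/
lemma C0Semigroup.IsGenerator.resolvent_op {T : C0Semigroup X} {A : X →ₗ.[ℂ] X}
    (hA : T.IsGenerator A) {β : ℂ} (hβ : β ∈ resolventSet A) (t : ℝ≥0) (x : X) :
    resolvent A β (T.op t x) = T.op t (resolvent A β x) := by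
  obtain ⟨h1, h2⟩ := isResolventAt_resolvent hβ
  obtain ⟨w, hw, hx⟩ := h1 x
  have hg := hA.graph_op t (A.mem_graph w)
  obtain ⟨v, hv, hv'⟩ := (LinearPMap.mem_graph_iff A).1 hg
  have := h2 v
  rw [hv, hv', ← map_smul, ← map_sub, hx] at this
  simp only at this
  rw [this, ← hw]

end Semigroups

/-! ### The spaces `X₁` and `X₋₁` -/

section Extrapolation

variable {X : Type*} [NormedAddCommGroup X] [NormedSpace ℂ X]

/-- The interpolation space `X₁`: the domain of `A` with the norm `‖(β - A) x‖`. -/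
def X1 (A : X →ₗ.[ℂ] X) (_β : ℂ) : Type _ := A.domain

instance (A : X →ₗ.[ℂ] X) (β : ℂ) : AddCommGroup (X1 A β) :=
  inferInstanceAs (AddCommGroup A.domain)

instance (A : X →ₗ.[ℂ] X) (β : ℂ) : Module ℂ (X1 A β) :=
  inferInstanceAs (Module ℂ A.domain)

/-- The map `β - A : X₁ → X`. -/
def X1.shift (A : X →ₗ.[ℂ] X) (β : ℂ) : X1 A β →ₗ[ℂ] X :=
  (β • A.domain.subtype - A.toFun : A.domain →ₗ[ℂ] X)

instance (A : X →ₗ.[ℂ] X) (β : ℂ) : SeminormedAddCommGroup (X1 A β) :=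
  SeminormedAddCommGroup.induced (X1 A β) X (X1.shift A β)

instance (A : X →ₗ.[ℂ] X) (β : ℂ) : NormedSpace ℂ (X1 A β) :=
  NormedSpace.induced ℂ (X1 A β) X (X1.shift A β)

/-- The vector of `X` underlying an element of `X₁ = D(A)`. -/
def X1.val {A : X →ₗ.[ℂ] X} {β : ℂ} (x : X1 A β) : X := Subtype.val (p := (· ∈ A.domain)) x

/-- The vector space `X` with the norm `‖(β - A)⁻¹ x‖`. -/
def PreExtrap (A : X →ₗ.[ℂ] X) (_β : ℂ) : Type _ := let _ := A; X

instance (A : X →ₗ.[ℂ] X) (β : ℂ) : AddCommGroup (PreExtrap A β) :=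
  inferInstanceAs (AddCommGroup X)

instance (A : X →ₗ.[ℂ] X) (β : ℂ) : Module ℂ (PreExtrap A β) :=
  inferInstanceAs (Module ℂ X)

/-- The identity, as a linear equivalence from `X` to its copy with the norm `‖(β - A)⁻¹ x‖`. -/
def PreExtrap.equiv (A : X →ₗ.[ℂ] X) (β : ℂ) : X ≃ₗ[ℂ] PreExtrap A β := LinearEquiv.refl ℂ X

instance (A : X →ₗ.[ℂ] X) (β : ℂ) : SeminormedAddCommGroup (PreExtrap A β) :=
  SeminormedAddCommGroup.induced (PreExtrap A β) X
    ((resolvent A β : X →ₗ[ℂ] X).comp (PreExtrap.equiv A β).symm.toLinearMap)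

instance (A : X →ₗ.[ℂ] X) (β : ℂ) : NormedSpace ℂ (PreExtrap A β) :=
  NormedSpace.induced ℂ (PreExtrap A β) X
    ((resolvent A β : X →ₗ[ℂ] X).comp (PreExtrap.equiv A β).symm.toLinearMap)

lemma PreExtrap.norm_equiv (A : X →ₗ.[ℂ] X) (β : ℂ) (x : X) :
    ‖PreExtrap.equiv A β x‖ = ‖resolvent A β x‖ := rfl

/-- The extrapolation space `X₋₁`: the completion of `X` for the norm `‖(β - A)⁻¹ x‖`. -/
def Extrap (A : X →ₗ.[ℂ] X) (β : ℂ) : Type _ := UniformSpace.Completion (PreExtrap A β)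

instance (A : X →ₗ.[ℂ] X) (β : ℂ) : NormedAddCommGroup (Extrap A β) :=
  inferInstanceAs (NormedAddCommGroup (UniformSpace.Completion (PreExtrap A β)))

instance (A : X →ₗ.[ℂ] X) (β : ℂ) : NormedSpace ℂ (Extrap A β) :=
  inferInstanceAs (NormedSpace ℂ (UniformSpace.Completion (PreExtrap A β)))

instance (A : X →ₗ.[ℂ] X) (β : ℂ) : CompleteSpace (Extrap A β) :=
  inferInstanceAs (CompleteSpace (UniformSpace.Completion (PreExtrap A β)))

/-- The isometric dense inclusion of `(X, ‖(β - A)⁻¹ ·‖)` into `X₋₁`. -/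
def Extrap.ofPre (A : X →ₗ.[ℂ] X) (β : ℂ) : PreExtrap A β →L[ℂ] Extrap A β :=
  (UniformSpace.Completion.toComplL : PreExtrap A β →L[ℂ] UniformSpace.Completion (PreExtrap A β))

lemma Extrap.norm_ofPre (A : X →ₗ.[ℂ] X) (β : ℂ) (x : PreExtrap A β) :
    ‖Extrap.ofPre A β x‖ = ‖x‖ :=
  UniformSpace.Completion.norm_coe x

lemma Extrap.denseRange_ofPre (A : X →ₗ.[ℂ] X) (β : ℂ) : DenseRange (Extrap.ofPre A β) :=
  UniformSpace.Completion.denseRange_coe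

lemma Extrap.isUniformInducing_ofPre (A : X →ₗ.[ℂ] X) (β : ℂ) :
    IsUniformInducing (Extrap.ofPre A β) :=
  UniformSpace.Completion.isUniformInducing_coe _

/-- The continuous embedding `X ↪ X₋₁`. -/
def Extrap.of (A : X →ₗ.[ℂ] X) (β : ℂ) : X →L[ℂ] Extrap A β :=
  (Extrap.ofPre A β).comp
    ((PreExtrap.equiv A β).toLinearMap.mkContinuous ‖resolvent A β‖
      fun x => (resolvent A β).le_opNorm x)

/-- `T(t)`, as a bounded operator for the norm `‖(β - A)⁻¹ ·‖`. -/
def preExtrapSemigroup {T : C0Semigroup X} {A : X →ₗ.[ℂ] X} (hA : T.IsGenerator A) {β : ℂ}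
    (hβ : β ∈ resolventSet A) (t : ℝ≥0) : PreExtrap A β →L[ℂ] PreExtrap A β :=
  ((PreExtrap.equiv A β).toLinearMap ∘ₗ (T.op t : X →ₗ[ℂ] X) ∘ₗ
    (PreExtrap.equiv A β).symm.toLinearMap).mkContinuous ‖T.op t‖ fun x => by
      change ‖resolvent A β (T.op t ((PreExtrap.equiv A β).symm x))‖ ≤
        ‖T.op t‖ * ‖resolvent A β ((PreExtrap.equiv A β).symm x)‖
      rw [hA.resolvent_op hβ]
      exact (T.op t).le_opNorm _

/-- The extended semigroup `T₋₁(t)` on `X₋₁`. -/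
def extrapSemigroup {T : C0Semigroup X} {A : X →ₗ.[ℂ] X} (hA : T.IsGenerator A) {β : ℂ}
    (hβ : β ∈ resolventSet A) (t : ℝ≥0) : Extrap A β →L[ℂ] Extrap A β :=
  ((Extrap.ofPre A β).comp (preExtrapSemigroup hA hβ t)).extend (Extrap.ofPre A β)

lemma extrapSemigroup_of {T : C0Semigroup X} {A : X →ₗ.[ℂ] X} (hA : T.IsGenerator A) {β : ℂ}
    (hβ : β ∈ resolventSet A) (t : ℝ≥0) (x : X) :
    extrapSemigroup hA hβ t (Extrap.of A β x) = Extrap.of A β (T.op t x) :=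
  ContinuousLinearMap.extend_eq _ (Extrap.denseRange_ofPre A β)
    (Extrap.isUniformInducing_ofPre A β) (PreExtrap.equiv A β x)

/-- `‖(α - A)⁻¹ x‖` is controlled by `‖(β - A)⁻¹ x‖`. -/
lemma norm_resolvent_le {A : X →ₗ.[ℂ] X} {β : ℂ} (hβ : β ∈ resolventSet A) (α : ℂ) (x : X) :
    ‖resolvent A α x‖ ≤ (1 + ‖β - α‖ * ‖resolvent A α‖) * ‖resolvent A β x‖ := by
  by_cases hα : α ∈ resolventSet A
  · obtain ⟨w, hw, hx⟩ := (isResolventAt_resolvent hβ).1 x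
    have h2 := (isResolventAt_resolvent hα).2 w
    have e : x = (α • (w : X) - A w) + (β - α) • (w : X) := by
      rw [← hx, sub_smul]; abel
    have e' : resolvent A α x = resolvent A β x + (β - α) • resolvent A α (resolvent A β x) := by
      rw [← hw]
      conv_lhs => rw [e, map_add, h2, map_smul]
    rw [e']
    calc _ ≤ ‖resolvent A β x‖ + ‖(β - α) • resolvent A α (resolvent A β x)‖ := norm_add_le _ _
      _ ≤ ‖resolvent A β x‖ + ‖β - α‖ * (‖resolvent A α‖ * ‖resolvent A β x‖) := by
        rw [norm_smul]; gcongr; exact (resolvent A α).le_opNorm _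
      _ = _ := by ring
  · have h0 : resolvent A α = 0 := dif_neg hα
    rw [h0]; simp

/-- The extended resolvent `(α - A₋₁)⁻¹ : X₋₁ → X`, the continuous extension of
`(α - A)⁻¹ : X → X`. -/
def extrapResolvent [CompleteSpace X] {A : X →ₗ.[ℂ] X} {β : ℂ} (hβ : β ∈ resolventSet A) (α : ℂ) :
    Extrap A β →L[ℂ] X :=
  (((resolvent A α : X →ₗ[ℂ] X).comp (PreExtrap.equiv A β).symm.toLinearMap).mkContinuous
    (1 + ‖β - α‖ * ‖resolvent A α‖)
    fun x => norm_resolvent_le hβ α ((PreExtrap.equiv A β).symm x)).extend (Extrap.ofPre A β)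

lemma extrapResolvent_of [CompleteSpace X] {A : X →ₗ.[ℂ] X} {β : ℂ} (hβ : β ∈ resolventSet A)
    (α : ℂ) (x : X) : extrapResolvent hβ α (Extrap.of A β x) = resolvent A α x :=
  ContinuousLinearMap.extend_eq _ (Extrap.denseRange_ofPre A β)
    (Extrap.isUniformInducing_ofPre A β) (PreExtrap.equiv A β x)

end Extrapolation

/-! ### The spaces `X_{1/2}` and `X_{-1/2}` of a self-adjoint, strictly negative operator -/

section Half

variable {X : Type*} [NormedAddCommGroup X] [InnerProductSpace ℂ X] [CompleteSpace X]

/-- `A` is self-adjoint and strictly negative: `⟨A z, z⟩ ≤ w_A ‖z‖²` on `D(A)` with `w_A < 0`. -/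
def IsSelfAdjointStrictlyNegative (A : X →ₗ.[ℂ] X) : Prop :=
  IsSelfAdjoint A ∧ ∃ wA < 0, ∀ z : A.domain, (inner ℂ (A z) (z : X)).re ≤ wA * ‖(z : X)‖ ^ 2

variable {A : X →ₗ.[ℂ] X}

lemma IsSelfAdjointStrictlyNegative.inner_symm (hA : IsSelfAdjointStrictlyNegative A)
    (x y : A.domain) : inner ℂ (A x) (y : X) = inner ℂ (x : X) (A y) := by
  have h := LinearPMap.adjoint_isFormalAdjoint hA.1.dense_domain
  rw [LinearPMap.isSelfAdjoint_def.1 hA.1] at h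
  exact h x y

/-- The domain of `A` with the inner product `⟨-A z, w⟩`, i.e. with the norm `√⟨-A z, z⟩`. -/
def PreHalf (_hA : IsSelfAdjointStrictlyNegative A) : Type _ := A.domain

variable (hA : IsSelfAdjointStrictlyNegative A)

instance : AddCommGroup (PreHalf hA) := inferInstanceAs (AddCommGroup A.domain)

instance : Module ℂ (PreHalf hA) := inferInstanceAs (Module ℂ A.domain)

/-- The identity, as a linear equivalence from `D(A)` to its copy with the norm `√⟨-A z, z⟩`. -/
def PreHalf.equiv : A.domain ≃ₗ[ℂ] PreHalf hA := LinearEquiv.refl ℂ A.domain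

/-- The energy inner product `⟨-A z, w⟩`. -/
abbrev PreHalf.core : PreInnerProductSpace.Core ℂ (PreHalf hA) where
  inner z w := inner ℂ (-A ((PreHalf.equiv hA).symm z)) (((PreHalf.equiv hA).symm w : A.domain) : X)
  conj_inner_symm z w := by
    rw [inner_conj_symm, inner_neg_left, inner_neg_right, hA.inner_symm]
  re_inner_nonneg z := by
    obtain ⟨w, hw, h⟩ := hA.2
    have := h ((PreHalf.equiv hA).symm z)
    rw [inner_neg_left]
    simp only [map_neg, RCLike.re_to_complex]
    nlinarith [sq_nonneg ‖(((PreHalf.equiv hA).symm z : A.domain) : X)‖]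
  add_left x y z := by
    rw [map_add, LinearPMap.map_add, neg_add, inner_add_left]
  smul_left x y r := by
    rw [map_smul, LinearPMap.map_smul, ← smul_neg, inner_smul_left]

instance : SeminormedAddCommGroup (PreHalf hA) :=
  @InnerProductSpace.Core.toSeminormedAddCommGroup ℂ (PreHalf hA) _ _ _ (PreHalf.core hA)

instance : InnerProductSpace ℂ (PreHalf hA) := InnerProductSpace.ofCore (PreHalf.core hA)

lemma PreHalf.norm_sq_equiv (z : A.domain) :
    ‖PreHalf.equiv hA z‖ ^ 2 = (inner ℂ (-A z) (z : X)).re :=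
  @norm_sq_eq_re_inner ℂ (PreHalf hA) _ _ _ (PreHalf.equiv hA z)

/-- The space `X_{1/2}`: the completion of `D(A)` for the norm `√⟨-A z, z⟩`. -/
def Half : Type _ := UniformSpace.Completion (PreHalf hA)

instance : NormedAddCommGroup (Half hA) :=
  inferInstanceAs (NormedAddCommGroup (UniformSpace.Completion (PreHalf hA)))

instance : InnerProductSpace ℂ (Half hA) :=
  inferInstanceAs (InnerProductSpace ℂ (UniformSpace.Completion (PreHalf hA)))

instance : CompleteSpace (Half hA) :=
  inferInstanceAs (CompleteSpace (UniformSpace.Completion (PreHalf hA)))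

/-- The isometric dense inclusion of `(D(A), √⟨-A ·, ·⟩)` into `X_{1/2}`. -/
def Half.ofPre : PreHalf hA →L[ℂ] Half hA :=
  (UniformSpace.Completion.toComplL : PreHalf hA →L[ℂ] UniformSpace.Completion (PreHalf hA))

lemma Half.norm_ofPre (z : PreHalf hA) : ‖Half.ofPre hA z‖ = ‖z‖ :=
  UniformSpace.Completion.norm_coe z

lemma Half.denseRange_ofPre : DenseRange (Half.ofPre hA) :=
  UniformSpace.Completion.denseRange_coe

lemma Half.isUniformInducing_ofPre : IsUniformInducing (Half.ofPre hA) :=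
  UniformSpace.Completion.isUniformInducing_coe _

/-- The dense inclusion `D(A) ↪ X_{1/2}`. -/
def Half.of (z : A.domain) : Half hA := Half.ofPre hA (PreHalf.equiv hA z)

lemma PreHalf.exists_bound : ∃ c : ℝ, ∀ z : PreHalf hA,
    ‖(((PreHalf.equiv hA).symm z : A.domain) : X)‖ ≤ c * ‖z‖ := by
  obtain ⟨w, hw, h⟩ := hA.2
  refine ⟨√((-w)⁻¹), fun z => ?_⟩
  have h1 := h ((PreHalf.equiv hA).symm z)
  have h2 := PreHalf.norm_sq_equiv hA ((PreHalf.equiv hA).symm z)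
  rw [LinearEquiv.apply_symm_apply, inner_neg_left, Complex.neg_re] at h2
  refine abs_le_of_sq_le_sq' ?_ (by positivity) |>.2
  rw [mul_pow, Real.sq_sqrt (inv_nonneg.2 (by linarith)), h2, ← div_eq_inv_mul,
    le_div_iff₀ (by linarith)]
  linarith

/-- The continuous embedding `X_{1/2} ↪ X`, the continuous extension of the inclusion of `D(A)`. -/
def Half.toX : Half hA →L[ℂ] X :=
  ((A.domain.subtype.comp (PreHalf.equiv hA).symm.toLinearMap).mkContinuous
    (PreHalf.exists_bound hA).choose (PreHalf.exists_bound hA).choose_spec).extend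
    (Half.ofPre hA)

lemma Half.toX_of (z : A.domain) : Half.toX hA (Half.of hA z) = z :=
  ContinuousLinearMap.extend_eq _ (Half.denseRange_ofPre hA) (Half.isUniformInducing_ofPre hA)
    (PreHalf.equiv hA z)

/-- The vector space `X` with the dual norm
`sup {|⟨x, z⟩| : z ∈ X_{1/2}, ‖z‖_{X_{1/2}} ≤ 1}` with respect to the pivot space `X`. -/
def PreNegHalf (_hA : IsSelfAdjointStrictlyNegative A) : Type _ := X

instance : AddCommGroup (PreNegHalf hA) := inferInstanceAs (AddCommGroup X)

instance : Module ℂ (PreNegHalf hA) := inferInstanceAs (Module ℂ X)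

/-- The identity, as a linear equivalence from `X` to its copy with the dual norm. -/
def PreNegHalf.equiv : X ≃ₗ[ℂ] PreNegHalf hA := LinearEquiv.refl ℂ X

/-- The (conjugate linear) map sending `x` to the bounded functional `⟨x, ·⟩` on `X_{1/2}`. -/
def PreNegHalf.functional : PreNegHalf hA →ₛₗ[starRingEnd ℂ] StrongDual ℂ (Half hA) where
  toFun x := (innerSL ℂ ((PreNegHalf.equiv hA).symm x)).comp (Half.toX hA)
  map_add' x y := by ext z; simp
  map_smul' c x := by ext z; simp

instance : SeminormedAddCommGroup (PreNegHalf hA) :=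
  SeminormedAddCommGroup.induced (PreNegHalf hA) (StrongDual ℂ (Half hA))
    (PreNegHalf.functional hA)

instance : NormedSpace ℂ (PreNegHalf hA) where
  norm_smul_le c x := by
    change ‖PreNegHalf.functional hA (c • x)‖ ≤ ‖c‖ * ‖PreNegHalf.functional hA x‖
    rw [map_smulₛₗ, norm_smul, RCLike.norm_conj]

lemma PreNegHalf.norm_equiv (x : X) :
    ‖PreNegHalf.equiv hA x‖ = ‖(innerSL ℂ x).comp (Half.toX hA)‖ := rfl

/-- The space `X_{-1/2}`: the dual of `X_{1/2}` with respect to the pivot space `X`, i.e. the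
completion of `X` for the dual norm. -/
def NegHalf : Type _ := UniformSpace.Completion (PreNegHalf hA)

instance : NormedAddCommGroup (NegHalf hA) :=
  inferInstanceAs (NormedAddCommGroup (UniformSpace.Completion (PreNegHalf hA)))

instance : NormedSpace ℂ (NegHalf hA) :=
  inferInstanceAs (NormedSpace ℂ (UniformSpace.Completion (PreNegHalf hA)))

instance : CompleteSpace (NegHalf hA) :=
  inferInstanceAs (CompleteSpace (UniformSpace.Completion (PreNegHalf hA)))

/-- The isometric dense inclusion of `X` with the dual norm into `X_{-1/2}`. -/
def NegHalf.ofPre : PreNegHalf hA →L[ℂ] NegHalf hA :=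
  (UniformSpace.Completion.toComplL :
    PreNegHalf hA →L[ℂ] UniformSpace.Completion (PreNegHalf hA))

lemma NegHalf.norm_ofPre (x : PreNegHalf hA) : ‖NegHalf.ofPre hA x‖ = ‖x‖ :=
  UniformSpace.Completion.norm_coe x

lemma NegHalf.denseRange_ofPre : DenseRange (NegHalf.ofPre hA) :=
  UniformSpace.Completion.denseRange_coe

lemma NegHalf.isUniformInducing_ofPre : IsUniformInducing (NegHalf.ofPre hA) :=
  UniformSpace.Completion.isUniformInducing_coe _

/-- The dual norm dominates the norm of `X₋₁`. -/
lemma PreNegHalf.exists_bound {β : ℂ} (hβ : β ∈ resolventSet A) :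
    ∃ c : ℝ, ∀ x : PreNegHalf hA,
      ‖PreExtrap.equiv A β ((PreNegHalf.equiv hA).symm x)‖ ≤ c * ‖x‖ := by
  obtain ⟨hR1, hR2⟩ := isResolventAt_resolvent hβ
  set R := resolvent A β with hR
  set S := ContinuousLinearMap.adjoint R with hS
  set k : ℝ := ‖S‖ * (‖β‖ * ‖S‖ + 1) with hk
  have hk0 : 0 ≤ k := by positivity
  refine ⟨√k, fun x' => ?_⟩
  obtain ⟨x, rfl⟩ := (PreNegHalf.equiv hA).surjective x'
  rw [LinearEquiv.symm_apply_apply, PreExtrap.norm_equiv, ← hR]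
  set w := R x with hw
  -- the vector `R* w` lies in the domain of `A`
  have key : ∀ z : A.domain,
      inner ℂ ((starRingEnd ℂ) β • S w - w) (z : X) = inner ℂ (S w) (A z) := by
    intro z
    have e : R (A z) = β • R z - (z : X) := by
      have := hR2 z
      rw [map_sub, map_smul] at this
      exact eq_sub_of_add_eq' (sub_eq_iff_eq_add.1 this).symm
    rw [hS, ContinuousLinearMap.adjoint_inner_left, e, inner_sub_left, inner_sub_right,
      inner_smul_left, inner_smul_right, ContinuousLinearMap.adjoint_inner_left]
    simp
  have hdom : S w ∈ A.adjoint.domain := LinearPMap.mem_adjoint_domain_of_exists _ ⟨_, key⟩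
  have hval : A.adjoint ⟨S w, hdom⟩ = (starRingEnd ℂ) β • S w - w :=
    LinearPMap.adjoint_apply_eq hA.1.dense_domain ⟨S w, hdom⟩ key
  have hg : (S w, (starRingEnd ℂ) β • S w - w) ∈ A.graph := by
    have := LinearPMap.mem_graph A.adjoint ⟨S w, hdom⟩
    rw [hval] at this
    have e : A.adjoint.graph = A.graph := by rw [LinearPMap.isSelfAdjoint_def.1 hA.1]
    rwa [e] at this
  obtain ⟨v, hv, hAv⟩ := (LinearPMap.mem_graph_iff A).1 hg
  simp only at hv hAv
  have hSw : ‖S w‖ ≤ ‖S‖ * ‖w‖ := S.le_opNorm w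
  have hvn : ‖PreHalf.equiv hA v‖ ≤ √k * ‖w‖ := by
    refine abs_le_of_sq_le_sq' ?_ (by positivity) |>.2
    rw [PreHalf.norm_sq_equiv, hAv, hv, mul_pow, Real.sq_sqrt hk0]
    calc _ ≤ ‖inner ℂ (-((starRingEnd ℂ) β • S w - w)) (S w)‖ := Complex.re_le_norm _
      _ ≤ ‖-((starRingEnd ℂ) β • S w - w)‖ * ‖S w‖ := norm_inner_le_norm _ _
      _ ≤ (‖β‖ * (‖S‖ * ‖w‖) + ‖w‖) * (‖S‖ * ‖w‖) := by
        gcongr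
        rw [norm_neg]
        refine (norm_sub_le _ _).trans ?_
        rw [norm_smul, RCLike.norm_conj]
        gcongr
      _ = k * ‖w‖ ^ 2 := by rw [hk]; ring
  have hsq : ‖w‖ ^ 2 ≤ (√k * ‖PreNegHalf.equiv hA x‖) * ‖w‖ := by
    have h1 : inner ℂ x (S w) = inner ℂ w w := by
      rw [hS, ContinuousLinearMap.adjoint_inner_right]
    have h2 : ‖inner ℂ x (S w)‖ ≤ ‖PreNegHalf.equiv hA x‖ * ‖PreHalf.equiv hA v‖ := by
      have h3 := ((innerSL ℂ x).comp (Half.toX hA)).le_opNorm (Half.of hA v)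
      rw [ContinuousLinearMap.comp_apply, Half.toX_of, hv] at h3
      simpa [Half.of, Half.norm_ofPre, PreNegHalf.norm_equiv] using h3
    rw [h1, inner_self_eq_norm_sq_to_K] at h2
    simp only [Complex.coe_algebraMap, norm_pow, Complex.norm_real, norm_norm] at h2
    nlinarith [norm_nonneg (PreNegHalf.equiv hA x)]
  rcases (norm_nonneg w).eq_or_lt with h0 | h0
  · rw [← h0]; positivity
  · nlinarith

/-- The continuous embedding `X_{-1/2} ↪ X₋₁`, the continuous extension of the identity of `X`. -/
def NegHalf.toExtrap {β : ℂ} (hβ : β ∈ resolventSet A) : NegHalf hA →L[ℂ] Extrap A β :=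
  ((Extrap.ofPre A β).comp
    (((PreExtrap.equiv A β).toLinearMap.comp (PreNegHalf.equiv hA).symm.toLinearMap).mkContinuous
      (PreNegHalf.exists_bound hA hβ).choose (PreNegHalf.exists_bound hA hβ).choose_spec)).extend
    (NegHalf.ofPre hA)

lemma NegHalf.toExtrap_of {β : ℂ} (hβ : β ∈ resolventSet A) (x : X) :
    NegHalf.toExtrap hA hβ (NegHalf.ofPre hA (PreNegHalf.equiv hA x)) =
      Extrap.of A β x :=
  ContinuousLinearMap.extend_eq _ (NegHalf.denseRange_ofPre hA)
    (NegHalf.isUniformInducing_ofPre hA) (PreNegHalf.equiv hA x)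

end Half

/-! ### The bilinear feedback system -/

/-- A bilinear feedback system
`z' = A z + B₁ u₁ + B₂ u₂`, `z(0) = z₀`, `y = C z`, `u₂ = N(z, y)`
on Hilbert spaces `X` (states), `U₁`, `U₂` (inputs) and `Y` (outputs). -/
structure System (X U₁ U₂ Y : Type*)
    [NormedAddCommGroup X] [InnerProductSpace ℂ X] [CompleteSpace X]
    [NormedAddCommGroup U₁] [InnerProductSpace ℂ U₁] [CompleteSpace U₁]
    [NormedAddCommGroup U₂] [InnerProductSpace ℂ U₂] [CompleteSpace U₂]
    [NormedAddCommGroup Y] [InnerProductSpace ℂ Y] [CompleteSpace Y] where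
  /-- the semigroup -/
  T : C0Semigroup X
  /-- its generator -/
  A : X →ₗ.[ℂ] X
  isGenerator : T.IsGenerator A
  /-- the point of `ρ(A)` used in the norms of `X₁` and `X₋₁` -/
  β : ℂ
  β_mem : β ∈ resolventSet A
  /-- the control operators -/
  B₁ : U₁ →L[ℂ] Extrap A β
  B₂ : U₂ →L[ℂ] Extrap A β
  /-- the continuous embedding `Y ⊆ X` -/
  incl : Y →L[ℂ] X
  incl_injective : Function.Injective incl
  /-- the observation operator -/
  C : X1 A β →L[ℂ] Y
  /-- its bounded extension to `X` -/
  CX : X →L[ℂ] X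
  CX_eq : ∀ x : X1 A β, CX x.val = incl (C x)
  /-- the bilinear feedback law -/
  N : X →L[ℂ] Y →L[ℂ] U₂
  N_bound : ∃ K > 0, ∃ p ∈ Ioo (0 : ℝ) 1, ∀ (z : X) (y : Y),
    ‖N z y‖ ≤ K * ‖z‖ * ‖incl y‖ ^ (1 - p) * ‖y‖ ^ p

/-- Lebesgue measure on `(0, t)`. -/
abbrev vol (t : ℝ) : Measure ℝ := volume.restrict (Ioo 0 t)

/-- Lebesgue measure on `(0, ∞)`. -/
abbrev volInf : Measure ℝ := volume.restrict (Ioi 0)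

section WeightedL2

variable {U : Type*} [NormedAddCommGroup U] [NormedSpace ℂ U]

/-- `u ∈ L²_ω(0, ∞; U)`. -/
def MemL2w (ω : ℝ) (u : ℝ → U) : Prop :=
  MemLp u 2 volInf ∧ MemLp (fun s => Real.exp (ω * s) • u s) 2 volInf

/-- The norm `‖e^{ω ·} u‖_{L²(I; U)}`. -/
def normL2w (ω : ℝ) (I : Set ℝ) (u : ℝ → U) : ℝ :=
  (eLpNorm (fun s => Real.exp (ω * s) • u s) 2 (volume.restrict I)).toReal

end WeightedL2

namespace System

variable {X U₁ U₂ Y : Type*}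
  [NormedAddCommGroup X] [InnerProductSpace ℂ X] [CompleteSpace X]
  [NormedAddCommGroup U₁] [InnerProductSpace ℂ U₁] [CompleteSpace U₁]
  [NormedAddCommGroup U₂] [InnerProductSpace ℂ U₂] [CompleteSpace U₂]
  [NormedAddCommGroup Y] [InnerProductSpace ℂ Y] [CompleteSpace Y]
  {U : Type*} [NormedAddCommGroup U] [InnerProductSpace ℂ U] [CompleteSpace U]
  (S : System X U₁ U₂ Y)

/-- The embedding `X ↪ X₋₁`. -/
def toExtrap : X →L[ℂ] Extrap S.A S.β := Extrap.of S.A S.β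

/-- The operator `T₋₁(t)`. -/
def Tm1 (t : ℝ≥0) : Extrap S.A S.β →L[ℂ] Extrap S.A S.β :=
  extrapSemigroup S.isGenerator S.β_mem t

/-- The operator `(α - A₋₁)⁻¹ : X₋₁ → X`. -/
def Rm1 (α : ℂ) : Extrap S.A S.β →L[ℂ] X := extrapResolvent S.β_mem α

/-- `x ∈ D(A)` and `C x = y`. -/
def ObservedAs (x : X) (y : Y) : Prop := ∃ w : X1 S.A S.β, w.val = x ∧ S.C w = y

/-- The input map `Φ_t u = ∫₀ᵗ T₋₁(t - s) B u(s) ds`, computed in `X₋₁`. -/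
def Phi (B : U →L[ℂ] Extrap S.A S.β) (t : ℝ) (u : ℝ → U) : Extrap S.A S.β :=
  ∫ s in (0 : ℝ)..t, S.Tm1 (t - s).toNNReal (B (u s))

/-- `B` is an `L²`-admissible control operator: `Φ_t` is a bounded operator from
`L²(0, ∞; U)` to `X`. -/
def IsAdmissibleControl (B : U →L[ℂ] Extrap S.A S.β) : Prop :=
  ∀ t > 0, ∃ Φ : Lp U 2 volInf →L[ℂ] X, ∀ u, S.toExtrap (Φ u) = S.Phi B t u

/-- `Ψ` is the output map `Ψ_t : X → L²(0, t; Y)`, the bounded extension of `x ↦ C T(·) x`,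
`x ∈ D(A)`. -/
def IsOutputMap (t : ℝ) (Ψ : X →L[ℂ] Lp Y 2 (vol t)) : Prop :=
  ∀ x : S.A.domain, ∀ᵐ s ∂(vol t), S.ObservedAs (S.T.op s.toNNReal x) (Ψ x s)

/-- `C` is an `L²`-admissible observation operator. -/
def IsAdmissibleObservation : Prop := ∀ t > 0, ∃ Ψ, S.IsOutputMap t Ψ

/-- `G` is a transfer function of `(A, B, C)`:
`G(α) - G(β) = C [(α - A₋₁)⁻¹ - (β - A₋₁)⁻¹] B` on the half-plane `Re > ω₀(T)`. -/
def IsTransferFunction (B : U →L[ℂ] Extrap S.A S.β) (G : ℂ → U →L[ℂ] Y) : Prop :=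
  ∀ α ∈ S.T.growthHalfPlane, ∀ β ∈ S.T.growthHalfPlane, ∀ u,
    S.ObservedAs (S.Rm1 α (B u) - S.Rm1 β (B u)) (G α u - G β u)

/-- `G` is the transfer function belonging to the output equation `y = C z` (without additional
feedthrough), `G(α) = C (α - A₋₁)⁻¹ B`, where `C` is extended to `X`. This fixes the additive
constant operator left open by `IsTransferFunction`. -/
def IsOutputTransferFunction (B : U →L[ℂ] Extrap S.A S.β) (G : ℂ → U →L[ℂ] Y) : Prop :=
  S.IsTransferFunction B G ∧
    ∀ α ∈ S.T.growthHalfPlane, ∀ u, S.incl (G α u) = S.CX (S.Rm1 α (B u))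

/-- The linear system associated with `S` is well-posed. -/
def WellPosed : Prop :=
  S.IsAdmissibleControl S.B₁ ∧ S.IsAdmissibleControl S.B₂ ∧ S.IsAdmissibleObservation ∧
  (∃ G : ℂ → U₁ →L[ℂ] Y, S.IsTransferFunction S.B₁ G ∧
    ∃ γ M : ℝ, ∀ α : ℂ, γ < α.re → α ∈ S.T.growthHalfPlane ∧ ‖G α‖ ≤ M) ∧
  (∃ G : ℂ → U₂ →L[ℂ] Y, S.IsTransferFunction S.B₂ G ∧
    ∃ γ M : ℝ, ∀ α : ℂ, γ < α.re → α ∈ S.T.growthHalfPlane ∧ ‖G α‖ ≤ M)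

/-- `F` is the input-output map `𝔽_t` belonging to `B` and the transfer function `G`: the bounded
operator `L²(0, t; U) → L²(0, t; Y)` with
`(F u)(s) = C [∫₀ˢ T₋₁(s - r) B u(r) dr - (α - A₋₁)⁻¹ B u(s)] + G(α) u(s)`
for `u ∈ W^{1,2}_loc(0, ∞; U)` with `u(0) = 0`, that is, `u(s) = ∫₀ˢ v(r) dr` with
`v ∈ L²_loc`. -/
def IsInputOutputMap (B : U →L[ℂ] Extrap S.A S.β) (G : ℂ → U →L[ℂ] Y) (t : ℝ)
    (F : Lp U 2 (vol t) →L[ℂ] Lp Y 2 (vol t)) : Prop :=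
  ∀ u v : ℝ → U, (∀ τ, MemLp v 2 (vol τ)) → (∀ s ≥ 0, u s = ∫ r in (0 : ℝ)..s, v r) →
    ∀ (hu : MemLp u 2 (vol t)), ∀ α ∈ S.T.growthHalfPlane,
      ∀ᵐ s ∂(vol t), ∃ x : X,
        S.toExtrap x = S.Phi B s u - S.toExtrap (S.Rm1 α (B (u s))) ∧
        S.ObservedAs x (F hu.toLp s - G α (u s))

/-- `z ∈ C([0, ∞); X)` and `y ∈ L²_loc(0, ∞; Y)` are a solution and output of the bilinear feedback
system with input data `z₀`, `u₁`:
`z(t) = T(t) z₀ + Φ¹_t u₁ + Φ²_t N(z, y)` and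
`y|_{[0,t]} = Ψ_t z₀ + 𝔽¹_t u₁ + 𝔽²_t N(z, y)`. -/
structure IsSolution (z₀ : X) (u₁ : ℝ → U₁) (z : ℝ → X) (y : ℝ → Y) : Prop where
  continuousOn : ContinuousOn z (Ici 0)
  memLp : ∀ t, MemLp y 2 (vol t)
  state : ∀ t ≥ 0, S.toExtrap (z t) = S.toExtrap (S.T.op t.toNNReal z₀) + S.Phi S.B₁ t u₁ +
    S.Phi S.B₂ t (fun s => S.N (z s) (y s))
  output : ∃ G₁ G₂, S.IsOutputTransferFunction S.B₁ G₁ ∧ S.IsOutputTransferFunction S.B₂ G₂ ∧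
    ∀ t > 0, ∃ Ψ F₁ F₂, S.IsOutputMap t Ψ ∧
      S.IsInputOutputMap S.B₁ G₁ t F₁ ∧ S.IsInputOutputMap S.B₂ G₂ t F₂ ∧
      ∃ (h₁ : MemLp u₁ 2 (vol t)) (h₂ : MemLp (fun s => S.N (z s) (y s)) 2 (vol t)),
        y =ᵐ[vol t] ⇑(Ψ z₀ + F₁ h₁.toLp + F₂ h₂.toLp)

/-- `A` is self-adjoint and strictly negative, `B_i ∈ L(U_i, X_{-1/2})` and `C ∈ L(X_{1/2}, Y)`. -/
def IsSelfAdjointType : Prop :=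
  ∃ hA : IsSelfAdjointStrictlyNegative S.A,
    (∃ B₁' : U₁ →L[ℂ] NegHalf hA, ∀ u, S.B₁ u = NegHalf.toExtrap hA S.β_mem (B₁' u)) ∧
    (∃ B₂' : U₂ →L[ℂ] NegHalf hA, ∀ u, S.B₂ u = NegHalf.toExtrap hA S.β_mem (B₂' u)) ∧
    (∃ C' : Half hA →L[ℂ] Y, ∀ x : S.A.domain, S.C x = C' (Half.of hA x))

/-- `A = A₀ + L` with `A₀` skew-adjoint and `L` bounded and strictly dissipative,
`B_i ∈ L(U_i, X)` and `C ∈ L(X, Y)`. -/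
def IsSkewAdjointType : Prop :=
  (∃ (A₀ : X →ₗ.[ℂ] X) (L : X →L[ℂ] X),
    Dense (A₀.domain : Set X) ∧ A₀.adjoint = -A₀ ∧
    (∃ wA < 0, ∀ z, (inner ℂ (L z) z).re ≤ wA * ‖z‖ ^ 2) ∧
    S.A = A₀ + (L : X →ₗ[ℂ] X).toPMap ⊤) ∧
  (∃ B₁' : U₁ →L[ℂ] X, ∀ u, S.B₁ u = S.toExtrap (B₁' u)) ∧
  (∃ B₂' : U₂ →L[ℂ] X, ∀ u, S.B₂ u = S.toExtrap (B₂' u)) ∧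
  (∃ C' : X →L[ℂ] Y, ∀ x : X1 S.A S.β, S.C x = C' x.val)

end System

/-! ### Local input-to-state stability -/

/-- Comparison functions of class `KL`, given on `[0, ∞)²`. -/
structure IsKL (b : ℝ → ℝ → ℝ) : Prop where
  continuousOn : ContinuousOn (fun q : ℝ × ℝ => b q.1 q.2) (Ici 0 ×ˢ Ici 0)
  nonneg : ∀ s ≥ 0, ∀ t ≥ 0, 0 ≤ b s t
  zero : ∀ t ≥ 0, b 0 t = 0
  strictMono : ∀ t ≥ 0, StrictMonoOn (fun s => b s t) (Ici 0)
  strictAnti : ∀ s > 0, StrictAntiOn (b s) (Ici 0)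
  tendsto : ∀ s > 0, Tendsto (b s) atTop (𝓝 0)

/-- Comparison functions of class `K_∞`, given on `[0, ∞)`. -/
structure IsKInfty (g : ℝ → ℝ) : Prop where
  continuousOn : ContinuousOn g (Ici 0)
  zero : g 0 = 0
  strictMono : StrictMonoOn g (Ici 0)
  tendsto : Tendsto g atTop atTop

/-- The system is locally `L²_ω`-input-to-state stable. -/
def System.IsLocallyISS {X U₁ U₂ Y : Type*}
    [NormedAddCommGroup X] [InnerProductSpace ℂ X] [CompleteSpace X]
    [NormedAddCommGroup U₁] [InnerProductSpace ℂ U₁] [CompleteSpace U₁]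
    [NormedAddCommGroup U₂] [InnerProductSpace ℂ U₂] [CompleteSpace U₂]
    [NormedAddCommGroup Y] [InnerProductSpace ℂ Y] [CompleteSpace Y]
    (S : System X U₁ U₂ Y) (ω : ℝ) : Prop :=
  ∃ b g, IsKL b ∧ IsKInfty g ∧ ∃ ε > 0, ∀ (z₀ : X) (u₁ : ℝ → U₁), MemL2w ω u₁ →
    ‖z₀‖ + normL2w ω (Ioi 0) u₁ ≤ ε →
    ∃ z y, S.IsSolution z₀ u₁ z y ∧
      ∀ t ≥ 0, ‖z t‖ ≤ b ‖z₀‖ t + g (normL2w ω (Ioo 0 t) u₁)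

end BilinearFeedback

end

/-!
Both classes of systems fit into one abstract setting (`GelfandFrame`, `System.Factorization`):
there are spaces `V ⊆ X ⊆ W`, in duality with respect to the pivot space `X`, such that `Re ⟨A x,
x⟩ ≤ -κ ‖x‖_V²` on `D(A)` for some `κ > 0`, the control operators take values in `W` and the
observation operator is bounded on `V`. For a self-adjoint `A` these are the spaces `X_{1/2} ⊆ X ⊆
X_{-1/2}`, with `κ = 1`; for a bounded, strictly dissipative perturbation of a skew-adjoint
operator all three spaces are `X`. All identities in `X₋₁` are transported to `X` by the isometry
`(β - A₋₁)⁻¹`.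

For classical solutions of `z' = A z + f` coercivity gives, for every real `ν`, the energy
estimate `e^{2νt} ‖z(t)‖² + κ ‖e^{ν ·} z‖²_{L²(0,t;V)} ≤ ‖z(0)‖² + 2ν ‖e^{ν ·} z‖²_{L²(0,t;X)} +
κ⁻¹ ‖e^{ν ·} f‖²_{L²(0,t;W)}`. By density there is a mild solution for every `f ∈ L²(0, t; W)`,
which satisfies the same estimate (`GelfandFrame.exists_isMild`,
`GelfandFrame.IsMild.hasEnergyBound`). Composing the solution operator with the observation
operator gives the output and input-output maps, while the bound on the resolvents from `W` to `V`
gives the bounded transfer function. Hence the linear system is well-posed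
(`System.Factorization.wellPosed`). As the output and input-output maps are determined by their
values on dense subspaces, a solution of the feedback system is the same as a mild solution of `z'
= A z + B₁ u₁ + B₂ N(z, c z)` with values in `V` (`exists_isFeedbackMild`,
`isSolution_of_isFeedbackMild`).

The nonlinear part consists of three applications of the energy estimate, with different weights.

* `ν = 0`: since `N` maps `L^∞(X) × L²(V)` to `L²(U₂)`, small global solutions are fixed points of
  a contraction on a ball of `L²(0, ∞; U₂)` (`exists_small_solution`).
* `ν > 0` small: if `‖z‖` is small, both the feedback term and the term `2ν ‖e^{ν ·} z‖²` are
  absorbed by the dissipated energy, which gives the decay (`IsFeedbackMild.norm_le_exp`).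
* `ν` large negative: the small solution is compared with an arbitrary one. The interpolation
  inequality for `N` and Young's inequality bound the part of the difference of the feedback terms
  that involves the large solution by a small multiple of the `V`-norm, which is absorbed by the
  dissipated energy, and a large multiple of the `X`-norm, which is absorbed by the weight; the
  other part is absorbed because the first solution is small (`IsFeedbackMild.eq_of_normL2w_le`).
-/

namespace BilinearFeedback

/-! ### Orbits of a semigroup -/

section Orbits

variable {X : Type*} [NormedAddCommGroup X] [NormedSpace ℂ X]
  {T : C0Semigroup X} {A : X →ₗ.[ℂ] X} {β : ℂ}

lemma C0Semigroup.continuous_orbit (T : C0Semigroup X) (x : X) :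
    Continuous fun s : ℝ => T.op s.toNNReal x :=
  (T.strongly_continuous x).comp continuous_real_toNNReal

lemma C0Semigroup.op_add_apply (T : C0Semigroup X) (s t : ℝ≥0) (x : X) :
    T.op (s + t) x = T.op s (T.op t x) := by
  rw [T.map_add, ContinuousLinearMap.comp_apply]

lemma C0Semigroup.op_comm (T : C0Semigroup X) (s t : ℝ≥0) (x : X) :
    T.op s (T.op t x) = T.op t (T.op s x) := by
  rw [← T.op_add_apply, add_comm, T.op_add_apply]

lemma C0Semigroup.op_zero_apply (T : C0Semigroup X) (x : X) : T.op 0 x = x := by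
  rw [T.map_zero]; rfl

/-- An orbit starting in `D(A)` is right differentiable, with derivative `T(t) A x`. -/
lemma C0Semigroup.IsGenerator.hasDerivWithinAt_orbit (hA : T.IsGenerator A) {x y : X}
    (h : (x, y) ∈ A.graph) {t : ℝ} (ht : 0 ≤ t) :
    HasDerivWithinAt (fun s : ℝ => T.op s.toNNReal x) (T.op t.toNNReal y) (Ioi t) t := by
  rw [hasDerivWithinAt_iff_tendsto_slope' (by simp)]
  have hlim := ((T.op t.toNNReal).continuous.tendsto y).comp ((hA x y).1 h)
  have hmap : Tendsto (fun s : ℝ => (s - t).toNNReal) (𝓝[>] t) (𝓝[>] 0) := by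
    refine tendsto_nhdsWithin_iff.2 ⟨?_, ?_⟩
    · have : Continuous fun s : ℝ => (s - t).toNNReal := by fun_prop
      have h0 := this.tendsto t
      simp only [sub_self, Real.toNNReal_zero] at h0
      exact h0.mono_left nhdsWithin_le_nhds
    · filter_upwards [self_mem_nhdsWithin] with s hs
      simpa using hs
  refine (hlim.comp hmap).congr' ?_
  filter_upwards [self_mem_nhdsWithin] with s hs
  have hs' : t < s := hs
  have e : s.toNNReal = t.toNNReal + (s - t).toNNReal := by
    rw [← Real.toNNReal_add ht (by linarith)]; congr 1; ring
  simp only [Function.comp_apply, slope_def_module]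
  rw [e, T.op_add_apply, map_smul, map_sub, Real.coe_toNNReal _ (by linarith),
    ← Complex.ofReal_inv, Complex.coe_smul]

/-- The resolvent maps into `D(A)`, and `A (β - A)⁻¹ x = β (β - A)⁻¹ x - x`. -/
lemma resolvent_mem_graph (hβ : β ∈ resolventSet A) (x : X) :
    (resolvent A β x, β • resolvent A β x - x) ∈ A.graph := by
  obtain ⟨w, hw, hx⟩ := (isResolventAt_resolvent hβ).1 x
  refine (LinearPMap.mem_graph_iff A).2 ⟨w, hw, ?_⟩
  simp only
  rw [← hw, ← hx]; abel

/-- `(β - A)⁻¹ x`, as an element of `D(A)`. -/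
noncomputable def resolventDom (hβ : β ∈ resolventSet A) : X →ₗ[ℂ] A.domain :=
  (resolvent A β : X →ₗ[ℂ] X).codRestrict A.domain fun x =>
    LinearPMap.mem_domain_of_mem_graph (resolvent_mem_graph hβ x)

@[simp] lemma coe_resolventDom (hβ : β ∈ resolventSet A) (x : X) :
    (resolventDom hβ x : X) = resolvent A β x := rfl

lemma apply_resolventDom (hβ : β ∈ resolventSet A) (x : X) :
    A (resolventDom hβ x) = β • resolvent A β x - x := by
  obtain ⟨w, hw, hx⟩ := (LinearPMap.mem_graph_iff A).1 (resolvent_mem_graph hβ x)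
  have : w = resolventDom hβ x := Subtype.ext hw
  rw [← this, hx]

lemma resolventDom_surjective (hβ : β ∈ resolventSet A) (w : A.domain) :
    ∃ x, resolventDom hβ x = w :=
  ⟨β • (w : X) - A w, Subtype.ext ((isResolventAt_resolvent hβ).2 w)⟩

lemma resolvent_injective (hβ : β ∈ resolventSet A) : Function.Injective (resolvent A β) := by
  rw [injective_iff_map_eq_zero]
  intro x hx
  have h1 := apply_resolventDom hβ x
  have h0 : resolventDom hβ x = 0 := Subtype.ext hx
  rw [h0, hx] at h1
  simpa using h1.symm

/-- The resolvent identity, as `R(α) = R(β) + (β - α) R(α) R(β)`. -/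
lemma resolvent_apply_eq {α : ℂ} (hα : α ∈ resolventSet A) (hβ : β ∈ resolventSet A) (x : X) :
    resolvent A α x = resolvent A β x + (β - α) • resolvent A α (resolvent A β x) := by
  have h2 := (isResolventAt_resolvent hα).2 (resolventDom hβ x)
  rw [apply_resolventDom, coe_resolventDom] at h2
  have e : x = (α • resolvent A β x - (β • resolvent A β x - x)) + (β - α) • resolvent A β x := by
    rw [sub_smul]; abel
  conv_lhs => rw [e, map_add, h2, map_smul]

lemma C0Semigroup.IsGenerator.integral_orbit [CompleteSpace X] (hA : T.IsGenerator A) {x y : X}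
    (h : (x, y) ∈ A.graph) {t : ℝ} (ht : 0 ≤ t) :
    ∫ s in (0 : ℝ)..t, T.op s.toNNReal y = T.op t.toNNReal x - x := by
  rw [intervalIntegral.integral_eq_sub_of_hasDeriv_right
    (f := fun s : ℝ => T.op s.toNNReal x) (T.continuous_orbit x).continuousOn
    (fun s hs => hA.hasDerivWithinAt_orbit h ?_) ((T.continuous_orbit y).intervalIntegrable _ _)]
  · simp [T.op_zero_apply]
  · rw [min_eq_left ht] at hs; exact hs.1.le

/-- Each point of the open half-plane `Re α > ω₀(T)` belongs to the resolvent set: for large `t` the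
operator `1 - e^{-α t} T(t)` is invertible, and `(α - A)⁻¹` is its inverse composed with
`∫₀ᵗ e^{-α s} T(s) ds`. -/
lemma C0Semigroup.IsGenerator.growthHalfPlane_subset [CompleteSpace X] (hA : T.IsGenerator A)
    (hβ : β ∈ resolventSet A) : T.growthHalfPlane ⊆ resolventSet A := by
  rintro α ⟨w, hw, M, hM⟩
  -- a time at which the weighted semigroup is a strict contraction
  obtain ⟨t, ht0, ht⟩ : ∃ t : ℝ≥0, 0 < t ∧ ‖Complex.exp (-α * (t : ℝ)) • T.op t‖ < 1 := by
    have hlim : Tendsto (fun t : ℝ => M * Real.exp (-((α.re - w) * t))) atTop (𝓝 (M * 0)) := by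
      refine Tendsto.const_mul _ (Real.tendsto_exp_neg_atTop_nhds_zero.comp ?_)
      exact tendsto_id.const_mul_atTop (by linarith)
    rw [mul_zero] at hlim
    obtain ⟨t, ht, ht'⟩ := ((hlim.eventually_lt_const one_pos).and (eventually_gt_atTop 0)).exists
    refine ⟨⟨t, ht'.le⟩, ht', lt_of_le_of_lt ?_ ht⟩
    rw [norm_smul, Complex.norm_exp]
    calc _ ≤ Real.exp (-α * (t : ℂ)).re * (M * Real.exp (w * t)) :=
          mul_le_mul_of_nonneg_left (hM ⟨t, ht'.le⟩) (Real.exp_pos _).le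
      _ = M * Real.exp (-((α.re - w) * t)) := by
          rw [mul_left_comm, ← Real.exp_add]; congr 2
          simp; ring
  set S : X →L[ℂ] X := Complex.exp (-α * (t : ℝ)) • T.op t with hS
  set V : X →L[ℂ] X := Units.val (Units.oneSub S ht)⁻¹ with hV
  have hVl : ∀ x, V (x - S x) = x := fun x => by
    have := congrArg (fun f : X →L[ℂ] X => f x) (Units.oneSub S ht).inv_mul
    simpa using this
  have hVr : ∀ x, V x - S (V x) = x := fun x => by
    have := congrArg (fun f : X →L[ℂ] X => f x) (Units.oneSub S ht).mul_inv
    simpa using this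
  set R := resolvent A β with hR
  -- the weighted orbits and their integrals
  set e : ℝ → X → X := fun s x => Complex.exp (-α * s) • T.op s.toNNReal x with he
  have hec : ∀ x, Continuous fun s => e s x := fun x =>
    (by fun_prop : Continuous fun s : ℝ => Complex.exp (-α * s)).smul (T.continuous_orbit x)
  have heint : ∀ x, IntervalIntegrable (fun s => e s x) volume 0 t :=
    fun x => (hec x).intervalIntegrable _ _
  set I : X → X := fun x => ∫ s in (0 : ℝ)..t, e s x with hI
  have hIadd : ∀ x y, I (x + y) = I x + I y := fun x y => by
    simp only [hI]
    rw [← intervalIntegral.integral_add (heint x) (heint y)]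
    simp [he]
  have hIsmul : ∀ (c : ℂ) x, I (c • x) = c • I x := fun c x => by
    simp only [hI]
    rw [← intervalIntegral.integral_smul]
    simp [he, smul_comm c]
  have hIV : ∀ x, I (V x) = V (I x) := by
    have hIS : ∀ x, I (S x) = S (I x) := fun x => by
      simp only [hI]
      rw [← S.intervalIntegral_comp_comm (heint x)]
      refine intervalIntegral.integral_congr fun s _ => ?_
      simp only [he, hS, smul_apply, map_smul]
      rw [T.op_comm, smul_comm]
    intro x
    have h1 : I (V x) - S (I (V x)) = I x := by
      rw [← hIS, sub_eq_add_neg, ← neg_one_smul ℂ, ← hIsmul, ← hIadd, neg_one_smul,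
        ← sub_eq_add_neg, hVr]
    rw [← h1, hVl]
  -- the derivative of the weighted orbit of a vector of `D(A)`
  have hder : ∀ x y, (x, y) ∈ A.graph → I (y - α • x) = S x - x := by
    intro x y hxy
    have h1 := intervalIntegral.integral_eq_sub_of_hasDeriv_right (a := 0) (b := (t : ℝ))
      (f := fun s => e s x) (f' := fun s => e s (y - α • x)) (hec x).continuousOn (fun s hs => by
        rw [min_eq_left t.coe_nonneg] at hs
        have h2 := hA.hasDerivWithinAt_orbit hxy hs.1.le
        have h3 : HasDerivAt (fun s : ℝ => Complex.exp (-α * s)) (Complex.exp (-α * s) * (-α)) s := by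
          have : HasDerivAt (fun s : ℂ => -α * s) (-α) (s : ℂ) := by
            simpa using (hasDerivAt_id (s : ℂ)).const_mul (-α)
          exact this.cexp.comp_ofReal
        refine (h3.hasDerivWithinAt.smul h2).congr_deriv ?_
        simp only [he, map_sub, map_smul, smul_sub]
        rw [mul_smul, neg_smul, smul_neg, sub_eq_add_neg]) (heint _)
    simp only [hI]
    rw [h1]
    simp [he, hS, T.op_zero_apply]
  -- the integral is bounded and lies in the range of the resolvent of `β`
  have hIR : ∀ x, I x = R ((β - α) • I x + x - S x) := by
    intro x
    have h1 := hder _ _ (resolvent_mem_graph hβ x)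
    have hRI : R (I x) = I (R x) := by
      simp only [hI]
      rw [← R.intervalIntegral_comp_comm (heint x)]
      refine intervalIntegral.integral_congr fun s _ => ?_
      simp only [he, map_smul, hR, hA.resolvent_op hβ]
    have hRS : R (S x) = S (R x) := by
      simp only [hS, smul_apply, map_smul, hR, hA.resolvent_op hβ]
    have h2 : β • R x - x - α • R x = (β - α) • R x + (-1 : ℂ) • x := by
      rw [sub_smul, neg_one_smul]; abel
    rw [h2, hIadd, hIsmul, hIsmul, neg_one_smul] at h1
    rw [map_sub, _root_.map_add, map_smul, hRI, hRS]
    rw [← hR] at h1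
    have h3 : I x = (β - α) • I (R x) - (S (R x) - R x) := by rw [← h1]; abel
    rw [h3]; abel
  obtain ⟨C, hC⟩ : ∃ C, ∀ x, ‖I x‖ ≤ C * ‖x‖ := by
    refine ⟨(Real.exp (|α.re| * t) * (|M| * Real.exp (|w| * t))) * |(t : ℝ) - 0|, fun x => ?_⟩
    rw [mul_right_comm]
    refine intervalIntegral.norm_integral_le_of_norm_le_const fun s hs => ?_
    rw [uIoc_of_le t.coe_nonneg] at hs
    simp only [he]
    rw [norm_smul, Complex.norm_exp, mul_assoc]
    have h1 : ‖T.op s.toNNReal‖ ≤ |M| * Real.exp (|w| * t) := by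
      refine (hM _).trans ?_
      rw [Real.coe_toNNReal _ hs.1.le]
      gcongr
      all_goals first | exact le_abs_self M | exact le_abs_self w | exact hs.2 | exact hs.1.le
    have h2 : (-α * (s : ℂ)).re ≤ |α.re| * t := by
      simp only [Complex.mul_re, Complex.neg_re, Complex.ofReal_re, Complex.ofReal_im, mul_zero,
        sub_zero]
      calc -α.re * s ≤ |α.re| * s := by gcongr; exacts [hs.1.le, neg_le_abs _]
        _ ≤ _ := by gcongr; exact hs.2
    gcongr
    exact ((T.op _).le_opNorm x).trans (by gcongr)
  let IL : X →L[ℂ] X :=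
    LinearMap.mkContinuous { toFun := I, map_add' := hIadd, map_smul' := hIsmul } C hC
  refine ⟨V.comp IL, fun x => ?_, fun v => ?_⟩
  · set p := V x with hp
    have h1 : (V.comp IL) x = I p := (hIV x).symm
    have hres := apply_resolventDom hβ ((β - α) • I p + p - S p)
    rw [← hR, ← hIR] at hres
    refine ⟨resolventDom hβ ((β - α) • I p + p - S p), ?_, ?_⟩
    · rw [h1, coe_resolventDom, ← hR, ← hIR]
    · rw [hres, coe_resolventDom, ← hR, ← hIR, ← hVr x, ← hp, sub_smul]
      abel
  · have h1 := hder _ _ (A.mem_graph v)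
    have h2 : α • (v : X) - A v = (-1 : ℂ) • (A v - α • (v : X)) := by
      rw [neg_one_smul]; abel
    change V (I (α • (v : X) - A v)) = v
    rw [h2, hIsmul, h1, neg_one_smul, neg_sub, hVl]

end Orbits

/-! ### Energy inequality for classical solutions, contraction semigroups -/

section Energy

variable {X : Type*} [NormedAddCommGroup X] [InnerProductSpace ℂ X]

/-- If `2 Re ⟨z', z⟩ ≤ q`, then the weighted energy `e^{2νt} ‖z(t)‖²` grows at most by the integral
of `e^{2νs} (2ν ‖z(s)‖² + q(s))`. -/
lemma weighted_energy_le {z z' : ℝ → X} {q : ℝ → ℝ} {t : ℝ} (ν : ℝ) (ht : 0 ≤ t)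
    (hz : ContinuousOn z (Icc 0 t)) (hz' : ContinuousOn z' (Icc 0 t))
    (hq : ContinuousOn q (Icc 0 t))
    (hder : ∀ s ∈ Ioo 0 t, HasDerivWithinAt z (z' s) (Ioi s) s)
    (hle : ∀ s ∈ Icc 0 t, 2 * (inner ℂ (z' s) (z s)).re ≤ q s) :
    Real.exp (2 * ν * t) * ‖z t‖ ^ 2 ≤ ‖z 0‖ ^ 2 +
      ∫ s in (0 : ℝ)..t, Real.exp (2 * ν * s) * (2 * ν * ‖z s‖ ^ 2 + q s) := by
  have hexp : Continuous fun s : ℝ => Real.exp (2 * ν * s) := by fun_prop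
  have hinner : ContinuousOn (fun s => (inner ℂ (z' s) (z s)).re) (Icc 0 t) :=
    Complex.continuous_re.comp_continuousOn (hz'.inner (𝕜 := ℂ) hz)
  have hφ' : ContinuousOn (fun s => Real.exp (2 * ν * s) *
      (2 * ν * ‖z s‖ ^ 2 + 2 * (inner ℂ (z' s) (z s)).re)) (Icc 0 t) :=
    hexp.continuousOn.mul ((continuousOn_const.mul (hz.norm.pow 2)).add
      (continuousOn_const.mul hinner))
  have h1 := intervalIntegral.integral_eq_sub_of_hasDeriv_right (a := 0) (b := t)
    (f := fun s => Real.exp (2 * ν * s) * ‖z s‖ ^ 2)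
    (f' := fun s => Real.exp (2 * ν * s) *
      (2 * ν * ‖z s‖ ^ 2 + 2 * (inner ℂ (z' s) (z s)).re))
    (by rw [uIcc_of_le ht]; exact hexp.continuousOn.mul (hz.norm.pow 2))
    (fun s hs => by
      rw [min_eq_left ht, max_eq_right ht] at hs
      have hd := hder s hs
      have h2 : HasDerivWithinAt (fun s => ‖z s‖ ^ 2) (2 * (inner ℂ (z' s) (z s)).re) (Ioi s) s := by
        have h3 := (Complex.reCLM.hasFDerivAt.comp_hasDerivWithinAt s (hd.inner ℂ hd))
        refine (h3.congr_deriv ?_).congr_of_eventuallyEq ?_ ?_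
        · simp only [Complex.reCLM_apply, Complex.add_re]
          have : (inner ℂ (z s) (z' s)).re = (inner ℂ (z' s) (z s)).re := inner_re_symm (𝕜 := ℂ) _ _
          rw [this]; ring
        · refine Eventually.of_forall fun r => ?_
          exact (inner_self_eq_norm_sq (𝕜 := ℂ) (z r)).symm
        · exact (inner_self_eq_norm_sq (𝕜 := ℂ) (z s)).symm
      have h4 : HasDerivAt (fun s : ℝ => Real.exp (2 * ν * s)) (Real.exp (2 * ν * s) * (2 * ν)) s := by
        have : HasDerivAt (fun s : ℝ => 2 * ν * s) (2 * ν) s := by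
          simpa using (hasDerivAt_id s).const_mul (2 * ν)
        exact this.exp
      refine (h4.hasDerivWithinAt.mul h2).congr_deriv ?_
      ring)
    (hφ'.intervalIntegrable_of_Icc ht)
  simp only [mul_zero, Real.exp_zero, one_mul] at h1
  have h2 : ∫ s in (0 : ℝ)..t, Real.exp (2 * ν * s) *
        (2 * ν * ‖z s‖ ^ 2 + 2 * (inner ℂ (z' s) (z s)).re) ≤
      ∫ s in (0 : ℝ)..t, Real.exp (2 * ν * s) * (2 * ν * ‖z s‖ ^ 2 + q s) := by
    refine intervalIntegral.integral_mono_on ht (hφ'.intervalIntegrable_of_Icc ht)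
      (ContinuousOn.intervalIntegrable_of_Icc ht ?_) fun s hs => ?_
    · exact hexp.continuousOn.mul ((continuousOn_const.mul (hz.norm.pow 2)).add hq)
    · have := hle s hs
      gcongr
  linarith

variable {T : C0Semigroup X} {A : X →ₗ.[ℂ] X}

/-- A semigroup with dissipative, densely defined generator is contractive. -/
lemma C0Semigroup.IsGenerator.norm_op_le_one (hA : T.IsGenerator A)
    (hdense : Dense (A.domain : Set X)) (hdiss : ∀ x : A.domain, (inner ℂ (A x) (x : X)).re ≤ 0)
    (t : ℝ≥0) : ‖T.op t‖ ≤ 1 := by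
  have key : ∀ x ∈ (A.domain : Set X), ‖T.op t x‖ ≤ ‖x‖ := by
    intro x hx
    have hg := A.mem_graph ⟨x, hx⟩
    have h := weighted_energy_le (z := fun s => T.op s.toNNReal x)
      (z' := fun s => T.op s.toNNReal (A ⟨x, hx⟩)) (q := fun _ => 0) 0 t.coe_nonneg
      (T.continuous_orbit _).continuousOn (T.continuous_orbit _).continuousOn continuousOn_const
      (fun s hs => hA.hasDerivWithinAt_orbit hg hs.1.le) (fun s _ => by
        obtain ⟨v, hv, hv'⟩ := (LinearPMap.mem_graph_iff A).1 (hA.graph_op s.toNNReal hg)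
        have := hdiss v
        rw [hv, hv'] at this
        simp only at this
        linarith)
    simp only [mul_zero, zero_mul, Real.exp_zero, one_mul, add_zero,
      intervalIntegral.integral_zero, Real.toNNReal_coe, Real.toNNReal_zero, T.op_zero_apply] at h
    exact abs_le_of_sq_le_sq' h (norm_nonneg _) |>.2
  refine ContinuousLinearMap.opNorm_le_bound _ zero_le_one fun x => ?_
  rw [one_mul]
  refine hdense.induction (P := fun x => ‖T.op t x‖ ≤ ‖x‖) (fun x hx => key x hx) ?_ x
  exact isClosed_le (T.op t).continuous.norm continuous_norm

end Energy

/-! ### Convolution with a contraction semigroup -/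

section Convolution

variable {X : Type*} [NormedAddCommGroup X] [NormedSpace ℂ X]
  {T : C0Semigroup X} {A : X →ₗ.[ℂ] X} {β : ℂ}

/-- The convolution `∫₀ᵗ T(t - s) g(s) ds`. -/
noncomputable def C0Semigroup.conv (T : C0Semigroup X) (g : ℝ → X) (t : ℝ) : X :=
  ∫ s in (0 : ℝ)..t, T.op (t - s).toNNReal (g s)

lemma C0Semigroup.norm_op_apply_le (hT : ∀ t, ‖T.op t‖ ≤ 1) (t : ℝ≥0) (x : X) :
    ‖T.op t x‖ ≤ ‖x‖ :=
  ((T.op t).le_of_opNorm_le (hT t) x).trans_eq (one_mul _)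

lemma C0Semigroup.continuous_op_uncurry (hT : ∀ t, ‖T.op t‖ ≤ 1) :
    Continuous fun p : ℝ × X => T.op p.1.toNNReal p.2 := by
  rw [continuous_iff_continuousAt]
  rintro ⟨t, x⟩
  have h1 : Tendsto (fun p : ℝ × X => T.op p.1.toNNReal (p.2 - x)) (𝓝 (t, x)) (𝓝 0) := by
    refine squeeze_zero_norm (a := fun p => ‖p.2 - x‖) (fun p => norm_op_apply_le hT _ _) ?_
    have : Continuous fun p : ℝ × X => ‖p.2 - x‖ := by fun_prop
    simpa using this.tendsto (t, x)
  have h2 : Tendsto (fun p : ℝ × X => T.op p.1.toNNReal x) (𝓝 (t, x)) (𝓝 (T.op t.toNNReal x)) :=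
    ((T.continuous_orbit x).comp continuous_fst).tendsto (t, x)
  have h3 := h1.add h2
  simp only [map_sub, sub_add_cancel, zero_add] at h3
  exact h3

lemma C0Semigroup.aestronglyMeasurable_op {α : Type*} [MeasurableSpace α] {μ : Measure α}
    (hT : ∀ t, ‖T.op t‖ ≤ 1) {σ : α → ℝ} {g : α → X} (hσ : AEMeasurable σ μ)
    (hg : AEStronglyMeasurable g μ) :
    AEStronglyMeasurable (fun s => T.op (σ s).toNNReal (g s)) μ :=
  (continuous_op_uncurry hT).comp_aestronglyMeasurable (hσ.aestronglyMeasurable.prodMk hg)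

lemma C0Semigroup.intervalIntegrable_op (hT : ∀ t, ‖T.op t‖ ≤ 1) {σ : ℝ → ℝ} {g : ℝ → X}
    {a b : ℝ} (hσ : Measurable σ) (hg : IntervalIntegrable g volume a b) :
    IntervalIntegrable (fun s => T.op (σ s).toNNReal (g s)) volume a b :=
  hg.mono_fun (aestronglyMeasurable_op hT hσ.aemeasurable hg.aestronglyMeasurable_restrict_uIoc)
    (Eventually.of_forall fun _ => norm_op_apply_le hT _ _)

lemma C0Semigroup.conv_congr_ae {g g' : ℝ → X} {t : ℝ} (ht : 0 ≤ t)
    (h : ∀ᵐ s ∂vol t, g s = g' s) : T.conv g t = T.conv g' t := by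
  refine intervalIntegral.integral_congr_ae_restrict ?_
  rw [uIoc_of_le ht, ← restrict_Ioo_eq_restrict_Ioc]
  filter_upwards [h] with s hs
  rw [hs]

lemma C0Semigroup.conv_add (hT : ∀ t, ‖T.op t‖ ≤ 1) {g g' : ℝ → X} {t : ℝ}
    (hg : IntervalIntegrable g volume 0 t) (hg' : IntervalIntegrable g' volume 0 t) :
    T.conv (fun s => g s + g' s) t = T.conv g t + T.conv g' t := by
  simp only [conv, _root_.map_add]
  exact intervalIntegral.integral_add (intervalIntegrable_op hT (by fun_prop) hg)
    (intervalIntegrable_op hT (by fun_prop) hg')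

lemma C0Semigroup.conv_smul (c : ℂ) (g : ℝ → X) (t : ℝ) :
    T.conv (fun s => c • g s) t = c • T.conv g t := by
  simp only [conv, map_smul, intervalIntegral.integral_smul]

lemma C0Semigroup.norm_conv_le (hT : ∀ t, ‖T.op t‖ ≤ 1) {g : ℝ → X} {t : ℝ} (ht : 0 ≤ t)
    (hg : IntervalIntegrable g volume 0 t) : ‖T.conv g t‖ ≤ ∫ s in (0 : ℝ)..t, ‖g s‖ :=
  intervalIntegral.norm_integral_le_of_norm_le ht
    (Eventually.of_forall fun _ _ => norm_op_apply_le hT _ _) hg.norm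

lemma C0Semigroup.continuous_conv (hT : ∀ t, ‖T.op t‖ ≤ 1) {g : ℝ → X} (hg : Continuous g) :
    Continuous (T.conv g) := by
  refine intervalIntegral.continuous_parametric_intervalIntegral_of_continuous
    (f := fun t s => T.op (t - s).toNNReal (g s)) ?_ continuous_id
  exact (continuous_op_uncurry hT).comp
    ((continuous_fst.sub continuous_snd).prodMk (hg.comp continuous_snd))

lemma C0Semigroup.map_conv [CompleteSpace X] (hT : ∀ t, ‖T.op t‖ ≤ 1) {g : ℝ → X} {t : ℝ}
    (hg : IntervalIntegrable g volume 0 t) (S : X →L[ℂ] X)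
    (hS : ∀ t x, S (T.op t x) = T.op t (S x)) :
    S (T.conv g t) = T.conv (fun s => S (g s)) t := by
  rw [conv, ← S.intervalIntegral_comp_comm (intervalIntegrable_op hT (by fun_prop) hg)]
  simp only [conv, hS]

/-- Interchange of the integrations over the triangle `0 ≤ s ≤ r ≤ t`. -/
lemma intervalIntegral_triangle_swap {t : ℝ} (ht : 0 ≤ t) {f : ℝ → ℝ → X}
    (hf : Integrable (Function.uncurry f)
      ((volume.restrict (Ioc 0 t)).prod (volume.restrict (Ioc 0 t)))) :
    ∫ r in (0 : ℝ)..t, ∫ s in (0 : ℝ)..r, f r s = ∫ s in (0 : ℝ)..t, ∫ r in s..t, f r s := by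
  set F : ℝ → ℝ → X := fun r s => {p : ℝ × ℝ | p.2 ≤ p.1}.indicator (Function.uncurry f) (r, s)
    with hF
  have hFi : Integrable (Function.uncurry F)
      ((volume.restrict (Ioc 0 t)).prod (volume.restrict (Ioc 0 t))) :=
    hf.indicator (measurableSet_le measurable_snd measurable_fst)
  have hswap := integral_integral_swap hFi
  rw [intervalIntegral.integral_of_le ht, intervalIntegral.integral_of_le ht]
  refine Eq.trans (setIntegral_congr_fun measurableSet_Ioc fun r hr => ?_)
    (hswap.trans (setIntegral_congr_fun measurableSet_Ioc fun s hs => ?_))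
  · rw [intervalIntegral.integral_of_le hr.1.le]
    have : (fun s => F r s) = (Iic r).indicator (f r) := by
      ext s; simp [hF, indicator, Function.uncurry]
    rw [this, setIntegral_indicator measurableSet_Iic]
    congr 2
    ext s; simp only [mem_Ioc, mem_inter_iff, mem_Iic]
    exact ⟨fun h => ⟨⟨h.1, h.2.trans hr.2⟩, h.2⟩, fun h => ⟨h.1.1, h.2⟩⟩
  · rw [intervalIntegral.integral_of_le hs.2]
    have : (fun r => F r s) = (Ici s).indicator (fun r => f r s) := by
      ext r; simp [hF, indicator, Function.uncurry]
    rw [this, setIntegral_indicator measurableSet_Ici, ← integral_Icc_eq_integral_Ioc]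
    congr 2
    ext r; simp only [mem_Ioc, mem_inter_iff, mem_Ici, mem_Icc]
    exact ⟨fun h => ⟨h.2, h.1.2⟩, fun h => ⟨⟨hs.1.trans_le h.1, h.2⟩, h.1⟩⟩

lemma C0Semigroup.integrable_op_prod (hT : ∀ t, ‖T.op t‖ ≤ 1) {g : ℝ → X} {t : ℝ} (ht : 0 ≤ t)
    (hg : IntervalIntegrable g volume 0 t) {σ : ℝ × ℝ → ℝ} (hσ : Measurable σ) :
    Integrable (fun p : ℝ × ℝ => T.op (σ p).toNNReal (g p.2))
      ((volume.restrict (Ioc 0 t)).prod (volume.restrict (Ioc 0 t))) := by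
  rw [intervalIntegrable_iff_integrableOn_Ioc_of_le ht] at hg
  have h1 : Integrable (fun p : ℝ × ℝ => g p.2)
      ((volume.restrict (Ioc 0 t)).prod (volume.restrict (Ioc 0 t))) := hg.comp_snd _
  exact h1.mono (aestronglyMeasurable_op hT hσ.aemeasurable h1.aestronglyMeasurable)
    (Eventually.of_forall fun _ => norm_op_apply_le hT _ _)

/-- `∫₀ᵗ (T * g)(r) dr = ∫₀ᵗ ∫₀ᵗ⁻ˢ T(τ) g(s) dτ ds`. -/
lemma C0Semigroup.integral_conv (hT : ∀ t, ‖T.op t‖ ≤ 1) {g : ℝ → X} {t : ℝ} (ht : 0 ≤ t)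
    (hg : IntervalIntegrable g volume 0 t) :
    ∫ r in (0 : ℝ)..t, T.conv g r =
      ∫ s in (0 : ℝ)..t, ∫ τ in (0 : ℝ)..(t - s), T.op τ.toNNReal (g s) := by
  simp only [conv]
  rw [intervalIntegral_triangle_swap (f := fun r s => T.op (r - s).toNNReal (g s)) ht
    (integrable_op_prod hT ht hg (σ := fun p => p.1 - p.2) (by fun_prop))]
  refine intervalIntegral.integral_congr fun s _ => ?_
  rw [intervalIntegral.integral_comp_sub_right (fun τ => T.op τ.toNNReal (g s)) s, sub_self]

section

variable [CompleteSpace X]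

/-- The convolution commutes with integration. -/
lemma C0Semigroup.conv_integral (hT : ∀ t, ‖T.op t‖ ≤ 1) {g : ℝ → X} {t : ℝ} (ht : 0 ≤ t)
    (hg : IntervalIntegrable g volume 0 t) :
    T.conv (fun s => ∫ r in (0 : ℝ)..s, g r) t = ∫ r in (0 : ℝ)..t, T.conv g r := by
  rw [integral_conv hT ht hg, conv]
  have h1 : ∀ r ∈ uIcc 0 t, T.op (t - r).toNNReal (∫ s in (0 : ℝ)..r, g s) =
      ∫ s in (0 : ℝ)..r, T.op (t - r).toNNReal (g s) := fun r hr => by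
    rw [uIcc_of_le ht] at hr
    rw [ContinuousLinearMap.intervalIntegral_comp_comm _ (hg.mono_set ?_)]
    rw [uIcc_of_le ht, uIcc_of_le hr.1]
    exact Icc_subset_Icc_right hr.2
  rw [intervalIntegral.integral_congr h1,
    intervalIntegral_triangle_swap (f := fun r s => T.op (t - r).toNNReal (g s)) ht
      (integrable_op_prod hT ht hg (σ := fun p => t - p.1) (by fun_prop))]
  refine intervalIntegral.integral_congr fun s _ => ?_
  rw [intervalIntegral.integral_comp_sub_left (fun τ => T.op τ.toNNReal (g s)) t, sub_self]

/-- The convolution solves `z' = A z + g` in integrated form, after application of `(β - A)⁻¹`. -/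
lemma C0Semigroup.IsGenerator.resolvent_conv (hA : T.IsGenerator A) (hβ : β ∈ resolventSet A)
    (hT : ∀ t, ‖T.op t‖ ≤ 1) {g : ℝ → X} {t : ℝ} (ht : 0 ≤ t)
    (hg : IntervalIntegrable g volume 0 t) :
    resolvent A β (T.conv g t) = resolvent A β (∫ s in (0 : ℝ)..t, g s) +
      (β • resolvent A β (∫ s in (0 : ℝ)..t, T.conv g s) - ∫ s in (0 : ℝ)..t, T.conv g s) := by
  set R := resolvent A β with hR
  have hRg : IntervalIntegrable (fun s => R (g s)) volume 0 t :=
    ⟨R.integrable_comp hg.1, R.integrable_comp hg.2⟩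
  have hGg : IntervalIntegrable (fun s => β • R (g s) - g s) volume 0 t := (hRg.smul β).sub hg
  set I := ∫ s in (0 : ℝ)..t, T.conv g s with hI
  have hGI : β • R I - I = ∫ s in (0 : ℝ)..t,
      ∫ τ in (0 : ℝ)..(t - s), T.op τ.toNNReal (β • R (g s) - g s) := by
    set S : X →L[ℂ] X := β • R - ContinuousLinearMap.id ℂ X with hS
    have hSg : ∀ x, S x = β • R x - x := fun x => rfl
    have hint : IntervalIntegrable (fun s => ∫ τ in (0 : ℝ)..(t - s), T.op τ.toNNReal (g s))
        volume 0 t := by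
      have h2 := (integrable_op_prod hT ht hg (σ := fun p => t - p.1) (by fun_prop))
      have h3 := (h2.indicator (measurableSet_le measurable_snd measurable_fst)).integral_prod_right
      rw [intervalIntegrable_iff_integrableOn_Ioc_of_le ht]
      refine (integrable_congr ?_).1 h3
      filter_upwards [ae_restrict_mem measurableSet_Ioc] with s hs
      have : (fun r => {p : ℝ × ℝ | p.2 ≤ p.1}.indicator
          (fun p : ℝ × ℝ => T.op (t - p.1).toNNReal (g p.2)) (r, s)) =
          (Ici s).indicator (fun r => T.op (t - r).toNNReal (g s)) := by
        ext r; simp [indicator]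
      rw [this, setIntegral_indicator measurableSet_Ici]
      have h4 : Ioc 0 t ∩ Ici s = Icc s t := by
        ext r; simp only [mem_Ioc, mem_inter_iff, mem_Ici, mem_Icc]
        exact ⟨fun h => ⟨h.2, h.1.2⟩, fun h => ⟨⟨hs.1.trans_le h.1, h.2⟩, h.1⟩⟩
      rw [h4, integral_Icc_eq_integral_Ioc, ← intervalIntegral.integral_of_le hs.2,
        intervalIntegral.integral_comp_sub_left (fun τ => T.op τ.toNNReal (g s)) t, sub_self]
    rw [← hSg, hI, integral_conv hT ht hg, ← S.intervalIntegral_comp_comm hint]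
    refine intervalIntegral.integral_congr fun s _ => ?_
    rw [← S.intervalIntegral_comp_comm ((T.continuous_orbit _).intervalIntegrable _ _)]
    refine intervalIntegral.integral_congr fun τ _ => ?_
    simp only [hSg, map_sub, map_smul, hR, hA.resolvent_op hβ]
  have hinner : ∀ s ∈ uIcc 0 t, ∫ τ in (0 : ℝ)..(t - s), T.op τ.toNNReal (β • R (g s) - g s) =
      T.op (t - s).toNNReal (R (g s)) - R (g s) := fun s hs => by
    rw [uIcc_of_le ht] at hs
    exact hA.integral_orbit (resolvent_mem_graph hβ (g s)) (by linarith [hs.2])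
  rw [hGI, intervalIntegral.integral_congr hinner, intervalIntegral.integral_sub
    (intervalIntegrable_op hT (by fun_prop) hRg) hRg,
    map_conv hT hg R (fun t x => hA.resolvent_op hβ t x), ← R.intervalIntegral_comp_comm hg, conv]
  abel

end

end Convolution

/-! ### Weighted `L²` norms -/

section WeightedNorm

variable {U U' : Type*} [NormedAddCommGroup U] [NormedAddCommGroup U'] {ν t : ℝ} {I : Set ℝ}

lemma exp_mul_le {s : ℝ} (hs : s ∈ Ioo 0 t) : Real.exp (ν * s) ≤ Real.exp (|ν| * t) :=
  Real.exp_le_exp.2 ((mul_le_mul_of_nonneg_right (le_abs_self ν) hs.1.le).trans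
    (mul_le_mul_of_nonneg_left hs.2.le (abs_nonneg ν)))

lemma memLp_vol_mono {f : ℝ → U} {s t : ℝ} (hst : s ≤ t) (hf : MemLp f 2 (vol t)) :
    MemLp f 2 (vol s) :=
  hf.mono_measure (Measure.restrict_mono (Ioo_subset_Ioo_right hst) le_rfl)

lemma memLp_vol_of_volInf {f : ℝ → U} (hf : MemLp f 2 volInf) (t : ℝ) : MemLp f 2 (vol t) :=
  hf.mono_measure (Measure.restrict_mono Ioo_subset_Ioi_self le_rfl)

lemma ae_vol_mono {p : ℝ → Prop} {s t : ℝ} (hst : s ≤ t) (h : ∀ᵐ r ∂vol t, p r) :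
    ∀ᵐ r ∂vol s, p r :=
  ae_mono (Measure.restrict_mono (Ioo_subset_Ioo_right hst) le_rfl) h

/-- A property that holds almost everywhere on each `(0, t)` holds almost everywhere on `(0, ∞)`. -/
lemma ae_volInf_of_forall {p : ℝ → Prop} (h : ∀ t > 0, ∀ᵐ r ∂vol t, p r) : ∀ᵐ r ∂volInf, p r := by
  have h1 : ∀ n : ℕ, ∀ᵐ r, r ∈ Ioo (0 : ℝ) (n + 1) → p r := fun n =>
    (ae_restrict_iff' measurableSet_Ioo).1 (h (n + 1) (by positivity))
  rw [ae_restrict_iff' measurableSet_Ioi]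
  filter_upwards [ae_all_iff.2 h1] with r hr hr0
  obtain ⟨n, hn⟩ := exists_nat_gt r
  exact hr n ⟨hr0, hn.trans (by linarith)⟩

lemma intervalIntegrable_of_memLp_vol {f : ℝ → U} (ht : 0 ≤ t) (hf : MemLp f 2 (vol t)) :
    IntervalIntegrable f volume 0 t := by
  rw [intervalIntegrable_iff_integrableOn_Ioo_of_le ht]
  exact hf.integrable (by norm_num)

variable [NormedSpace ℂ U] [NormedSpace ℂ U']

/-- `e^{ν ·} f ∈ L²(I; U)`. -/
abbrev MemW (ν : ℝ) (I : Set ℝ) (f : ℝ → U) : Prop :=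
  MemLp (fun s => Real.exp (ν * s) • f s) 2 (volume.restrict I)

lemma memW_zero_iff {f : ℝ → U} : MemW 0 I f ↔ MemLp f 2 (volume.restrict I) := by
  simp [MemW]

lemma memW_of_memLp {f : ℝ → U} (hf : MemLp f 2 (vol t)) : MemW ν (Ioo 0 t) f := by
  refine hf.of_le_mul (c := Real.exp (|ν| * t)) ?_ ?_
  · exact ((by fun_prop : Continuous fun s : ℝ => Real.exp (ν * s)).aestronglyMeasurable).smul
      hf.aestronglyMeasurable
  · filter_upwards [ae_restrict_mem measurableSet_Ioo] with s hs
    rw [norm_smul, Real.norm_eq_abs, Real.abs_exp]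
    exact mul_le_mul_of_nonneg_right (exp_mul_le hs) (norm_nonneg _)

lemma normL2w_nonneg (ν : ℝ) (I : Set ℝ) (f : ℝ → U) : 0 ≤ normL2w ν I f :=
  ENNReal.toReal_nonneg

lemma normL2w_congr {f g : ℝ → U} (h : ∀ᵐ s ∂volume.restrict I, f s = g s) :
    normL2w ν I f = normL2w ν I g := by
  unfold normL2w
  congr 1
  refine eLpNorm_congr_ae ?_
  filter_upwards [h] with s hs
  rw [hs]

lemma normL2w_add_le {f g : ℝ → U} (hf : MemW ν I f) (hg : MemW ν I g) :
    normL2w ν I (fun s => f s + g s) ≤ normL2w ν I f + normL2w ν I g := by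
  unfold normL2w
  rw [← ENNReal.toReal_add hf.eLpNorm_ne_top hg.eLpNorm_ne_top]
  refine ENNReal.toReal_mono (ENNReal.add_ne_top.2 ⟨hf.eLpNorm_ne_top, hg.eLpNorm_ne_top⟩) ?_
  refine le_trans (le_of_eq ?_)
    (eLpNorm_add_le hf.aestronglyMeasurable hg.aestronglyMeasurable (by norm_num))
  congr 1; ext s; simp

lemma normL2w_le_mul {f : ℝ → U} {g : ℝ → U'} {c : ℝ} (hc : 0 ≤ c) (hg : MemW ν I g)
    (h : ∀ᵐ s ∂volume.restrict I, ‖f s‖ ≤ c * ‖g s‖) :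
    normL2w ν I f ≤ c * normL2w ν I g := by
  unfold normL2w
  conv_rhs => rw [← ENNReal.toReal_ofReal hc, ← ENNReal.toReal_mul]
  refine ENNReal.toReal_mono (ENNReal.mul_ne_top ENNReal.ofReal_ne_top hg.eLpNorm_ne_top) ?_
  refine eLpNorm_le_mul_eLpNorm_of_ae_le_mul ?_ 2
  filter_upwards [h] with s hs
  rw [norm_smul, norm_smul, mul_left_comm]
  gcongr

lemma normL2w_neg (f : ℝ → U) : normL2w ν I (fun s => -f s) = normL2w ν I f := by
  unfold normL2w
  rw [← eLpNorm_neg]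
  congr 2; ext s; simp

lemma normL2w_le_add_sub {f g : ℝ → U} (hf : MemW ν I f) (hg : MemW ν I g) :
    |normL2w ν I f - normL2w ν I g| ≤ normL2w ν I (fun s => f s - g s) := by
  have hfg : MemW ν I (fun s => f s - g s) := by
    refine (hf.sub hg).ae_eq (Eventually.of_forall fun s => ?_)
    simp [smul_sub]
  have hgf : MemW ν I (fun s => g s - f s) := by
    refine (hg.sub hf).ae_eq (Eventually.of_forall fun s => ?_)
    simp [smul_sub]
  have h1 := normL2w_add_le hg hfg
  have h2 := normL2w_add_le hf hgf
  have h3 : normL2w ν I (fun s => g s - f s) = normL2w ν I (fun s => f s - g s) := by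
    rw [← normL2w_neg]; simp
  simp only [add_sub_cancel] at h1 h2
  rw [abs_sub_le_iff]
  constructor <;> linarith

lemma normL2w_mono_set {f : ℝ → U} {J : Set ℝ} (hIJ : I ⊆ J) (hf : MemW ν J f) :
    normL2w ν I f ≤ normL2w ν J f :=
  ENNReal.toReal_mono hf.eLpNorm_ne_top
    (eLpNorm_mono_measure _ (Measure.restrict_mono hIJ le_rfl))

/-- On a bounded interval the weighted norms are controlled by the unweighted one. -/
lemma normL2w_le_exp_mul {f : ℝ → U} {s : ℝ} (hst : s ≤ t) (hf : MemLp f 2 (vol t)) :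
    normL2w ν (Ioo 0 s) f ≤ Real.exp (|ν| * t) * normL2w 0 (Ioo 0 t) f := by
  refine (normL2w_mono_set (Ioo_subset_Ioo_right hst) (memW_of_memLp hf)).trans ?_
  unfold normL2w
  conv_rhs => rw [← ENNReal.toReal_ofReal (Real.exp_pos (|ν| * t)).le, ← ENNReal.toReal_mul]
  have h0 : MemW 0 (Ioo 0 t) f := memW_of_memLp hf
  refine ENNReal.toReal_mono (ENNReal.mul_ne_top ENNReal.ofReal_ne_top h0.eLpNorm_ne_top) ?_
  refine eLpNorm_le_mul_eLpNorm_of_ae_le_mul ?_ 2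
  filter_upwards [ae_restrict_mem measurableSet_Ioo] with r hr
  rw [zero_mul, Real.exp_zero, one_smul, norm_smul, Real.norm_eq_abs, Real.abs_exp]
  exact mul_le_mul_of_nonneg_right (exp_mul_le hr) (norm_nonneg _)

lemma tendsto_normL2w {f : ℕ → ℝ → U} {g : ℝ → U} {s : ℝ} (hst : s ≤ t)
    (hf : ∀ n, MemLp (f n) 2 (vol t)) (hg : MemLp g 2 (vol t))
    (h : Tendsto (fun n => normL2w 0 (Ioo 0 t) (fun s => f n s - g s)) atTop (𝓝 0)) :
    Tendsto (fun n => normL2w ν (Ioo 0 s) (f n)) atTop (𝓝 (normL2w ν (Ioo 0 s) g)) := by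
  rw [tendsto_iff_norm_sub_tendsto_zero]
  have h1 := h.const_mul (Real.exp (|ν| * t))
  rw [mul_zero] at h1
  refine squeeze_zero (fun _ => norm_nonneg _) (fun n => ?_) h1
  exact (normL2w_le_add_sub (memW_of_memLp (memLp_vol_mono hst (hf n)))
    (memW_of_memLp (memLp_vol_mono hst hg))).trans (normL2w_le_exp_mul hst ((hf n).sub hg))

lemma normL2w_sq {f : ℝ → U} (ht : 0 ≤ t) (hf : MemLp f 2 (vol t)) :
    normL2w ν (Ioo 0 t) f ^ 2 = ∫ s in (0 : ℝ)..t, Real.exp (2 * ν * s) * ‖f s‖ ^ 2 := by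
  have hw : MemW ν (Ioo 0 t) f := memW_of_memLp hf
  unfold normL2w
  rw [hw.eLpNorm_eq_integral_rpow_norm (by norm_num) (by norm_num),
    ENNReal.toReal_ofReal (by positivity), ← Real.rpow_natCast, ← Real.rpow_mul (by positivity)]
  simp only [ENNReal.toReal_ofNat, Nat.cast_ofNat, ne_eq, OfNat.ofNat_ne_zero, not_false_eq_true,
    inv_mul_cancel₀, Real.rpow_one, Real.rpow_ofNat]
  rw [intervalIntegral.integral_of_le ht, ← restrict_Ioo_eq_restrict_Ioc]
  refine integral_congr_ae (Eventually.of_forall fun s => ?_)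
  simp only
  rw [norm_smul, Real.norm_eq_abs, Real.abs_exp, mul_pow, ← Real.exp_nat_mul]
  congr 2; push_cast; ring

lemma integral_norm_le_normL2w {f : ℝ → U} {s : ℝ} (hs : 0 ≤ s) (hst : s ≤ t)
    (hf : MemLp f 2 (vol t)) :
    ∫ r in (0 : ℝ)..s, ‖f r‖ ≤ √t * normL2w 0 (Ioo 0 t) f := by
  have h0 : MemW 0 (Ioo 0 t) f := memW_of_memLp hf
  have hfs := memLp_vol_mono hst hf
  have h1 := eLpNorm_le_eLpNorm_mul_rpow_measure_univ (μ := vol s) (p := 1) (q := 2)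
    (by norm_num) hfs.aestronglyMeasurable
  rw [intervalIntegral.integral_of_le hs, ← restrict_Ioo_eq_restrict_Ioc,
    integral_norm_eq_lintegral_enorm hfs.aestronglyMeasurable, ← eLpNorm_one_eq_lintegral_enorm]
  have h2 : (eLpNorm f 2 (vol s) * (vol s) Set.univ ^
      (1 / (1 : ℝ≥0∞).toReal - 1 / (2 : ℝ≥0∞).toReal)).toReal =
      √s * normL2w 0 (Ioo 0 s) f := by
    rw [ENNReal.toReal_mul, mul_comm]
    congr 1
    · rw [Measure.restrict_apply_univ, Real.volume_Ioo, sub_zero, ← ENNReal.toReal_rpow,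
        ENNReal.toReal_ofReal hs, Real.sqrt_eq_rpow]
      norm_num
    · simp [normL2w]
  calc _ ≤ _ := ENNReal.toReal_mono (ENNReal.mul_ne_top hfs.eLpNorm_ne_top
        (ENNReal.rpow_ne_top_of_nonneg (by norm_num) (by simp))) h1
    _ = √s * normL2w 0 (Ioo 0 s) f := h2
    _ ≤ _ := mul_le_mul (Real.sqrt_le_sqrt hst)
      (normL2w_mono_set (Ioo_subset_Ioo_right hst) h0) (normL2w_nonneg _ _ _) (Real.sqrt_nonneg t)

lemma normL2w_zero_eq (f : ℝ → U) : normL2w 0 I f = (eLpNorm f 2 (volume.restrict I)).toReal := by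
  simp [normL2w]

/-- A function whose `L²(0, t)` norms are bounded is square integrable on `(0, ∞)`. -/
lemma memLp_volInf_of_bound {f : ℝ → U} {c : ℝ} (hf : ∀ t > 0, MemLp f 2 (vol t))
    (hc : ∀ t > 0, normL2w 0 (Ioo 0 t) f ≤ c) :
    MemLp f 2 volInf ∧ normL2w 0 (Ioi 0) f ≤ c := by
  have hU : (⋃ n : ℕ, Ioo (0 : ℝ) (n + 1)) = Ioi 0 := by
    ext r
    simp only [mem_iUnion, mem_Ioo, mem_Ioi]
    refine ⟨fun ⟨n, h⟩ => h.1, fun h => ?_⟩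
    obtain ⟨n, hn⟩ := exists_nat_gt r
    exact ⟨n, h, by linarith⟩
  have hc0 : 0 ≤ c := (normL2w_nonneg _ _ _).trans (hc 1 one_pos)
  have hle : eLpNorm f 2 volInf ≤ ENNReal.ofReal c := by
    have h1 : ∫⁻ s in Ioi (0 : ℝ), ‖f s‖ₑ ^ (2 : ℝ) ≤ ENNReal.ofReal c ^ (2 : ℝ) := by
      rw [← hU, setLIntegral_iUnion_of_directed]
      · refine iSup_le fun n => ?_
        have hn : (0 : ℝ) < n + 1 := by positivity
        have h2 : eLpNorm f 2 (vol (n + 1)) ≤ ENNReal.ofReal c := by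
          rw [← ENNReal.ofReal_toReal (hf _ hn).eLpNorm_ne_top, ← normL2w_zero_eq]
          exact ENNReal.ofReal_le_ofReal (hc _ hn)
        rw [eLpNorm_eq_lintegral_rpow_enorm_toReal (by norm_num) (by norm_num)] at h2
        have h3 := ENNReal.rpow_le_rpow h2 (by norm_num : (0 : ℝ) ≤ 2)
        rw [← ENNReal.rpow_mul] at h3
        simpa using h3
      · refine directed_of_isDirected_le fun m n hmn => Ioo_subset_Ioo_right ?_
        gcongr
    rw [eLpNorm_eq_lintegral_rpow_enorm_toReal (by norm_num) (by norm_num)]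
    have h3 := ENNReal.rpow_le_rpow h1 (by norm_num : (0 : ℝ) ≤ 1 / 2)
    rw [← ENNReal.rpow_mul] at h3
    simpa using h3
  refine ⟨⟨?_, hle.trans_lt ENNReal.ofReal_lt_top⟩, ?_⟩
  · rw [volInf, ← hU, aestronglyMeasurable_iUnion_iff]
    exact fun n => (hf _ (by positivity)).aestronglyMeasurable
  · rw [normL2w_zero_eq]
    exact ENNReal.toReal_le_of_le_ofReal hc0 hle

end WeightedNorm

/-! ### Gelfand frames and mild solutions -/

section Frame

/-- A Gelfand triple `V ⊆ X ⊆ W` adapted to a coercive operator `A` on `X`: `D(A)` is dense in `V`,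
the inner product of `X` extends to a pairing of `W` with `V`, the form `⟨-A ·, ·⟩` is coercive for
the norm of `V`, and `(β - A)⁻¹` extends to `W`.

The spaces are arbitrary normed spaces together with comparison maps, so that the triple
`X_{1/2} ⊆ X ⊆ X_{-1/2}` of a self-adjoint operator and the trivial triple `X ⊆ X ⊆ X` are both
instances. -/
structure GelfandFrame {X : Type*} [NormedAddCommGroup X] [InnerProductSpace ℂ X]
    (A : X →ₗ.[ℂ] X) (β : ℂ) (V W : Type*) [NormedAddCommGroup V] [NormedSpace ℂ V]
    [NormedAddCommGroup W] [NormedSpace ℂ W] where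
  dense_domain : Dense (A.domain : Set X)
  /-- the embedding `V ⊆ X` -/
  j : V →L[ℂ] X
  j_injective : Function.Injective j
  /-- the embedding `D(A) ⊆ V` -/
  ι : A.domain →ₗ[ℂ] V
  j_ι : ∀ x, j (ι x) = x
  denseRange_ι : DenseRange ι
  /-- the embedding `X ⊆ W` -/
  k : X →L[ℂ] W
  denseRange_k : DenseRange k
  norm_inner_le : ∀ x v, ‖inner ℂ x (j v)‖ ≤ ‖k x‖ * ‖v‖
  /-- the extension of `(β - A)⁻¹` to `W` -/
  J : W →L[ℂ] X
  J_k : ∀ x, J (k x) = resolvent A β x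
  /-- the coercivity constant -/
  κ : ℝ
  κ_pos : 0 < κ
  coercive : ∀ x : A.domain, (inner ℂ (A x) (x : X)).re ≤ -κ * ‖ι x‖ ^ 2

variable {X : Type*} [NormedAddCommGroup X] [InnerProductSpace ℂ X]
  {A : X →ₗ.[ℂ] X} {β : ℂ} {V W : Type*} [NormedAddCommGroup V] [NormedSpace ℂ V]
  [NormedAddCommGroup W] [NormedSpace ℂ W] {T : C0Semigroup X}

namespace GelfandFrame

variable (Fr : GelfandFrame A β V W)

include Fr in
lemma norm_op_le_one (hA : T.IsGenerator A) (t : ℝ≥0) : ‖T.op t‖ ≤ 1 :=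
  hA.norm_op_le_one Fr.dense_domain (fun x => (Fr.coercive x).trans (by
    have := Fr.κ_pos
    have : 0 ≤ Fr.κ * ‖Fr.ι x‖ ^ 2 := by positivity
    linarith)) t

lemma norm_ι_resolventDom_le {α : ℂ} (hα : α ∈ resolventSet A) (x : X) :
    ‖Fr.ι (resolventDom hα x)‖ ≤
      √(Fr.κ⁻¹ * ((‖α‖ * ‖resolvent A α‖ + 1) * ‖resolvent A α‖)) * ‖x‖ := by
  have hκ := Fr.κ_pos
  have h1 := Fr.coercive (resolventDom hα x)
  rw [apply_resolventDom, coe_resolventDom] at h1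
  have h2 : ‖inner ℂ (α • resolvent A α x - x) (resolvent A α x)‖ ≤
      ((‖α‖ * ‖resolvent A α‖ + 1) * ‖x‖) * (‖resolvent A α‖ * ‖x‖) := by
    refine (norm_inner_le_norm _ _).trans ?_
    gcongr
    · refine (norm_sub_le _ _).trans ?_
      rw [norm_smul, add_mul, one_mul, mul_assoc]
      gcongr
      exact (resolvent A α).le_opNorm x
    · exact (resolvent A α).le_opNorm x
  have h3 := (abs_le.1 (Complex.abs_re_le_norm
    (inner ℂ (α • resolvent A α x - x) (resolvent A α x)))).1
  refine abs_le_of_sq_le_sq' ?_ (by positivity) |>.2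
  rw [mul_pow, Real.sq_sqrt (by positivity), mul_assoc, inv_mul_eq_div, le_div_iff₀ hκ]
  nlinarith

/-- `(α - A)⁻¹` as a bounded operator from `X` to `V`. -/
noncomputable def lift {α : ℂ} (hα : α ∈ resolventSet A) : X →L[ℂ] V :=
  (Fr.ι ∘ₗ resolventDom hα).mkContinuous _ (Fr.norm_ι_resolventDom_le hα)

lemma lift_apply {α : ℂ} (hα : α ∈ resolventSet A) (x : X) :
    Fr.lift hα x = Fr.ι (resolventDom hα x) := rfl

lemma j_lift {α : ℂ} (hα : α ∈ resolventSet A) (x : X) : Fr.j (Fr.lift hα x) = resolvent A α x := by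
  rw [lift_apply, Fr.j_ι, coe_resolventDom]

/-- `z` is the mild solution on `[0, t]` of `z' = A z + f`, `z(0) = z₀`, with an inhomogeneity
`f ∈ L²(0, t; W)`, and `v ∈ L²(0, t; V)` is `z` regarded as a `V`-valued function. The variation of
constants formula is stated after application of the injective operator `(β - A)⁻¹`. -/
structure IsMild (T : C0Semigroup X) (t : ℝ) (z₀ : X) (f : ℝ → W) (z : ℝ → X) (v : ℝ → V) :
    Prop where
  memLp_input : MemLp f 2 (vol t)
  memLp : MemLp v 2 (vol t)
  state : ∀ s ∈ Icc 0 t, resolvent A β (z s) = T.op s.toNNReal (resolvent A β z₀) +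
    T.conv (fun r => Fr.J (f r)) s
  ae_eq : ∀ᵐ s ∂vol t, Fr.j (v s) = z s

/-- The energy estimate for `z' = A z + f`, `z(0) = z₀`, with an exponential weight. -/
def HasEnergyBound (t : ℝ) (z₀ : X) (f : ℝ → W) (z : ℝ → X) (v : ℝ → V) : Prop :=
  ∀ ν : ℝ, ∀ s ∈ Icc 0 t,
    Real.exp (2 * ν * s) * ‖z s‖ ^ 2 + Fr.κ * normL2w ν (Ioo 0 s) v ^ 2 ≤
      ‖z₀‖ ^ 2 + 2 * ν * normL2w ν (Ioo 0 s) z ^ 2 + Fr.κ⁻¹ * normL2w ν (Ioo 0 s) f ^ 2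

/-! ### Classical solutions -/

section Classical

/-- The mild solution of `y' = A y + h`, `y(0) = x`, with an `X`-valued inhomogeneity. -/
noncomputable def _root_.BilinearFeedback.C0Semigroup.mildSol (T : C0Semigroup X) (x : X)
    (h : ℝ → X) (s : ℝ) : X :=
  T.op s.toNNReal x + T.conv h s

lemma _root_.Continuous.memLp_vol {U : Type*} [NormedAddCommGroup U] {f : ℝ → U}
    (hf : Continuous f) (t : ℝ) : MemLp f 2 (vol t) := by
  obtain ⟨C, hC⟩ := (isCompact_Icc (a := (0 : ℝ)) (b := t)).exists_bound_of_continuousOn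
    hf.continuousOn
  refine MemLp.of_bound hf.aestronglyMeasurable C ?_
  filter_upwards [ae_restrict_mem measurableSet_Ioo] with s hs
  exact hC s (Ioo_subset_Icc_self hs)

variable (hA : T.IsGenerator A) (hβ : β ∈ resolventSet A) {h : ℝ → X} (hh : Continuous h) (x : X)

include Fr hA hh in
lemma continuous_mildSol : Continuous (T.mildSol x h) :=
  (T.continuous_orbit x).add (C0Semigroup.continuous_conv (Fr.norm_op_le_one hA) hh)

variable [CompleteSpace X]

include Fr hA hβ hh in
lemma resolvent_mildSol (s : ℝ) :
    resolvent A β (T.mildSol x h s) = T.op s.toNNReal (resolvent A β x) +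
      T.conv (fun r => resolvent A β (h r)) s := by
  rw [C0Semigroup.mildSol, map_add, hA.resolvent_op hβ,
    C0Semigroup.map_conv (Fr.norm_op_le_one hA) (hh.intervalIntegrable _ _) _
      (fun t x => hA.resolvent_op hβ t x)]

include hA hβ hh in
lemma isMild_mildSol {t : ℝ} :
    Fr.IsMild T t (resolvent A β x) (fun s => Fr.k (resolvent A β (h s)))
      (fun s => resolvent A β (T.mildSol x h s)) (fun s => Fr.lift hβ (T.mildSol x h s)) where
  memLp_input := by
    apply Continuous.memLp_vol
    fun_prop
  memLp := by
    apply Continuous.memLp_vol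
    have := Fr.continuous_mildSol hA hh x
    fun_prop
  state s _ := by
    simp only [Fr.J_k]
    rw [Fr.resolvent_mildSol hA hβ hh x s, map_add, hA.resolvent_op hβ,
      C0Semigroup.map_conv (Fr.norm_op_le_one hA) _ _ (fun t x => hA.resolvent_op hβ t x)]
    exact Continuous.intervalIntegrable (by fun_prop) _ _
  ae_eq := Eventually.of_forall fun s => Fr.j_lift hβ _

include Fr hA hβ hh in
lemma resolvent_mildSol_eq_integral {s : ℝ} (hs : 0 ≤ s) :
    resolvent A β (T.mildSol x h s) = resolvent A β x + ∫ r in (0 : ℝ)..s,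
      (β • resolvent A β (T.mildSol x h r) - T.mildSol x h r + resolvent A β (h r)) := by
  set R := resolvent A β with hR
  have hT := Fr.norm_op_le_one hA
  have hc : Continuous fun r => T.conv h r := C0Semigroup.continuous_conv hT hh
  have h1 := hA.integral_orbit (resolvent_mem_graph hβ x) hs
  have h2 := hA.resolvent_conv hβ hT hs (hh.intervalIntegrable 0 s)
  rw [← hR] at h1 h2
  have e : ∀ r, β • R (T.mildSol x h r) - T.mildSol x h r + R (h r) =
      T.op r.toNNReal (β • R x - x) + (β • R (T.conv h r) - T.conv h r + R (h r)) := fun r => by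
    simp only [C0Semigroup.mildSol, map_add, map_sub, map_smul, smul_add, hR, hA.resolvent_op hβ]
    abel
  have hcR : Continuous fun r => β • R (T.conv h r) := by fun_prop
  have hhR : Continuous fun r => R (h r) := by fun_prop
  have hc1 : Continuous fun r => β • R (T.conv h r) - T.conv h r := by fun_prop
  have hc2 : Continuous fun r => β • R (T.conv h r) - T.conv h r + R (h r) := by fun_prop
  simp only [e]
  rw [intervalIntegral.integral_add ((T.continuous_orbit _).intervalIntegrable _ _)
      (hc2.intervalIntegrable _ _), h1,
    intervalIntegral.integral_add (hc1.intervalIntegrable _ _)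
      (hhR.intervalIntegrable _ _),
    intervalIntegral.integral_sub (hcR.intervalIntegrable _ _) (hc.intervalIntegrable _ _),
    intervalIntegral.integral_smul, R.intervalIntegral_comp_comm (hc.intervalIntegrable _ _),
    R.intervalIntegral_comp_comm (hh.intervalIntegrable _ _), C0Semigroup.mildSol, map_add, h2, hR,
    hA.resolvent_op hβ]
  abel

include hA hβ hh in
lemma hasEnergyBound_mildSol {t : ℝ} :
    Fr.HasEnergyBound t (resolvent A β x) (fun s => Fr.k (resolvent A β (h s)))
      (fun s => resolvent A β (T.mildSol x h s)) (fun s => Fr.lift hβ (T.mildSol x h s)) := by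
  intro ν s hs
  have hκ := Fr.κ_pos
  set R := resolvent A β with hR
  set y := T.mildSol x h with hy
  have hyc : Continuous y := Fr.continuous_mildSol hA hh x
  have hz : Continuous fun r => R (y r) := by fun_prop
  have hv : Continuous fun r => Fr.lift hβ (y r) := by fun_prop
  have hf : Continuous fun r => Fr.k (R (h r)) := by fun_prop
  have hz' : Continuous fun r => β • R (y r) - y r + R (h r) := by fun_prop
  have key := weighted_energy_le (z := fun r => R (y r))
    (z' := fun r => β • R (y r) - y r + R (h r))
    (q := fun r => -Fr.κ * ‖Fr.lift hβ (y r)‖ ^ 2 + Fr.κ⁻¹ * ‖Fr.k (R (h r))‖ ^ 2) ν hs.1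
    hz.continuousOn hz'.continuousOn (by fun_prop) (fun r hr => by
      have h1 : HasDerivAt (fun r => R x + ∫ r' in (0 : ℝ)..r,
          (β • R (y r') - y r' + R (h r'))) (β • R (y r) - y r + R (h r)) r :=
        (intervalIntegral.integral_hasDerivAt_right (hz'.intervalIntegrable _ _)
          (hz'.stronglyMeasurableAtFilter _ _) hz'.continuousAt).const_add _
      refine h1.hasDerivWithinAt.congr (fun r' hr' => ?_) ?_
      · exact Fr.resolvent_mildSol_eq_integral hA hβ hh x (hr.1.le.trans (le_of_lt hr'))
      · exact Fr.resolvent_mildSol_eq_integral hA hβ hh x hr.1.le) (fun r _ => by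
      have h1 := Fr.coercive (resolventDom hβ (y r))
      rw [apply_resolventDom, coe_resolventDom, ← Fr.lift_apply, ← hR] at h1
      have h2 := Fr.norm_inner_le (R (h r)) (Fr.lift hβ (y r))
      rw [Fr.j_lift, ← hR] at h2
      have h3 := (Complex.re_le_norm _).trans h2
      rw [inner_add_left, Complex.add_re]
      -- the elementary inequality `2 a b ≤ κ a² + κ⁻¹ b²`
      have h4 : 2 * (‖Fr.k (R (h r))‖ * ‖Fr.lift hβ (y r)‖) ≤
          Fr.κ * ‖Fr.lift hβ (y r)‖ ^ 2 + Fr.κ⁻¹ * ‖Fr.k (R (h r))‖ ^ 2 := by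
        have h5 : 0 ≤ Fr.κ⁻¹ * (Fr.κ * ‖Fr.lift hβ (y r)‖ - ‖Fr.k (R (h r))‖) ^ 2 := by positivity
        have h6 : Fr.κ⁻¹ * (Fr.κ * ‖Fr.lift hβ (y r)‖ - ‖Fr.k (R (h r))‖) ^ 2 =
            Fr.κ * ‖Fr.lift hβ (y r)‖ ^ 2 + Fr.κ⁻¹ * ‖Fr.k (R (h r))‖ ^ 2 -
              2 * (‖Fr.k (R (h r))‖ * ‖Fr.lift hβ (y r)‖) := by
          field_simp; ring
        linarith
      linarith)
  have hexp : Continuous fun r : ℝ => Real.exp (2 * ν * r) := by fun_prop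
  have e0 : R (y 0) = R x := by
    simp [hy, C0Semigroup.mildSol, C0Semigroup.conv, T.op_zero_apply]
  have e1 : ∫ r in (0 : ℝ)..s, Real.exp (2 * ν * r) * (2 * ν * ‖R (y r)‖ ^ 2 +
      (-Fr.κ * ‖Fr.lift hβ (y r)‖ ^ 2 + Fr.κ⁻¹ * ‖Fr.k (R (h r))‖ ^ 2)) =
      2 * ν * normL2w ν (Ioo 0 s) (fun r => R (y r)) ^ 2 +
      (-Fr.κ * normL2w ν (Ioo 0 s) (fun r => Fr.lift hβ (y r)) ^ 2 +
        Fr.κ⁻¹ * normL2w ν (Ioo 0 s) (fun r => Fr.k (R (h r))) ^ 2) := by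
    rw [normL2w_sq hs.1 (hz.memLp_vol s), normL2w_sq hs.1 (hv.memLp_vol s),
      normL2w_sq hs.1 (hf.memLp_vol s), ← intervalIntegral.integral_const_mul,
      ← intervalIntegral.integral_const_mul, ← intervalIntegral.integral_const_mul,
      ← intervalIntegral.integral_add, ← intervalIntegral.integral_add]
    · refine intervalIntegral.integral_congr fun r _ => ?_
      ring
    all_goals exact Continuous.intervalIntegrable (by fun_prop) _ _
  rw [e0, e1] at key
  linarith

end Classical

end GelfandFrame

end Frame

/-! ### Existence, uniqueness and energy estimate for mild solutions -/

section Approximation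

variable {X W : Type*} [NormedAddCommGroup X] [NormedSpace ℂ X] [NormedAddCommGroup W]
  [NormedSpace ℂ W]

/-- Functions of the form `d ∘ h`, with `h` continuous and `d` of dense range, are dense in `L²`. -/
lemma exists_continuous_approx (d : X →L[ℂ] W) (hd : DenseRange d) {t : ℝ} {f : ℝ → W}
    (hf : MemLp f 2 (vol t)) {ε : ℝ} (hε : 0 < ε) :
    ∃ h : ℝ → X, Continuous h ∧ normL2w 0 (Ioo 0 t) (fun s => f s - d (h s)) ≤ ε := by
  suffices H : ∃ g : ℝ → W, eLpNorm (f - g) 2 (vol t) ≤ ENNReal.ofReal ε ∧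
      ∃ h : ℝ → X, Continuous h ∧ g = fun s => d (h s) by
    obtain ⟨g, hg, h, hh, rfl⟩ := H
    refine ⟨h, hh, ?_⟩
    rw [normL2w_zero_eq]
    exact ENNReal.toReal_le_of_le_ofReal hε.le hg
  refine hf.induction_dense (by norm_num)
    (fun g => ∃ h : ℝ → X, Continuous h ∧ g = fun s => d (h s)) ?_ ?_ ?_ (by simpa using hε)
  · intro c s hs _ ε' hε'
    obtain ⟨e, he0, he⟩ : ∃ e : ℝ, 0 < e ∧ ENNReal.ofReal e ≤ ε' := by
      obtain ⟨e, he0, he⟩ := ENNReal.lt_iff_exists_nnreal_btwn.1 (pos_iff_ne_zero.2 hε')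
      exact ⟨e, by exact_mod_cast he0, by simpa using he.le⟩
    have h1 : MemLp (s.indicator fun _ => (1 : ℝ)) 2 (vol t) :=
      (memLp_const 1).indicator hs
    set M := (eLpNorm (fun _ : ℝ => (1 : ℝ)) 2 (vol t)).toReal with hM
    have hM0 : 0 ≤ M := ENNReal.toReal_nonneg
    have hMe : eLpNorm (fun _ : ℝ => (1 : ℝ)) 2 (vol t) = ENNReal.ofReal M :=
      (ENNReal.ofReal_toReal (memLp_const (1 : ℝ)).eLpNorm_ne_top).symm
    obtain ⟨x, hx⟩ := hd.exists_dist_lt c (ε := e / 2 / (M + 1)) (by positivity)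
    rw [dist_comm, dist_eq_norm] at hx
    obtain ⟨φ, -, hφ, hφc, -⟩ := h1.exists_hasCompactSupport_eLpNorm_sub_le (by norm_num)
      (ε := ENNReal.ofReal (e / 2 / (‖d x‖ + 1))) (by simp; positivity)
    refine ⟨fun r => d (φ r • x), ?_, _, hφc.smul continuous_const, rfl⟩
    have hsplit : (fun r => d (φ r • x)) - (s.indicator fun _ => c) =
        (fun r => -((s.indicator (fun _ => (1 : ℝ)) - φ) r • d x)) +
          (s.indicator fun _ => d x - c) := by
      ext r
      simp only [Pi.sub_apply, Pi.add_apply, indicator]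
      rw [← Complex.coe_smul, map_smul, Complex.coe_smul, sub_smul]
      split_ifs <;> simp
    rw [hsplit]
    refine (eLpNorm_add_le (((h1.aestronglyMeasurable.sub hφc.aestronglyMeasurable).smul_const _).neg)
      (aestronglyMeasurable_const.indicator hs) (by norm_num)).trans (le_trans ?_ he)
    have b1 : eLpNorm (fun r => -((s.indicator (fun _ => (1 : ℝ)) - φ) r • d x)) 2 (vol t) ≤
        ENNReal.ofReal (e / 2) := by
      refine (eLpNorm_le_mul_eLpNorm_of_ae_le_mul (c := ‖d x‖)
        (g := s.indicator (fun _ => (1 : ℝ)) - φ) (Eventually.of_forall fun r => ?_) 2).trans ?_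
      · rw [norm_neg, norm_smul, mul_comm]
      · refine (mul_le_mul_right hφ _).trans ?_
        rw [← ENNReal.ofReal_mul (norm_nonneg _)]
        refine ENNReal.ofReal_le_ofReal ?_
        rw [mul_div_assoc', div_le_iff₀ (by positivity)]
        nlinarith [norm_nonneg (d x)]
    have b2 : eLpNorm (s.indicator fun _ => d x - c) 2 (vol t) ≤ ENNReal.ofReal (e / 2) := by
      refine (eLpNorm_le_mul_eLpNorm_of_ae_le_mul (c := ‖d x - c‖)
        (g := fun _ => (1 : ℝ)) (Eventually.of_forall fun r => ?_) 2).trans ?_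
      · by_cases hr : r ∈ s <;> simp [hr]
      · rw [hMe, ← ENNReal.ofReal_mul (norm_nonneg _)]
        refine ENNReal.ofReal_le_ofReal ?_
        calc ‖d x - c‖ * M ≤ e / 2 / (M + 1) * M := by gcongr
          _ ≤ e / 2 := by
            rw [div_mul_eq_mul_div, div_le_iff₀ (by positivity)]
            nlinarith
    refine (add_le_add b1 b2).trans_eq ?_
    rw [← ENNReal.ofReal_add (by positivity) (by positivity), add_halves]
  · rintro _ _ ⟨h, hh, rfl⟩ ⟨h', hh', rfl⟩
    exact ⟨fun s => h s + h' s, hh.add hh', by ext s; simp⟩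
  · rintro _ ⟨h, hh, rfl⟩
    exact (by fun_prop : Continuous fun s => d (h s)).aestronglyMeasurable

end Approximation

namespace GelfandFrame

variable {X : Type*} [NormedAddCommGroup X] [InnerProductSpace ℂ X]
  {A : X →ₗ.[ℂ] X} {β : ℂ} {V W : Type*} [NormedAddCommGroup V] [NormedSpace ℂ V]
  [NormedAddCommGroup W] [NormedSpace ℂ W] {T : C0Semigroup X} {Fr : GelfandFrame A β V W}
  {t : ℝ} {z₀ z₀' : X} {f f' : ℝ → W} {z z' : ℝ → X} {v v' : ℝ → V}

lemma intervalIntegrable_J (Fr : GelfandFrame A β V W) (hf : MemLp f 2 (vol t)) {s : ℝ}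
    (hs : s ∈ Icc 0 t) : IntervalIntegrable (fun r => Fr.J (f r)) volume 0 s :=
  intervalIntegrable_of_memLp_vol hs.1 (Fr.J.comp_memLp' (memLp_vol_mono hs.2 hf))

lemma IsMild.add (hA : T.IsGenerator A) (h : Fr.IsMild T t z₀ f z v)
    (h' : Fr.IsMild T t z₀' f' z' v') :
    Fr.IsMild T t (z₀ + z₀') (fun s => f s + f' s) (fun s => z s + z' s) (fun s => v s + v' s) where
  memLp_input := h.memLp_input.add h'.memLp_input
  memLp := h.memLp.add h'.memLp
  state s hs := by
    simp only [map_add]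
    rw [h.state s hs, h'.state s hs, C0Semigroup.conv_add (Fr.norm_op_le_one hA)
      (Fr.intervalIntegrable_J h.memLp_input hs) (Fr.intervalIntegrable_J h'.memLp_input hs)]
    abel
  ae_eq := by
    filter_upwards [h.ae_eq, h'.ae_eq] with s hs hs'
    rw [map_add, hs, hs']

lemma IsMild.smul (c : ℂ) (h : Fr.IsMild T t z₀ f z v) :
    Fr.IsMild T t (c • z₀) (fun s => c • f s) (fun s => c • z s) (fun s => c • v s) where
  memLp_input := h.memLp_input.const_smul c
  memLp := h.memLp.const_smul c
  state s hs := by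
    simp only [map_smul]
    rw [h.state s hs, C0Semigroup.conv_smul, smul_add]
  ae_eq := by
    filter_upwards [h.ae_eq] with s hs
    rw [map_smul, hs]

lemma IsMild.sub (hA : T.IsGenerator A) (h : Fr.IsMild T t z₀ f z v)
    (h' : Fr.IsMild T t z₀' f' z' v') :
    Fr.IsMild T t (z₀ - z₀') (fun s => f s - f' s) (fun s => z s - z' s)
      (fun s => v s - v' s) := by
  simpa [sub_eq_add_neg] using h.add hA (h'.smul (-1))

lemma IsMild.mono {s : ℝ} (hst : s ≤ t) (h : Fr.IsMild T t z₀ f z v) :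
    Fr.IsMild T s z₀ f z v where
  memLp_input := memLp_vol_mono hst h.memLp_input
  memLp := memLp_vol_mono hst h.memLp
  state r hr := h.state r (Icc_subset_Icc_right hst hr)
  ae_eq := ae_vol_mono hst h.ae_eq

lemma IsMild.congr (h : Fr.IsMild T t z₀ f z v) (hf : ∀ᵐ s ∂vol t, f s = f' s)
    (hz : ∀ s ∈ Icc 0 t, z s = z' s) (hv : ∀ᵐ s ∂vol t, v s = v' s) :
    Fr.IsMild T t z₀ f' z' v' where
  memLp_input := h.memLp_input.ae_eq hf
  memLp := h.memLp.ae_eq hv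
  state s hs := by
    rw [← hz s hs, h.state s hs, C0Semigroup.conv_congr_ae hs.1]
    filter_upwards [ae_vol_mono hs.2 hf] with r hr
    rw [hr]
  ae_eq := by
    filter_upwards [h.ae_eq, hv, ae_restrict_mem measurableSet_Ioo] with s h1 h2 h3
    rw [← h2, h1, hz s (Ioo_subset_Icc_self h3)]

/-- Mild solutions are unique: the variation of constants formula determines the state, and the
embedding `V ⊆ X` is injective. -/
lemma IsMild.unique (hβ : β ∈ resolventSet A) (h : Fr.IsMild T t z₀ f z v)
    (h' : Fr.IsMild T t z₀ f' z' v') (hf : ∀ᵐ s ∂vol t, f s = f' s) :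
    (∀ s ∈ Icc 0 t, z s = z' s) ∧ ∀ᵐ s ∂vol t, v s = v' s := by
  have hz : ∀ s ∈ Icc 0 t, z s = z' s := fun s hs => by
    refine resolvent_injective hβ ?_
    rw [h.state s hs, h'.state s hs, C0Semigroup.conv_congr_ae hs.1]
    filter_upwards [ae_vol_mono hs.2 hf] with r hr
    rw [hr]
  refine ⟨hz, ?_⟩
  filter_upwards [h.ae_eq, h'.ae_eq, ae_restrict_mem measurableSet_Ioo] with s h1 h2 h3
  refine Fr.j_injective ?_
  rw [h1, h2, hz s (Ioo_subset_Icc_self h3)]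

/-- The energy estimate without weight, after taking square roots. -/
lemma HasEnergyBound.norm_le (h : Fr.HasEnergyBound t z₀ f z v) {s : ℝ} (hs : s ∈ Icc 0 t) :
    ‖z s‖ ≤ ‖z₀‖ + √Fr.κ⁻¹ * normL2w 0 (Ioo 0 s) f ∧
    √Fr.κ * normL2w 0 (Ioo 0 s) v ≤ ‖z₀‖ + √Fr.κ⁻¹ * normL2w 0 (Ioo 0 s) f := by
  have hκ := Fr.κ_pos
  have h1 := h 0 s hs
  simp only [mul_zero, zero_mul, Real.exp_zero, one_mul, add_zero] at h1
  have e1 : √Fr.κ ^ 2 = Fr.κ := Real.sq_sqrt hκ.le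
  have e2 : √Fr.κ⁻¹ ^ 2 = Fr.κ⁻¹ := Real.sq_sqrt (inv_nonneg.2 hκ.le)
  have hf := normL2w_nonneg 0 (Ioo 0 s) f
  have hb : ‖z₀‖ ^ 2 + Fr.κ⁻¹ * normL2w 0 (Ioo 0 s) f ^ 2 ≤
      (‖z₀‖ + √Fr.κ⁻¹ * normL2w 0 (Ioo 0 s) f) ^ 2 := by
    rw [add_sq, mul_pow, e2]
    have : 0 ≤ 2 * ‖z₀‖ * (√Fr.κ⁻¹ * normL2w 0 (Ioo 0 s) f) := by positivity
    linarith
  have hv : 0 ≤ Fr.κ * normL2w 0 (Ioo 0 s) v ^ 2 := by positivity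
  constructor
  · refine abs_le_of_sq_le_sq' ?_ (by positivity) |>.2
    linarith
  · refine abs_le_of_sq_le_sq' ?_ (by positivity) |>.2
    rw [mul_pow, e1]
    nlinarith [sq_nonneg ‖z s‖]

lemma _root_.BilinearFeedback.denseRange_resolvent (hd : Dense (A.domain : Set X))
    (hβ : β ∈ resolventSet A) : DenseRange (resolvent A β) := by
  refine hd.mono fun x hx => ?_
  obtain ⟨y, hy⟩ := resolventDom_surjective hβ ⟨x, hx⟩
  exact ⟨y, congrArg Subtype.val hy⟩

lemma _root_.BilinearFeedback.C0Semigroup.mildSol_sub (hT : ∀ t, ‖T.op t‖ ≤ 1) (x x' : X)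
    {h h' : ℝ → X} (hh : Continuous h) (hh' : Continuous h') (s : ℝ) :
    T.mildSol (x - x') (fun r => h r - h' r) s = T.mildSol x h s - T.mildSol x' h' s := by
  have : T.conv (fun r => h r - h' r) s = T.conv h s - T.conv h' s := by
    have h1 := C0Semigroup.conv_add (t := s) hT (hh.intervalIntegrable _ _)
      ((hh'.const_smul (-1 : ℂ)).intervalIntegrable _ _)
    have h2 := C0Semigroup.conv_smul (T := T) (-1) h' s
    simp only [Pi.smul_apply] at h1
    rw [Pi.smul_def, h2] at h1
    simpa [sub_eq_add_neg] using h1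
  simp only [C0Semigroup.mildSol, this, map_sub]
  abel

variable [CompleteSpace X] [CompleteSpace V]

/-- Existence of mild solutions for `f ∈ L²(0, t; W)`: they are limits of classical solutions, for
which the energy estimate follows from coercivity. -/
lemma exists_isMild (Fr : GelfandFrame A β V W) (hA : T.IsGenerator A) (hβ : β ∈ resolventSet A)
    (ht : 0 ≤ t) (z₀ : X) (hf : MemLp f 2 (vol t)) :
    ∃ z v, ContinuousOn z (Icc 0 t) ∧ Fr.IsMild T t z₀ f z v ∧ Fr.HasEnergyBound t z₀ f z v := by
  have hκ := Fr.κ_pos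
  have hT := Fr.norm_op_le_one hA
  have hR := denseRange_resolvent Fr.dense_domain hβ
  set a : ℕ → ℝ := fun n => 1 / ((n : ℝ) + 1) with ha
  have ha0 : ∀ n, 0 < a n := fun n => by positivity
  have halim : Tendsto a atTop (𝓝 0) := tendsto_one_div_add_atTop_nhds_zero_nat
  have hanti : ∀ {m n}, m ≤ n → a n ≤ a m := fun {m n} hmn => by
    simp only [ha]; gcongr
  have hx : ∀ n, ∃ x, ‖resolvent A β x - z₀‖ ≤ a n := fun n => by
    obtain ⟨x, hx⟩ := hR.exists_dist_lt z₀ (ha0 n)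
    exact ⟨x, by rw [← dist_eq_norm, dist_comm]; exact hx.le⟩
  have hh : ∀ n, ∃ h : ℝ → X, Continuous h ∧
      normL2w 0 (Ioo 0 t) (fun s => f s - (Fr.k.comp (resolvent A β)) (h s)) ≤ a n := fun n =>
    exists_continuous_approx (Fr.k.comp (resolvent A β))
      (Fr.denseRange_k.comp hR Fr.k.continuous) hf (ha0 n)
  choose x hx using hx
  choose h hhc hh using hh
  simp only [ContinuousLinearMap.comp_apply] at hh
  set zn : ℕ → ℝ → X := fun n s => resolvent A β (T.mildSol (x n) (h n) s) with hzn
  set vn : ℕ → ℝ → V := fun n s => Fr.lift hβ (T.mildSol (x n) (h n) s) with hvn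
  set fn : ℕ → ℝ → W := fun n s => Fr.k (resolvent A β (h n s)) with hfn
  have hmild : ∀ n, Fr.IsMild T t (resolvent A β (x n)) (fn n) (zn n) (vn n) := fun n =>
    Fr.isMild_mildSol hA hβ (hhc n) (x n)
  have henergy : ∀ n, Fr.HasEnergyBound t (resolvent A β (x n)) (fn n) (zn n) (vn n) := fun n =>
    Fr.hasEnergyBound_mildSol hA hβ (hhc n) (x n)
  have hfnm : ∀ n, MemLp (fn n) 2 (vol t) := fun n => (hmild n).memLp_input
  have hvnm : ∀ n, MemLp (vn n) 2 (vol t) := fun n => (hmild n).memLp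
  have hffn : ∀ n, normL2w 0 (Ioo 0 t) (fun s => fn n s - f s) ≤ a n := fun n => by
    rw [← normL2w_neg]; simpa using hh n
  -- the approximations form a Cauchy sequence, by the energy estimate for the differences
  set C : ℝ := 2 * (1 + √Fr.κ⁻¹) with hC
  have hdiff : ∀ n m N, N ≤ n → N ≤ m → ∀ s ∈ Icc 0 t, ‖zn n s - zn m s‖ ≤ C * a N ∧
      √Fr.κ * normL2w 0 (Ioo 0 s) (fun r => vn n r - vn m r) ≤ C * a N := by
    intro n m N hn hm s hs
    have h1 := (Fr.hasEnergyBound_mildSol hA hβ ((hhc n).sub (hhc m)) (x n - x m)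
      (t := t)).norm_le hs
    simp only [Pi.sub_def, C0Semigroup.mildSol_sub hT _ _ (hhc n) (hhc m), map_sub] at h1
    have h2 : normL2w 0 (Ioo 0 s) (fun r => fn n r - fn m r) ≤ a N + a N := by
      have hm1 : MemW 0 (Ioo 0 t) (fun r => fn n r - f r) := memW_of_memLp ((hfnm n).sub hf)
      have hm2 : MemW 0 (Ioo 0 t) (fun r => f r - fn m r) := memW_of_memLp (hf.sub (hfnm m))
      refine (normL2w_mono_set (Ioo_subset_Ioo_right hs.2)
        (memW_of_memLp ((hfnm n).sub (hfnm m)))).trans ?_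
      have h3 := normL2w_add_le hm1 hm2
      simp only [sub_add_sub_cancel] at h3
      exact h3.trans (add_le_add ((hffn n).trans (hanti hn)) ((hh m).trans (hanti hm)))
    have h3 : ‖resolvent A β (x n) - resolvent A β (x m)‖ ≤ a N + a N := by
      rw [← sub_sub_sub_cancel_right _ _ z₀]
      exact (norm_sub_le _ _).trans (add_le_add ((hx n).trans (hanti hn)) ((hx m).trans (hanti hm)))
    have h4 : ‖resolvent A β (x n) - resolvent A β (x m)‖ +
        √Fr.κ⁻¹ * normL2w 0 (Ioo 0 s) (fun r => fn n r - fn m r) ≤ C * a N := by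
      calc _ ≤ (a N + a N) + √Fr.κ⁻¹ * (a N + a N) := by gcongr
        _ = C * a N := by rw [hC]; ring
    exact ⟨h1.1.trans h4, h1.2.trans h4⟩
  have hCa : Tendsto (fun N => C * a N) atTop (𝓝 0) := by simpa using halim.const_mul C
  -- the limit of the states
  have hzlim : ∀ s, ∃ p, s ∈ Icc 0 t → Tendsto (fun n => zn n s) atTop (𝓝 p) := fun s => by
    by_cases hs : s ∈ Icc 0 t
    · obtain ⟨p, hp⟩ := cauchySeq_tendsto_of_complete (cauchySeq_of_le_tendsto_0
        (s := fun n => zn n s) (fun N => C * a N)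
        (fun n m N hn hm => by rw [dist_eq_norm]; exact (hdiff n m N hn hm s hs).1) hCa)
      exact ⟨p, fun _ => hp⟩
    · exact ⟨0, fun h => absurd h hs⟩
  choose z hz using hzlim
  have hzu : ∀ n, ∀ s ∈ Icc 0 t, ‖zn n s - z s‖ ≤ C * a n := fun n s hs => by
    refine le_of_tendsto ((tendsto_const_nhds.sub (hz s hs)).norm) ?_
    filter_upwards [eventually_ge_atTop n] with m hm
    exact (hdiff n m n le_rfl hm s hs).1
  have hzcont : ContinuousOn z (Icc 0 t) := by
    have hu : TendstoUniformlyOn zn z atTop (Icc 0 t) := by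
      rw [Metric.tendstoUniformlyOn_iff]
      intro ε hε
      filter_upwards [hCa.eventually_lt_const hε] with n hn s hs
      rw [dist_comm, dist_eq_norm]
      exact (hzu n s hs).trans_lt hn
    refine hu.continuousOn (Frequently.of_forall fun n => ?_)
    exact ((resolvent A β).continuous.comp (Fr.continuous_mildSol hA (hhc n) (x n))).continuousOn
  -- the limit of the `V`-valued functions
  have hdistV : ∀ n m, dist ((hvnm n).toLp) ((hvnm m).toLp) =
      normL2w 0 (Ioo 0 t) (fun r => vn n r - vn m r) := fun n m => by
    rw [dist_eq_norm, ← MemLp.toLp_sub, Lp.norm_toLp, normL2w_zero_eq]; rfl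
  have hκ' : 0 < √Fr.κ := Real.sqrt_pos.2 hκ
  obtain ⟨p, hp⟩ := cauchySeq_tendsto_of_complete (cauchySeq_of_le_tendsto_0
    (s := fun n => (hvnm n).toLp) (fun N => (√Fr.κ)⁻¹ * (C * a N)) (fun n m N hn hm => by
      rw [hdistV, ← div_eq_inv_mul, le_div_iff₀' hκ']
      exact (hdiff n m N hn hm t ⟨ht, le_rfl⟩).2) (by simpa using hCa.const_mul (√Fr.κ)⁻¹))
  have hvp : MemLp (p : ℝ → V) 2 (vol t) := Lp.memLp p
  have hvlim : Tendsto (fun n => normL2w 0 (Ioo 0 t) (fun r => vn n r - p r)) atTop (𝓝 0) := by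
    refine (tendsto_iff_norm_sub_tendsto_zero.1 hp).congr fun n => ?_
    rw [← Lp.toLp_coeFn p hvp, ← MemLp.toLp_sub, Lp.norm_toLp, normL2w_zero_eq]
    simp only [Lp.toLp_coeFn]; rfl
  have hflim : Tendsto (fun n => normL2w 0 (Ioo 0 t) (fun r => fn n r - f r)) atTop (𝓝 0) :=
    squeeze_zero (fun n => normL2w_nonneg _ _ _) hffn halim
  have hae : ∀ᵐ s ∂vol t, Fr.j (p s) = z s := by
    have h1 : Tendsto (fun n => eLpNorm (vn n - ⇑p) 2 (vol t)) atTop (𝓝 0) := by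
      rw [← ENNReal.tendsto_toReal_iff (fun n => ((hvnm n).sub hvp).eLpNorm_ne_top) (by simp)]
      refine hvlim.congr fun n => ?_
      rw [normL2w_zero_eq]; rfl
    obtain ⟨ns, hns, hae⟩ := (tendstoInMeasure_of_tendsto_eLpNorm (by norm_num)
      (fun n => (hvnm n).aestronglyMeasurable) hvp.aestronglyMeasurable h1).exists_seq_tendsto_ae
    filter_upwards [hae, ae_restrict_mem measurableSet_Ioo] with s hs hst
    refine tendsto_nhds_unique ((Fr.j.continuous.tendsto _).comp hs) ?_
    refine ((hz s (Ioo_subset_Icc_self hst)).comp hns.tendsto_atTop).congr fun n => ?_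
    exact (Fr.j_lift hβ _).symm
  have hxlim : Tendsto (fun n => resolvent A β (x n)) atTop (𝓝 z₀) :=
    tendsto_iff_norm_sub_tendsto_zero.2 (squeeze_zero (fun _ => norm_nonneg _) hx halim)
  refine ⟨z, p, hzcont, ⟨hf, hvp, fun s hs => ?_, hae⟩, fun ν s hs => ?_⟩
  · -- passage to the limit in the variation of constants formula
    have h1 : Tendsto (fun n => T.conv (fun r => Fr.J (fn n r)) s) atTop
        (𝓝 (T.conv (fun r => Fr.J (f r)) s)) := by
      rw [tendsto_iff_norm_sub_tendsto_zero]
      have h3 : Tendsto (fun n => √t * (‖Fr.J‖ * a n)) atTop (𝓝 0) := by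
        simpa using (halim.const_mul ‖Fr.J‖).const_mul √t
      refine squeeze_zero (fun _ => norm_nonneg _) (fun n => ?_) h3
      have h4 : T.conv (fun r => Fr.J (fn n r)) s - T.conv (fun r => Fr.J (f r)) s =
          T.conv (fun r => Fr.J (fn n r - f r)) s := by
        have h5 := C0Semigroup.conv_add (t := s) hT
          (Fr.intervalIntegrable_J ((hfnm n).sub hf) hs) (Fr.intervalIntegrable_J hf hs)
        simp only [Pi.sub_apply] at h5
        rw [sub_eq_iff_eq_add, ← h5]
        simp
      have hJ : MemLp (fun r => Fr.J (fn n r - f r)) 2 (vol t) :=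
        Fr.J.comp_memLp' ((hfnm n).sub hf)
      rw [h4]
      refine (C0Semigroup.norm_conv_le hT hs.1
        (intervalIntegrable_of_memLp_vol hs.1 (memLp_vol_mono hs.2 hJ))).trans ?_
      refine (integral_norm_le_normL2w hs.1 hs.2 hJ).trans ?_
      gcongr
      refine (normL2w_le_mul (norm_nonneg Fr.J) (memW_of_memLp ((hfnm n).sub hf))
        (Eventually.of_forall fun r => Fr.J.le_opNorm _)).trans ?_
      gcongr
      exact hffn n
    refine tendsto_nhds_unique (((resolvent A β).continuous.tendsto _).comp (hz s hs)) ?_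
    refine (((((T.op s.toNNReal).comp (resolvent A β)).continuous.tendsto _).comp hxlim).add
      h1).congr fun n => ?_
    exact ((hmild n).state s hs).symm
  · -- passage to the limit in the energy estimate
    have hjn : ∀ n, normL2w ν (Ioo 0 s) (zn n) = normL2w ν (Ioo 0 s) (fun r => Fr.j (vn n r)) :=
      fun n => normL2w_congr (ae_vol_mono hs.2 ((hmild n).ae_eq.mono fun r hr => hr.symm))
    have hj : normL2w ν (Ioo 0 s) z = normL2w ν (Ioo 0 s) (fun r => Fr.j (p r)) :=
      normL2w_congr (ae_vol_mono hs.2 (hae.mono fun r hr => hr.symm))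
    have hjlim : Tendsto (fun n => normL2w 0 (Ioo 0 t) (fun r => Fr.j (vn n r) - Fr.j (p r)))
        atTop (𝓝 0) := by
      have h1 := hvlim.const_mul ‖Fr.j‖
      rw [mul_zero] at h1
      refine squeeze_zero (fun _ => normL2w_nonneg _ _ _) (fun n => ?_) h1
      refine normL2w_le_mul (norm_nonneg _) (memW_of_memLp ((hvnm n).sub hvp))
        (Eventually.of_forall fun r => ?_)
      rw [← map_sub]
      exact Fr.j.le_opNorm _
    have l1 := tendsto_normL2w (ν := ν) hs.2 hvnm hvp hvlim
    have l2 := tendsto_normL2w (ν := ν) hs.2 hfnm hf hflim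
    have l3 := tendsto_normL2w (ν := ν) hs.2 (fun n => Fr.j.comp_memLp' (hvnm n))
      (Fr.j.comp_memLp' hvp) hjlim
    simp only [Function.comp_def] at l3
    rw [← hj] at l3
    simp only [← hjn] at l3
    exact le_of_tendsto_of_tendsto'
      ((((hz s hs).norm.pow 2).const_mul (Real.exp (2 * ν * s))).add ((l1.pow 2).const_mul Fr.κ))
      (((hxlim.norm.pow 2).add ((l3.pow 2).const_mul (2 * ν))).add ((l2.pow 2).const_mul Fr.κ⁻¹))
      fun n => henergy n ν s hs

end GelfandFrame

section

/-- A linear relation that is everywhere defined and bounded is the graph of a bounded operator. -/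
lemma exists_clm_of_relation {E F : Type*} [SeminormedAddCommGroup E] [NormedSpace ℂ E]
    [NormedAddCommGroup F] [NormedSpace ℂ F] (G : Submodule ℂ (E × F)) (C : ℝ)
    (hex : ∀ x, ∃ y, (x, y) ∈ G) (hb : ∀ x y, (x, y) ∈ G → ‖y‖ ≤ C * ‖x‖) :
    ∃ L : E →L[ℂ] F, ∀ x, (x, L x) ∈ G := by
  choose L hL using hex
  have huniq : ∀ x y, (x, y) ∈ G → y = L x := fun x y h => by
    have h1 := hb _ _ (G.sub_mem h (hL x))
    simp only [sub_self, norm_zero, mul_zero] at h1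
    exact sub_eq_zero.1 (norm_le_zero_iff.1 h1)
  refine ⟨LinearMap.mkContinuous { toFun := L, map_add' := fun x y => ?_, map_smul' := fun c x => ?_ }
    C fun x => hb _ _ (hL x), hL⟩
  · exact (huniq _ _ (G.add_mem (hL x) (hL y))).symm
  · exact (huniq _ _ (G.smul_mem c (hL x))).symm

end

namespace GelfandFrame

variable {X : Type*} [NormedAddCommGroup X] [InnerProductSpace ℂ X] [CompleteSpace X]
  {A : X →ₗ.[ℂ] X} {β : ℂ} {V W : Type*} [NormedAddCommGroup V] [NormedSpace ℂ V] [CompleteSpace V]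
  [NormedAddCommGroup W] [NormedSpace ℂ W] {T : C0Semigroup X} {Fr : GelfandFrame A β V W}
  {t : ℝ} {z₀ z₀' : X} {f f' : ℝ → W} {z z' : ℝ → X} {v v' : ℝ → V}

/-- By uniqueness, every mild solution is the limit of classical ones, and so it is continuous and
satisfies the energy estimate. -/
lemma IsMild.continuousOn_and_hasEnergyBound (hA : T.IsGenerator A) (hβ : β ∈ resolventSet A)
    (ht : 0 ≤ t) (h : Fr.IsMild T t z₀ f z v) :
    ContinuousOn z (Icc 0 t) ∧ Fr.HasEnergyBound t z₀ f z v := by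
  obtain ⟨z', v', hc, hm, he⟩ := Fr.exists_isMild hA hβ ht z₀ h.memLp_input
  obtain ⟨hz, hv⟩ := h.unique hβ hm (Eventually.of_forall fun _ => rfl)
  refine ⟨hc.congr hz, fun ν s hs => ?_⟩
  have h1 : normL2w ν (Ioo 0 s) z = normL2w ν (Ioo 0 s) z' := normL2w_congr <| by
    filter_upwards [ae_restrict_mem measurableSet_Ioo] with r hr
    exact hz r ⟨hr.1.le, hr.2.le.trans hs.2⟩
  have h2 : normL2w ν (Ioo 0 s) v = normL2w ν (Ioo 0 s) v' := normL2w_congr (ae_vol_mono hs.2 hv)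
  rw [h1, h2, hz s hs]
  exact he ν s hs

lemma IsMild.continuousOn (hA : T.IsGenerator A) (hβ : β ∈ resolventSet A)
    (ht : 0 ≤ t) (h : Fr.IsMild T t z₀ f z v) : ContinuousOn z (Icc 0 t) :=
  (h.continuousOn_and_hasEnergyBound hA hβ ht).1

lemma IsMild.hasEnergyBound (hA : T.IsGenerator A) (hβ : β ∈ resolventSet A)
    (ht : 0 ≤ t) (h : Fr.IsMild T t z₀ f z v) : Fr.HasEnergyBound t z₀ f z v :=
  (h.continuousOn_and_hasEnergyBound hA hβ ht).2

/-- Mild solutions exist globally in time for `f ∈ L²_loc(0, ∞; W)`. -/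
lemma exists_isMild_global (Fr : GelfandFrame A β V W) (hA : T.IsGenerator A)
    (hβ : β ∈ resolventSet A) (z₀ : X) (hf : ∀ t, MemLp f 2 (vol t)) :
    ∃ z v, ContinuousOn z (Ici 0) ∧ ∀ t ≥ 0, Fr.IsMild T t z₀ f z v := by
  have hex : ∀ t : ℝ, ∃ (z : ℝ → X) (v : ℝ → V), 0 ≤ t → Fr.IsMild T t z₀ f z v := fun t => by
    by_cases ht : 0 ≤ t
    · obtain ⟨z, v, -, h, -⟩ := Fr.exists_isMild hA hβ ht z₀ (hf t)
      exact ⟨z, v, fun _ => h⟩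
    · exact ⟨0, 0, fun h => absurd h ht⟩
  choose zt vt ht using hex
  set z : ℝ → X := fun s => zt s s with hz
  have hzt : ∀ t, ∀ s ∈ Icc 0 t, zt t s = z s := fun t s hs =>
    (((ht t (hs.1.trans hs.2)).mono hs.2).unique hβ (ht s hs.1)
      (Eventually.of_forall fun _ => rfl)).1 s ⟨hs.1, le_rfl⟩
  have hvt : ∀ t ≥ 0, ∀ᵐ s ∂vol t, vt t s = Function.invFun Fr.j (z s) := fun t h0 => by
    filter_upwards [(ht t h0).ae_eq, ae_restrict_mem measurableSet_Ioo] with s hs hst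
    rw [← hzt t s (Ioo_subset_Icc_self hst), ← hs, Function.leftInverse_invFun Fr.j_injective]
  have hm : ∀ t ≥ 0, Fr.IsMild T t z₀ f z fun s => Function.invFun Fr.j (z s) := fun t h0 =>
    (ht t h0).congr (Eventually.of_forall fun _ => rfl) (hzt t) (hvt t h0)
  refine ⟨z, _, fun s hs => ?_, hm⟩
  have hs0 : (0 : ℝ) ≤ s := hs
  have h1 : ContinuousOn z (Icc 0 (s + 1)) := (hm _ (by linarith)).continuousOn hA hβ (by linarith)
  refine (h1 s ⟨hs0, by linarith⟩).mono_of_mem_nhdsWithin ?_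
  filter_upwards [self_mem_nhdsWithin, nhdsWithin_le_nhds (Iio_mem_nhds (lt_add_one s))] with r h2 h3
  exact ⟨h2, le_of_lt h3⟩

/-- The bounded operator `(z₀, f) ↦ v` mapping initial values and inhomogeneities to mild solutions,
regarded as elements of `L²(0, t; V)`. -/
lemma exists_solutionOperator (Fr : GelfandFrame A β V W) (hA : T.IsGenerator A)
    (hβ : β ∈ resolventSet A) (ht : 0 ≤ t) :
    ∃ L : X × Lp W 2 (vol t) →L[ℂ] Lp V 2 (vol t), ∀ p, ∃ z, Fr.IsMild T t p.1 p.2 z (L p) := by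
  have hκ := Real.sqrt_pos.2 Fr.κ_pos
  let G : Submodule ℂ ((X × Lp W 2 (vol t)) × Lp V 2 (vol t)) :=
    { carrier := {q | ∃ z, Fr.IsMild T t q.1.1 q.1.2 z q.2}
      add_mem' := by
        rintro a b ⟨z, hz⟩ ⟨z', hz'⟩
        refine ⟨_, (hz.add hA hz').congr ?_ (fun _ _ => rfl) ?_⟩
        · filter_upwards [Lp.coeFn_add a.1.2 b.1.2] with s hs
          exact hs.symm
        · filter_upwards [Lp.coeFn_add a.2 b.2] with s hs
          exact hs.symm
      zero_mem' := by
        refine ⟨fun _ => 0, ⟨Lp.memLp _, Lp.memLp _, fun s hs => ?_, ?_⟩⟩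
        · have : T.conv (fun r => Fr.J ((0 : Lp W 2 (vol t)) r)) s = T.conv (fun _ => 0) s := by
            refine C0Semigroup.conv_congr_ae hs.1 (ae_vol_mono hs.2 ?_)
            filter_upwards [Lp.coeFn_zero W 2 (vol t)] with r hr
            rw [hr, Pi.zero_apply, map_zero]
          simp only [Prod.fst_zero, Prod.snd_zero]
          rw [this]
          simp [C0Semigroup.conv]
        · filter_upwards [Lp.coeFn_zero V 2 (vol t)] with r hr
          rw [Prod.snd_zero, hr, Pi.zero_apply, map_zero]
      smul_mem' := by
        rintro c a ⟨z, hz⟩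
        refine ⟨_, (hz.smul c).congr ?_ (fun _ _ => rfl) ?_⟩
        · filter_upwards [Lp.coeFn_smul c a.1.2] with s hs
          simp [hs]
        · filter_upwards [Lp.coeFn_smul c a.2] with s hs
          simp [hs] }
  refine exists_clm_of_relation G ((√Fr.κ)⁻¹ * (1 + √Fr.κ⁻¹)) (fun p => ?_) ?_
  · obtain ⟨z, v, -, h, -⟩ := Fr.exists_isMild hA hβ ht p.1 (Lp.memLp p.2)
    refine ⟨h.memLp.toLp, z, h.congr (Eventually.of_forall fun _ => rfl) (fun _ _ => rfl) ?_⟩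
    exact (MemLp.coeFn_toLp h.memLp).symm
  · rintro p v ⟨z, h⟩
    have h1 := ((h.hasEnergyBound hA hβ ht).norm_le ⟨ht, le_rfl⟩).2
    rw [normL2w_zero_eq, normL2w_zero_eq, ← Lp.norm_def, ← Lp.norm_def] at h1
    rw [mul_assoc, ← div_eq_inv_mul, le_div_iff₀' hκ]
    refine h1.trans ?_
    rw [add_mul, one_mul]
    gcongr
    · exact norm_fst_le p
    · exact norm_snd_le p

/-! ### The extended resolvent and the transfer function -/

omit [CompleteSpace X] [CompleteSpace V] in
/-- By coercivity, `κ ‖(α - A)⁻¹ x‖_V² ≤ Re ⟨x, (α - A)⁻¹ x⟩ ≤ ‖x‖_W ‖(α - A)⁻¹ x‖_V` for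
`Re α ≥ 0`. -/
lemma norm_lift_le (Fr : GelfandFrame A β V W) {α : ℂ} (hα : α ∈ resolventSet A) (h0 : 0 ≤ α.re)
    (x : X) : ‖Fr.lift hα x‖ ≤ Fr.κ⁻¹ * ‖Fr.k x‖ := by
  have hκ := Fr.κ_pos
  have h1 := Fr.coercive (resolventDom hα x)
  rw [apply_resolventDom, coe_resolventDom, ← Fr.lift_apply, inner_sub_left, Complex.sub_re,
    inner_smul_left, inner_self_eq_norm_sq_to_K] at h1
  have h2 := (Complex.re_le_norm _).trans (Fr.norm_inner_le x (Fr.lift hα x))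
  rw [Fr.j_lift] at h2
  have h3 : ((starRingEnd ℂ) α * (‖resolvent A α x‖ : ℂ) ^ 2).re =
      α.re * ‖resolvent A α x‖ ^ 2 := by
    rw [← Complex.ofReal_pow, Complex.re_mul_ofReal, Complex.conj_re]
  simp only [Complex.coe_algebraMap] at h1
  rw [h3] at h1
  have h4 : Fr.κ * ‖Fr.lift hα x‖ ^ 2 ≤ ‖Fr.k x‖ * ‖Fr.lift hα x‖ := by
    have : 0 ≤ α.re * ‖resolvent A α x‖ ^ 2 := by positivity
    linarith
  rw [inv_mul_eq_div, le_div_iff₀ hκ]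
  rcases (norm_nonneg (Fr.lift hα x)).eq_or_lt with h | h
  · rw [← h, zero_mul]; exact norm_nonneg _
  · nlinarith

omit [CompleteSpace X] [CompleteSpace V] in
include Fr in
lemma mem_growthHalfPlane (hA : T.IsGenerator A) {α : ℂ} (h : 0 < α.re) :
    α ∈ T.growthHalfPlane :=
  ⟨0, h, 1, fun t => by simpa using Fr.norm_op_le_one hA t⟩

/-- The resolvents extend to bounded operators from `W` to `V`; by coercivity they are uniformly
bounded on the right half-plane. -/
lemma exists_extendedResolvent (Fr : GelfandFrame A β V W) (hA : T.IsGenerator A)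
    (hβ : β ∈ resolventSet A) {α : ℂ} (hα : α ∈ resolventSet A) :
    ∃ Q : W →L[ℂ] V, (∀ x, Q (Fr.k x) = Fr.lift hα x) ∧
      (∀ w, Fr.j (Q w) = Fr.J w + (β - α) • resolvent A α (Fr.J w)) ∧
      (0 ≤ α.re → ‖Q‖ ≤ Fr.κ⁻¹) := by
  have h1 : (1 : ℂ) ∈ resolventSet A :=
    hA.growthHalfPlane_subset hβ (Fr.mem_growthHalfPlane hA (by simp))
  set Q₁ : W →L[ℂ] V := (Fr.lift h1 : X →ₗ[ℂ] V).extendOfNorm (Fr.k : X →ₗ[ℂ] W) with hQ₁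
  have hQ₁k : ∀ x, Q₁ (Fr.k x) = Fr.lift h1 x := fun x =>
    LinearMap.extendOfNorm_eq Fr.denseRange_k ⟨Fr.κ⁻¹, fun x => Fr.norm_lift_le h1 (by simp) x⟩ x
  set Q : W →L[ℂ] V := Q₁ + (1 - α) • (Fr.lift hα).comp (Fr.j.comp Q₁) with hQ
  have hQk : ∀ x, Q (Fr.k x) = Fr.lift hα x := fun x => by
    refine Fr.j_injective ?_
    simp only [hQ, add_apply, smul_apply,
      ContinuousLinearMap.comp_apply, map_add, map_smul, hQ₁k, Fr.j_lift]
    exact (resolvent_apply_eq hα h1 x).symm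
  refine ⟨Q, hQk, fun w => ?_, fun h0 => ?_⟩
  · refine Fr.denseRange_k.induction_on (p := fun w => Fr.j (Q w) =
      Fr.J w + (β - α) • resolvent A α (Fr.J w)) w
      (isClosed_eq (by fun_prop) (by fun_prop)) fun x => ?_
    rw [hQk, Fr.j_lift, Fr.J_k, ← resolvent_apply_eq hα hβ]
  · refine ContinuousLinearMap.opNorm_le_bound _ (inv_nonneg.2 Fr.κ_pos.le) fun w => ?_
    refine Fr.denseRange_k.induction_on (p := fun w => ‖Q w‖ ≤ Fr.κ⁻¹ * ‖w‖) w
      (isClosed_le (by fun_prop) (by fun_prop)) fun x => ?_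
    rw [hQk]
    exact Fr.norm_lift_le hα h0 x

omit [CompleteSpace V] in
/-- For an inhomogeneity `f` with derivative `g`, `f(0) = 0`, the mild solution `z` belongs to
`(β - A)⁻¹ f + D(A)`, pointwise in time: the derivative `z'` is the mild solution belonging to `g`. -/
lemma IsMild.sub_J_eq (hA : T.IsGenerator A) (hβ : β ∈ resolventSet A) {g : ℝ → W}
    (h : Fr.IsMild T t 0 f z v) (h' : Fr.IsMild T t 0 g z' v')
    (hfg : ∀ s ∈ Icc 0 t, Fr.J (f s) = ∫ r in (0 : ℝ)..s, Fr.J (g r)) {s : ℝ} (hs : s ∈ Icc 0 t) :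
    z s - Fr.J (f s) = resolvent A β (β • z s - z' s) := by
  have hT := Fr.norm_op_le_one hA
  have hg := Fr.intervalIntegrable_J h'.memLp_input hs
  have h1 := h.state s hs
  have h2 := h'.state s hs
  simp only [map_zero, zero_add] at h1 h2
  have h3 : T.conv (fun r => Fr.J (f r)) s = ∫ r in (0 : ℝ)..s, T.conv (fun r => Fr.J (g r)) r := by
    rw [← C0Semigroup.conv_integral hT hs.1 hg]
    refine C0Semigroup.conv_congr_ae hs.1 ?_
    filter_upwards [ae_restrict_mem measurableSet_Ioo] with r hr
    exact hfg r ⟨hr.1.le, hr.2.le.trans hs.2⟩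
  have h4 := hA.resolvent_conv hβ hT hs.1 hg
  rw [← h2, ← h3, ← h1, ← hfg s hs] at h4
  refine resolvent_injective hβ ?_
  rw [map_sub, map_sub, map_sub, h4, map_smul, map_smul]
  abel

end GelfandFrame

/-! ### Uniqueness of bounded extensions from primitives -/

/-- Two bounded operators on `L²(0, t; U)` coincide if they agree on all functions
`u(s) = ∫₀ˢ v(r) dr` with `v ∈ L²_loc`. -/
lemma clm_eq_of_eq_on_primitives {U H : Type*} [NormedAddCommGroup U] [InnerProductSpace ℂ U]
    [CompleteSpace U] [NormedAddCommGroup H] [NormedSpace ℂ H] {t : ℝ}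
    {F F' : Lp U 2 (vol t) →L[ℂ] H}
    (h : ∀ u v : ℝ → U, (∀ τ, MemLp v 2 (vol τ)) → (∀ s ≥ 0, u s = ∫ r in (0 : ℝ)..s, v r) →
      ∀ hu : MemLp u 2 (vol t), F hu.toLp = F' hu.toLp) : F = F' := by
  set K : Submodule ℂ (Lp U 2 (vol t)) := LinearMap.ker (F - F').toLinearMap with hK
  have hclosed : IsClosed (K : Set (Lp U 2 (vol t))) := (F - F').isClosed_ker
  have : CompleteSpace K := hclosed.completeSpace_coe
  have hbot : Kᗮ = ⊥ := by
    rw [Submodule.eq_bot_iff]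
    intro f hf
    have hfi : Integrable f (vol t) := (Lp.memLp f).integrable (by norm_num)
    have h1 : ∀ᵐ s ∂vol t, s ∈ Ioo 0 t → f s = 0 := by
      refine isOpen_Ioo.ae_eq_zero_of_integral_contDiff_smul_eq_zero
        (hfi.locallyIntegrable.locallyIntegrableOn _) fun g hg hgs hgt => ?_
      obtain ⟨Cg, hCg⟩ := hgs.exists_bound_of_continuous hg.continuous
      have hgf : Integrable (fun s => g s • f s) (vol t) :=
        (hfi.norm.const_mul Cg).mono'
          (hg.continuous.aestronglyMeasurable.smul hfi.aestronglyMeasurable)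
          (Eventually.of_forall fun s => by
            rw [norm_smul]
            exact mul_le_mul_of_nonneg_right (hCg s) (norm_nonneg _))
      refine ext_inner_left ℂ fun e => ?_
      rw [inner_zero_right, ← integral_inner hgf]
      have hu : MemLp (fun s => g s • e) 2 (vol t) :=
        (hg.continuous.smul continuous_const).memLp_vol t
      have hmem : hu.toLp ∈ K := by
        rw [hK, LinearMap.mem_ker]
        have hg' : Continuous (deriv g) := hg.continuous_deriv (by simp)
        have hprim := h (fun s => g s • e) (fun s => deriv g s • e)
          (fun τ => (hg'.smul continuous_const).memLp_vol τ) (fun s _ => by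
            rw [intervalIntegral.integral_smul_const, intervalIntegral.integral_deriv_eq_sub
              (fun x _ => (hg.differentiable (by simp)).differentiableAt)
              (hg'.intervalIntegrable _ _)]
            have h0 : g 0 = 0 := by
              by_contra hne
              exact lt_irrefl _ (hgt (subset_tsupport _ hne)).1
            rw [h0, sub_zero]) hu
        simp [hprim]
      have h2 := (Submodule.mem_orthogonal _ _).1 hf _ hmem
      rw [L2.inner_def] at h2
      rw [← h2]
      refine integral_congr_ae ?_
      filter_upwards [hu.coeFn_toLp] with s hs
      rw [hs, ← Complex.coe_smul, ← Complex.coe_smul, inner_smul_left, inner_smul_right,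
        Complex.conj_ofReal]
    refine Lp.ext ?_
    filter_upwards [h1, ae_restrict_mem measurableSet_Ioo, Lp.coeFn_zero U 2 (vol t)] with s h2 h3 h4
    rw [h2 h3, h4]; rfl
  have htop : K = ⊤ := (Submodule.orthogonal_eq_bot_iff).1 hbot
  ext1 u
  have hu : u ∈ K := htop ▸ Submodule.mem_top
  rw [hK, LinearMap.mem_ker] at hu
  exact sub_eq_zero.1 hu

namespace System

variable {X U₁ U₂ Y : Type*}
  [NormedAddCommGroup X] [InnerProductSpace ℂ X] [CompleteSpace X]
  [NormedAddCommGroup U₁] [InnerProductSpace ℂ U₁] [CompleteSpace U₁]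
  [NormedAddCommGroup U₂] [InnerProductSpace ℂ U₂] [CompleteSpace U₂]
  [NormedAddCommGroup Y] [InnerProductSpace ℂ Y] [CompleteSpace Y]
  {U : Type*} [NormedAddCommGroup U] [InnerProductSpace ℂ U]
  (S : System X U₁ U₂ Y)

/-! ### The extrapolation space as an isometric copy of the state space -/

lemma Rm1_toExtrap (α : ℂ) (x : X) : S.Rm1 α (S.toExtrap x) = resolvent S.A α x :=
  extrapResolvent_of S.β_mem α x

lemma denseRange_toExtrap : DenseRange S.toExtrap :=
  Extrap.denseRange_ofPre S.A S.β

lemma norm_Rm1 (ξ : Extrap S.A S.β) : ‖S.Rm1 S.β ξ‖ = ‖ξ‖ := by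
  refine S.denseRange_toExtrap.induction_on (p := fun ξ => ‖S.Rm1 S.β ξ‖ = ‖ξ‖) ξ
    (isClosed_eq (by fun_prop) (by fun_prop)) fun x => ?_
  rw [Rm1_toExtrap]
  exact (Extrap.norm_ofPre S.A S.β (PreExtrap.equiv S.A S.β x)).symm

/-- `(β - A₋₁)⁻¹ : X₋₁ → X` as a linear isometry. -/
noncomputable def isom : Extrap S.A S.β →ₗᵢ[ℂ] X :=
  ⟨(S.Rm1 S.β : Extrap S.A S.β →ₗ[ℂ] X), S.norm_Rm1⟩

lemma isom_toExtrap (x : X) : S.isom (S.toExtrap x) = resolvent S.A S.β x :=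
  S.Rm1_toExtrap _ x

lemma isom_Tm1 (t : ℝ≥0) (ξ : Extrap S.A S.β) : S.isom (S.Tm1 t ξ) = S.T.op t (S.isom ξ) := by
  refine S.denseRange_toExtrap.induction_on
    (p := fun ξ => S.isom (S.Tm1 t ξ) = S.T.op t (S.isom ξ)) ξ
    (isClosed_eq (S.isom.continuous.comp (S.Tm1 t).continuous)
      ((S.T.op t).continuous.comp S.isom.continuous)) fun x => ?_
  have : S.Tm1 t (S.toExtrap x) = S.toExtrap (S.T.op t x) :=
    extrapSemigroup_of S.isGenerator S.β_mem t x
  rw [this, isom_toExtrap, isom_toExtrap, S.isGenerator.resolvent_op S.β_mem]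

lemma isom_Phi (B : U →L[ℂ] Extrap S.A S.β) (t : ℝ) (u : ℝ → U) :
    S.isom (S.Phi B t u) = S.T.conv (fun s => S.isom (B (u s))) t := by
  simp only [Phi, C0Semigroup.conv, intervalIntegral, map_sub, ← LinearIsometry.integral_comp_comm,
    isom_Tm1]

lemma toExtrap_injective : Function.Injective S.toExtrap := fun x y h => by
  refine resolvent_injective S.β_mem ?_
  rw [← isom_toExtrap, h, isom_toExtrap]

/-- The resolvent identity on `X₋₁`. -/
lemma Rm1_eq {α : ℂ} (hα : α ∈ resolventSet S.A) (ξ : Extrap S.A S.β) :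
    S.Rm1 α ξ = S.isom ξ + (S.β - α) • resolvent S.A α (S.isom ξ) := by
  have hc : Continuous fun ξ => S.isom ξ := S.isom.continuous
  refine S.denseRange_toExtrap.induction_on
    (p := fun ξ => S.Rm1 α ξ = S.isom ξ + (S.β - α) • resolvent S.A α (S.isom ξ)) ξ
    (isClosed_eq (by fun_prop) (by fun_prop)) fun x => ?_
  rw [Rm1_toExtrap, isom_toExtrap, ← resolvent_apply_eq hα S.β_mem]

variable {S}

lemma ObservedAs.unique {x : X} {y y' : Y} (h : S.ObservedAs x y) (h' : S.ObservedAs x y') :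
    y = y' := by
  obtain ⟨w, hw, rfl⟩ := h
  obtain ⟨w', hw', rfl⟩ := h'
  have : w = w' := Subtype.ext (hw.trans hw'.symm)
  rw [this]

variable (S)

/-- A factorisation of the control and observation operators of a system over a Gelfand triple
`V ⊆ X ⊆ W`: the control operators take values in `W` and the observation operator is bounded
on `V`. -/
structure Factorization (V W : Type*) [NormedAddCommGroup V] [NormedSpace ℂ V]
    [NormedAddCommGroup W] [NormedSpace ℂ W] extends GelfandFrame S.A S.β V W where
  /-- the control operator `B₁`, with values in `W` -/
  b₁ : U₁ →L[ℂ] W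
  isom_B₁ : ∀ u, S.isom (S.B₁ u) = J (b₁ u)
  /-- the control operator `B₂`, with values in `W` -/
  b₂ : U₂ →L[ℂ] W
  isom_B₂ : ∀ u, S.isom (S.B₂ u) = J (b₂ u)
  /-- the observation operator, extended to `V` -/
  c : V →L[ℂ] Y
  c_ι : ∀ d : S.A.domain, S.C d = c (ι d)

variable {S} {V W : Type*} [NormedAddCommGroup V] [NormedSpace ℂ V] [CompleteSpace V]
  [NormedAddCommGroup W] [NormedSpace ℂ W]

namespace Factorization

variable (Fr : S.Factorization V W)

omit [CompleteSpace V] in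
lemma incl_c (v : V) : S.incl (Fr.c v) = S.CX (Fr.j v) := by
  refine Fr.denseRange_ι.induction_on (p := fun v => S.incl (Fr.c v) = S.CX (Fr.j v)) v
    (isClosed_eq (by fun_prop) (by fun_prop)) fun d => ?_
  rw [← Fr.c_ι, Fr.j_ι]
  exact (S.CX_eq d).symm

omit [CompleteSpace V] in
lemma observedAs {d : S.A.domain} {v : V} (h : Fr.j v = d) : S.ObservedAs d (Fr.c v) := by
  refine ⟨d, rfl, (Fr.c_ι d).trans ?_⟩
  rw [Fr.j_injective ((Fr.j_ι d).trans h.symm)]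

variable {B : U →L[ℂ] Extrap S.A S.β} {b : U →L[ℂ] W} (hb : ∀ u, S.isom (B u) = Fr.J (b u))

section

include hb

omit [CompleteSpace V]

/-- For the inhomogeneity `B u`, mild solutions are given by the input map. -/
lemma toExtrap_eq_of_isMild {t : ℝ} {z₀ : X} {u : ℝ → U} {z : ℝ → X} {v : ℝ → V}
    (h : Fr.IsMild S.T t z₀ (fun s => b (u s)) z v) {s : ℝ} (hs : s ∈ Icc 0 t) :
    S.toExtrap (z s) = S.toExtrap (S.T.op s.toNNReal z₀) + S.Phi B s u := by
  refine S.isom.injective ?_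
  rw [map_add, isom_toExtrap, isom_toExtrap, isom_Phi, h.state s hs,
    S.isGenerator.resolvent_op S.β_mem]
  simp only [hb]

end

section

include hb

/-! ### Well-posedness of the linear system -/

/-- Admissibility of `B`: the state of the mild solution with inhomogeneity `b u` at time `t` is a
bounded function of `u`, by the energy estimate. -/
lemma isAdmissibleControl : S.IsAdmissibleControl B := by
  intro t ht
  have hT := Fr.norm_op_le_one S.isGenerator
  have hmem : ∀ u : Lp U 2 volInf, MemLp (fun s => b (u s)) 2 (vol t) := fun u =>
    b.comp_memLp' (memLp_vol_of_volInf (Lp.memLp u) t)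
  have hint : ∀ u : Lp U 2 volInf, IntervalIntegrable (fun s => Fr.J (b (u s))) volume 0 t :=
    fun u => Fr.intervalIntegrable_J (hmem u) ⟨ht.le, le_rfl⟩
  have hvol : ∀ {p : ℝ → Prop}, (∀ᵐ s ∂volInf, p s) → ∀ᵐ s ∂vol t, p s := fun h =>
    ae_mono (Measure.restrict_mono Ioo_subset_Ioi_self le_rfl) h
  let G : Submodule ℂ (Lp U 2 volInf × X) :=
    { carrier := {q | resolvent S.A S.β q.2 = S.T.conv (fun s => Fr.J (b (q.1 s))) t}
      add_mem' := by
        rintro p q hp hq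
        simp only [mem_ofPred_eq] at hp hq ⊢
        rw [Prod.snd_add, map_add, hp, hq, ← C0Semigroup.conv_add hT (hint p.1) (hint q.1)]
        refine C0Semigroup.conv_congr_ae ht.le (hvol ?_)
        filter_upwards [Lp.coeFn_add p.1 q.1] with s hs
        rw [Prod.fst_add, hs, Pi.add_apply, map_add, map_add]
      zero_mem' := by
        have : S.T.conv (fun s => Fr.J (b ((0 : Lp U 2 volInf) s))) t = S.T.conv (fun _ => 0) t := by
          refine C0Semigroup.conv_congr_ae ht.le (hvol ?_)
          filter_upwards [Lp.coeFn_zero U 2 volInf] with s hs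
          rw [hs, Pi.zero_apply, map_zero, map_zero]
        simp only [mem_ofPred_eq, Prod.fst_zero, Prod.snd_zero]
        rw [this]
        simp [C0Semigroup.conv]
      smul_mem' := by
        rintro c q hq
        simp only [mem_ofPred_eq] at hq ⊢
        rw [Prod.smul_snd, map_smul, hq, ← C0Semigroup.conv_smul]
        refine C0Semigroup.conv_congr_ae ht.le (hvol ?_)
        filter_upwards [Lp.coeFn_smul c q.1] with s hs
        rw [Prod.smul_fst, hs, Pi.smul_apply, map_smul, map_smul] }
  have hex : ∀ u : Lp U 2 volInf, ∃ x, (u, x) ∈ G ∧ ‖x‖ ≤ √Fr.κ⁻¹ * ‖b‖ * ‖u‖ := fun u => by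
    obtain ⟨z, v, -, h, he⟩ := Fr.exists_isMild S.isGenerator S.β_mem ht.le 0 (hmem u)
    refine ⟨z t, ?_, ?_⟩
    · have := h.state t ⟨ht.le, le_rfl⟩
      rwa [map_zero, map_zero, zero_add] at this
    · have h1 := (he.norm_le ⟨ht.le, le_rfl⟩).1
      rw [norm_zero, zero_add] at h1
      refine h1.trans ?_
      rw [mul_assoc]
      gcongr
      have hu : MemW 0 (Ioi 0) u := memW_zero_iff.2 (Lp.memLp u)
      refine (normL2w_le_mul (norm_nonneg b) (memW_of_memLp (memLp_vol_of_volInf (Lp.memLp u) t))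
        (Eventually.of_forall fun s => b.le_opNorm _)).trans ?_
      gcongr
      refine (normL2w_mono_set Ioo_subset_Ioi_self hu).trans_eq ?_
      rw [normL2w_zero_eq, Lp.norm_def]
  obtain ⟨Φ, hΦ⟩ := exists_clm_of_relation G (√Fr.κ⁻¹ * ‖b‖)
    (fun u => (hex u).imp fun _ h => h.1) (fun u x hx => by
      obtain ⟨x', hx', hn⟩ := hex u
      have hxx : x = x' := resolvent_injective S.β_mem (Eq.trans hx hx'.symm)
      rwa [hxx])
  refine ⟨Φ, fun u => S.isom.injective ?_⟩
  rw [isom_toExtrap, isom_Phi]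
  simp only [hb]
  exact hΦ u

/-- The output transfer functions are the functions `α ↦ c (α - A)⁻¹ b` with `(α - A)⁻¹` regarded as
a map from `W` to `V`. -/
lemma isOutputTransferFunction_iff {G : ℂ → U →L[ℂ] Y} : S.IsOutputTransferFunction B G ↔
    ∀ α ∈ S.T.growthHalfPlane, ∀ u, ∃ w, Fr.j w = S.Rm1 α (B u) ∧ G α u = Fr.c w := by
  have hsub := S.isGenerator.growthHalfPlane_subset S.β_mem
  constructor
  · intro h α hα u
    obtain ⟨Q, -, hQ, -⟩ := Fr.exists_extendedResolvent S.isGenerator S.β_mem (hsub hα)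
    have hw : Fr.j (Q (b u)) = S.Rm1 α (B u) := by rw [hQ, Rm1_eq S (hsub hα), hb]
    refine ⟨_, hw, S.incl_injective ?_⟩
    rw [h.2 α hα u, Fr.incl_c, hw]
  · intro h
    refine ⟨fun α hα γ hγ u => ?_, fun α hα u => ?_⟩
    · obtain ⟨w, hw, hGw⟩ := h α hα u
      obtain ⟨w', hw', hGw'⟩ := h γ hγ u
      set ξ := S.isom (B u)
      have hd : S.Rm1 α (B u) - S.Rm1 γ (B u) =
          (((S.β - α) • resolventDom (hsub hα) ξ - (S.β - γ) • resolventDom (hsub hγ) ξ :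
            S.A.domain) : X) := by
        rw [Rm1_eq S (hsub hα), Rm1_eq S (hsub hγ)]
        simp [ξ]
      have h1 := Fr.observedAs (v := w - w') (by rw [← hd, map_sub, hw, hw'])
      rwa [← hd, map_sub, ← hGw, ← hGw'] at h1
    · obtain ⟨w, hw, hGw⟩ := h α hα u
      rw [hGw, Fr.incl_c, hw]

/-- The transfer function is bounded on the right half-plane, because the resolvents are uniformly
bounded from `W` to `V` there. -/
lemma exists_outputTransferFunction : ∃ G : ℂ → U →L[ℂ] Y, S.IsOutputTransferFunction B G ∧
    ∃ γ M : ℝ, ∀ α : ℂ, γ < α.re → α ∈ S.T.growthHalfPlane ∧ ‖G α‖ ≤ M := by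
  have hsub := S.isGenerator.growthHalfPlane_subset S.β_mem
  have hex : ∀ α, ∃ g : U →L[ℂ] Y, α ∈ S.T.growthHalfPlane →
      (∀ u, ∃ w, Fr.j w = S.Rm1 α (B u) ∧ g u = Fr.c w) ∧
      (0 ≤ α.re → ‖g‖ ≤ ‖Fr.c‖ * (Fr.κ⁻¹ * ‖b‖)) := fun α => by
    by_cases hα : α ∈ S.T.growthHalfPlane
    · obtain ⟨Q, -, hQ, hQn⟩ := Fr.exists_extendedResolvent S.isGenerator S.β_mem (hsub hα)
      refine ⟨Fr.c.comp (Q.comp b), fun _ => ⟨fun u => ⟨Q (b u), ?_, rfl⟩, fun h0 => ?_⟩⟩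
      · rw [hQ, Rm1_eq S (hsub hα), hb]
      · refine (ContinuousLinearMap.opNorm_comp_le _ _).trans ?_
        gcongr
        refine (ContinuousLinearMap.opNorm_comp_le _ _).trans ?_
        gcongr
        exact hQn h0
    · exact ⟨0, fun h => absurd h hα⟩
  choose G hG using hex
  refine ⟨G, (Fr.isOutputTransferFunction_iff hb).2 fun α hα => (hG α hα).1, 0,
    ‖Fr.c‖ * (Fr.κ⁻¹ * ‖b‖), fun α hα => ?_⟩
  have hm := Fr.mem_growthHalfPlane S.isGenerator hα
  exact ⟨hm, (hG α hm).2 hα.le⟩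

end

/-! ### Output and input-output maps -/

/-- The output map is `c` composed with the `V`-valued mild solution of `z' = A z`. -/
lemma exists_outputMap {t : ℝ} (ht : 0 < t) : ∃ Ψ : X →L[ℂ] Lp Y 2 (vol t), S.IsOutputMap t Ψ ∧
    ∀ x, ∃ z v, Fr.IsMild S.T t x (fun _ => 0) z v ∧ ∀ᵐ s ∂vol t, Ψ x s = Fr.c (v s) := by
  obtain ⟨L, hL⟩ := Fr.exists_solutionOperator S.isGenerator S.β_mem ht.le
  set Ψ : X →L[ℂ] Lp Y 2 (vol t) :=
    (Fr.c.compLpL 2 (vol t)).comp (L.comp (ContinuousLinearMap.inl ℂ X (Lp W 2 (vol t)))) with hΨ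
  have key : ∀ x, ∃ z v, Fr.IsMild S.T t x (fun _ => 0) z v ∧
      ∀ᵐ s ∂vol t, Ψ x s = Fr.c (v s) := fun x => by
    obtain ⟨z, hz⟩ := hL (x, 0)
    exact ⟨z, _, hz.congr (Lp.coeFn_zero W 2 (vol t)) (fun _ _ => rfl)
      (Eventually.of_forall fun _ => rfl), Fr.c.coeFn_compLpL (L (x, 0))⟩
  refine ⟨Ψ, fun x => ?_, key⟩
  obtain ⟨z, v, hm, hv⟩ := key x
  filter_upwards [hv, hm.ae_eq, ae_restrict_mem measurableSet_Ioo] with s h1 h2 h3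
  have h4 := hm.state s (Ioo_subset_Icc_self h3)
  have h5 : S.T.conv (fun _ => Fr.J 0) s = 0 := by simp [C0Semigroup.conv]
  rw [h5, add_zero, ← S.isGenerator.resolvent_op S.β_mem] at h4
  have h6 := resolvent_injective S.β_mem h4
  have hg := LinearPMap.mem_domain_of_mem_graph
    (S.isGenerator.graph_op s.toNNReal (S.A.mem_graph x))
  rw [h1]
  exact Fr.observedAs (d := ⟨_, hg⟩) (h2.trans h6)

/-- Since `D(A)` is dense, every output map is the one given by the mild solutions. -/
lemma isMild_of_isOutputMap {t : ℝ} (ht : 0 < t) {Ψ : X →L[ℂ] Lp Y 2 (vol t)}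
    (h : S.IsOutputMap t Ψ) (x : X) :
    ∃ z v, Fr.IsMild S.T t x (fun _ => 0) z v ∧ ∀ᵐ s ∂vol t, Ψ x s = Fr.c (v s) := by
  obtain ⟨Ψ', h', hm⟩ := Fr.exists_outputMap ht
  suffices Ψ = Ψ' by rw [this]; exact hm x
  refine ContinuousLinearMap.coeFn_injective
    (Continuous.ext_on Fr.dense_domain Ψ.continuous Ψ'.continuous fun x hx => Lp.ext ?_)
  filter_upwards [h ⟨x, hx⟩, h' ⟨x, hx⟩] with s h1 h2
  exact h1.unique h2

section

include hb

/-- An operator given by the `V`-valued mild solutions is the input-output map. -/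
lemma isInputOutputMap_of_isMild [CompleteSpace U] {t : ℝ} (ht : 0 < t) {G : ℂ → U →L[ℂ] Y}
    (hG : ∀ α ∈ S.T.growthHalfPlane, ∀ u, ∃ w, Fr.j w = S.Rm1 α (B u) ∧ G α u = Fr.c w)
    {F : Lp U 2 (vol t) →L[ℂ] Lp Y 2 (vol t)}
    (hF : ∀ u, ∀ hu : MemLp u 2 (vol t), ∃ z v, Fr.IsMild S.T t 0 (fun s => b (u s)) z v ∧
      ∀ᵐ s ∂vol t, F hu.toLp s = Fr.c (v s)) :
    S.IsInputOutputMap B G t F := by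
  intro u u' hu' huu' hu α hα
  have hsub := S.isGenerator.growthHalfPlane_subset S.β_mem hα
  obtain ⟨z, v, hm, hv⟩ := hF u hu
  obtain ⟨z', v', -, hm', -⟩ := Fr.exists_isMild S.isGenerator S.β_mem ht.le 0
    (b.comp_memLp' (hu' t))
  have hJ : ∀ s ∈ Icc 0 t, Fr.J (b (u s)) = ∫ r in (0 : ℝ)..s, Fr.J (b (u' r)) := fun s hs => by
    have hi := intervalIntegrable_of_memLp_vol hs.1 (hu' s)
    rw [huu' s hs.1]
    exact ((Fr.J.comp b).intervalIntegral_comp_comm hi).symm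
  filter_upwards [hv, hm.ae_eq, ae_restrict_mem measurableSet_Ioo] with s h1 h2 h3
  have hs := Ioo_subset_Icc_self h3
  obtain ⟨w, hw, hGw⟩ := hG α hα (u s)
  have h4 := hm.sub_J_eq S.isGenerator S.β_mem hm' hJ hs
  have hd : z s - S.Rm1 α (B (u s)) = ((resolventDom S.β_mem (S.β • z s - z' s) -
      (S.β - α) • resolventDom hsub (S.isom (B (u s))) : S.A.domain) : X) := by
    rw [Rm1_eq S hsub, ← sub_sub, hb, h4]
    rfl
  refine ⟨z s - S.Rm1 α (B (u s)), ?_, ?_⟩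
  · rw [map_sub, Fr.toExtrap_eq_of_isMild hb hm hs, map_zero, map_zero, zero_add]
  · rw [h1, hGw, ← map_sub, hd]
    refine Fr.observedAs ?_
    rw [map_sub, h2, hw, hd]

/-- The input-output map is `c` composed with the `V`-valued mild solution of `z' = A z + b u`,
`z(0) = 0`. -/
lemma exists_inputOutputMap [CompleteSpace U] {t : ℝ} (ht : 0 < t) :
    ∃ F : Lp U 2 (vol t) →L[ℂ] Lp Y 2 (vol t),
      (∀ G, S.IsOutputTransferFunction B G → S.IsInputOutputMap B G t F) ∧
      ∀ u, ∀ hu : MemLp u 2 (vol t), ∃ z v, Fr.IsMild S.T t 0 (fun s => b (u s)) z v ∧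
        ∀ᵐ s ∂vol t, F hu.toLp s = Fr.c (v s) := by
  obtain ⟨L, hL⟩ := Fr.exists_solutionOperator S.isGenerator S.β_mem ht.le
  set F : Lp U 2 (vol t) →L[ℂ] Lp Y 2 (vol t) :=
    (Fr.c.compLpL 2 (vol t)).comp ((L.comp (ContinuousLinearMap.inr ℂ X (Lp W 2 (vol t)))).comp
      (b.compLpL 2 (vol t))) with hF
  have key : ∀ u, ∀ hu : MemLp u 2 (vol t), ∃ z v, Fr.IsMild S.T t 0 (fun s => b (u s)) z v ∧
      ∀ᵐ s ∂vol t, F hu.toLp s = Fr.c (v s) := fun u hu => by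
    obtain ⟨z, hz⟩ := hL (0, b.compLpL 2 (vol t) hu.toLp)
    refine ⟨z, _, hz.congr ?_ (fun _ _ => rfl)
      (Eventually.of_forall fun _ => rfl), Fr.c.coeFn_compLpL _⟩
    filter_upwards [b.coeFn_compLpL (p := 2) (𝕜' := ℂ) hu.toLp, hu.coeFn_toLp] with s h1 h2
    rw [h1, h2]
  exact ⟨F, fun G hG => Fr.isInputOutputMap_of_isMild hb ht
    ((Fr.isOutputTransferFunction_iff hb).1 hG) key, key⟩

/-- Since primitives of `L²`-functions are dense in `L²(0, t; U)`, every input-output map is the one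
given by the mild solutions. -/
lemma isMild_of_isInputOutputMap [CompleteSpace U] {t : ℝ} (ht : 0 < t) {G : ℂ → U →L[ℂ] Y}
    (hG : S.IsOutputTransferFunction B G) {F : Lp U 2 (vol t) →L[ℂ] Lp Y 2 (vol t)}
    (hF : S.IsInputOutputMap B G t F) (u : ℝ → U) (hu : MemLp u 2 (vol t)) :
    ∃ z v, Fr.IsMild S.T t 0 (fun s => b (u s)) z v ∧
      ∀ᵐ s ∂vol t, F hu.toLp s = Fr.c (v s) := by
  obtain ⟨F', hF', hm⟩ := Fr.exists_inputOutputMap hb ht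
  suffices F = F' by rw [this]; exact hm u hu
  refine clm_eq_of_eq_on_primitives fun u v hv huv hu => Lp.ext ?_
  have h1 : (1 : ℂ) ∈ S.T.growthHalfPlane := Fr.mem_growthHalfPlane S.isGenerator (by simp)
  filter_upwards [hF u v hv huv hu 1 h1, hF' G hG u v hv huv hu 1 h1] with s hs hs'
  obtain ⟨x, hx, hxo⟩ := hs
  obtain ⟨x', hx', hxo'⟩ := hs'
  have hxx : x = x' := S.toExtrap_injective (hx.trans hx'.symm)
  rw [← hxx] at hxo'
  exact sub_left_injective (hxo.unique hxo')

end

include Fr in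
lemma wellPosed : S.WellPosed := by
  obtain ⟨G₁, hG₁, hb₁⟩ := Fr.exists_outputTransferFunction Fr.isom_B₁
  obtain ⟨G₂, hG₂, hb₂⟩ := Fr.exists_outputTransferFunction Fr.isom_B₂
  exact ⟨Fr.isAdmissibleControl Fr.isom_B₁, Fr.isAdmissibleControl Fr.isom_B₂,
    fun t ht => (Fr.exists_outputMap ht).imp fun _ h => h.1,
    ⟨G₁, hG₁.1, hb₁⟩, ⟨G₂, hG₂.1, hb₂⟩⟩

end Factorization

end System

section Auxiliary

/-- The contraction principle on a closed ball about the origin. -/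
lemma exists_fixedPoint_of_contraction {E : Type*} [NormedAddCommGroup E] [CompleteSpace E]
    (Γ : E → E) {r : ℝ} (hr : 0 ≤ r) (hmaps : ∀ f, ‖f‖ ≤ r → ‖Γ f‖ ≤ r)
    (hlip : ∀ f g, ‖f‖ ≤ r → ‖g‖ ≤ r → ‖Γ f - Γ g‖ ≤ 1 / 2 * ‖f - g‖) :
    ∃ f, ‖f‖ ≤ r ∧ Γ f = f := by
  set s : Set E := Metric.closedBall 0 r with hs
  have hmem : ∀ f, f ∈ s ↔ ‖f‖ ≤ r := fun f => mem_closedBall_zero_iff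
  have hmapsTo : MapsTo Γ s s := fun f hf => (hmem _).2 (hmaps f ((hmem f).1 hf))
  have hcontr : ContractingWith (1 / 2 : ℝ≥0) (hmapsTo.restrict Γ s s) := by
    refine ⟨by norm_num, LipschitzWith.of_dist_le_mul fun f g => ?_⟩
    rw [Subtype.dist_eq, Subtype.dist_eq, dist_eq_norm, dist_eq_norm]
    simpa using hlip f g ((hmem _).1 f.2) ((hmem _).1 g.2)
  obtain ⟨f, hf, hfix, -⟩ := hcontr.exists_fixedPoint' Metric.isClosed_closedBall.isComplete
    hmapsTo ((hmem 0).2 (by simpa using hr)) (edist_ne_top _ _)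
  exact ⟨f, (hmem f).1 hf, hfix⟩

/-- Young's inequality with a small constant. -/
lemma exists_rpow_mul_rpow_le {p : ℝ} (hp : p ∈ Ioo (0 : ℝ) 1) {η : ℝ} (hη : 0 < η) :
    ∃ C : ℝ, 0 ≤ C ∧ ∀ a b : ℝ, 0 ≤ a → 0 ≤ b → a ^ (1 - p) * b ^ p ≤ η * b + C * a := by
  have h1p : 0 < 1 - p := by linarith [hp.2]
  set θ : ℝ := η ^ (1 / (1 - p)) with hθ
  have hθ0 : 0 < θ := by positivity
  have hθ1 : θ ^ (1 - p) = η := by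
    rw [hθ, ← Real.rpow_mul hη.le, one_div_mul_cancel h1p.ne', Real.rpow_one]
  refine ⟨(1 / θ) ^ p, by positivity, fun a b ha hb => ?_⟩
  -- compare `a` with `θ b`
  rcases le_total a (θ * b) with h | h
  · calc a ^ (1 - p) * b ^ p ≤ (θ * b) ^ (1 - p) * b ^ p := by gcongr
      _ = η * b := by
        rw [Real.mul_rpow hθ0.le hb, hθ1, mul_assoc, ← Real.rpow_add_of_nonneg hb h1p.le hp.1.le,
          sub_add_cancel, Real.rpow_one]
      _ ≤ η * b + (1 / θ) ^ p * a := le_add_of_nonneg_right (by positivity)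
  · have hb' : b ≤ 1 / θ * a := by
      rw [one_div_mul_eq_div, le_div_iff₀' hθ0]; exact h
    calc a ^ (1 - p) * b ^ p ≤ a ^ (1 - p) * (1 / θ * a) ^ p :=
          mul_le_mul_of_nonneg_left (Real.rpow_le_rpow hb hb' hp.1.le) (by positivity)
      _ = (1 / θ) ^ p * a := by
        rw [Real.mul_rpow (by positivity) ha, mul_left_comm,
          ← Real.rpow_add_of_nonneg ha h1p.le hp.1.le, sub_add_cancel, Real.rpow_one]
      _ ≤ η * b + (1 / θ) ^ p * a := le_add_of_nonneg_left (by positivity)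

variable {U U' U'' : Type*} [NormedAddCommGroup U] [NormedSpace ℂ U]
  [NormedAddCommGroup U'] [NormedSpace ℂ U'] [NormedAddCommGroup U''] [NormedSpace ℂ U'']
  {ν t : ℝ}

lemma normL2w_le_of_norm_le_add {h : ℝ → U} {f : ℝ → U'} {g : ℝ → U''} {a b : ℝ} (ha : 0 ≤ a)
    (hb : 0 ≤ b) (hf : MemLp f 2 (vol t)) (hg : MemLp g 2 (vol t))
    (hle : ∀ᵐ s ∂vol t, ‖h s‖ ≤ a * ‖f s‖ + b * ‖g s‖) :
    normL2w ν (Ioo 0 t) h ≤ a * normL2w ν (Ioo 0 t) f + b * normL2w ν (Ioo 0 t) g := by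
  have hF : MemLp (fun s => ((a * ‖f s‖ : ℝ) : ℂ)) 2 (vol t) := (hf.norm.const_mul a).ofReal
  have hG : MemLp (fun s => ((b * ‖g s‖ : ℝ) : ℂ)) 2 (vol t) := (hg.norm.const_mul b).ofReal
  have h1 := normL2w_le_mul (f := h) zero_le_one (memW_of_memLp (ν := ν) (hF.add hG)) (by
    filter_upwards [hle] with s hs
    rw [Pi.add_apply, ← Complex.ofReal_add, Complex.norm_real, one_mul]
    exact hs.trans (Real.le_norm_self _))
  rw [one_mul] at h1
  refine h1.trans ((normL2w_add_le (memW_of_memLp hF) (memW_of_memLp hG)).trans ?_)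
  gcongr
  · refine normL2w_le_mul ha (memW_of_memLp hf) (Eventually.of_forall fun s => ?_)
    simp [abs_of_nonneg ha]
  · refine normL2w_le_mul hb (memW_of_memLp hg) (Eventually.of_forall fun s => ?_)
    simp [abs_of_nonneg hb]

lemma normL2w_eq_zero_weight (I : Set ℝ) (f : ℝ → U) :
    normL2w ν I f = normL2w 0 I (fun s => Real.exp (ν * s) • f s) := by
  simp [normL2w]

/-- A bounded bilinear map sends `L^∞ × L²` to `L²`. -/
lemma memLp_bilin {E F : Type*} [NormedAddCommGroup E] [NormedSpace ℂ E] [NormedAddCommGroup F]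
    [NormedSpace ℂ F] (N : E →L[ℂ] F →L[ℂ] U) (c : U' →L[ℂ] F) {z : ℝ → E} {v : ℝ → U'} {a : ℝ}
    (ha : 0 ≤ a) (hz : AEStronglyMeasurable z (vol t)) (hza : ∀ᵐ s ∂vol t, ‖z s‖ ≤ a)
    (hv : MemLp v 2 (vol t)) :
    MemLp (fun s => N (z s) (c (v s))) 2 (vol t) ∧
      normL2w ν (Ioo 0 t) (fun s => N (z s) (c (v s))) ≤
        ‖N‖ * a * ‖c‖ * normL2w ν (Ioo 0 t) v := by
  have hle : ∀ᵐ s ∂vol t, ‖N (z s) (c (v s))‖ ≤ ‖N‖ * a * ‖c‖ * ‖v s‖ := by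
    filter_upwards [hza] with s hs
    calc _ ≤ ‖N‖ * ‖z s‖ * ‖c (v s)‖ := N.le_opNorm₂ _ _
      _ ≤ ‖N‖ * a * (‖c‖ * ‖v s‖) := by gcongr; exact c.le_opNorm _
      _ = _ := by ring
  refine ⟨hv.of_le_mul ?_ hle, normL2w_le_mul (by positivity) (memW_of_memLp hv) hle⟩
  exact N.aestronglyMeasurable_comp₂ hz (c.continuous.comp_aestronglyMeasurable
    hv.aestronglyMeasurable)

end Auxiliary

namespace System.Factorization

variable {X U₁ U₂ Y : Type*}
  [NormedAddCommGroup X] [InnerProductSpace ℂ X] [CompleteSpace X]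
  [NormedAddCommGroup U₁] [InnerProductSpace ℂ U₁] [CompleteSpace U₁]
  [NormedAddCommGroup U₂] [InnerProductSpace ℂ U₂] [CompleteSpace U₂]
  [NormedAddCommGroup Y] [InnerProductSpace ℂ Y] [CompleteSpace Y]
  {S : System X U₁ U₂ Y}
  {V W : Type*} [NormedAddCommGroup V] [NormedSpace ℂ V] [CompleteSpace V]
  [NormedAddCommGroup W] [NormedSpace ℂ W] (Fr : S.Factorization V W)

/-! ### Solutions of the bilinear feedback system as mild solutions -/

/-- `z`, regarded as the `V`-valued function `v`, is a mild solution on `[0, t]` of the bilinear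
feedback system. -/
def IsFeedbackMild (t : ℝ) (z₀ : X) (u₁ : ℝ → U₁) (z : ℝ → X) (v : ℝ → V) : Prop :=
  Fr.IsMild S.T t z₀ (fun s => Fr.b₁ (u₁ s) + Fr.b₂ (S.N (z s) (Fr.c (v s)))) z v

/-- Every solution in the sense of input, output and input-output maps is a mild solution with
values in `V`, and its output is `c` applied to it. -/
lemma exists_isFeedbackMild {z₀ : X} {u₁ : ℝ → U₁} {z : ℝ → X} {y : ℝ → Y}
    (h : S.IsSolution z₀ u₁ z y) {t : ℝ} (ht : 0 < t) :
    ∃ v, Fr.IsFeedbackMild t z₀ u₁ z v ∧ ∀ᵐ s ∂vol t, y s = Fr.c (v s) := by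
  obtain ⟨G₁, G₂, hG₁, hG₂, hout⟩ := h.output
  obtain ⟨Ψ, F₁, F₂, hΨ, hF₁, hF₂, h₁, h₂, hy⟩ := hout t ht
  obtain ⟨zΨ, vΨ, mΨ, eΨ⟩ := Fr.isMild_of_isOutputMap ht hΨ z₀
  obtain ⟨z₁, v₁, m₁, e₁⟩ := Fr.isMild_of_isInputOutputMap Fr.isom_B₁ ht hG₁ hF₁ u₁ h₁
  obtain ⟨z₂, v₂, m₂, e₂⟩ := Fr.isMild_of_isInputOutputMap Fr.isom_B₂ ht hG₂ hF₂ _ h₂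
  have hz : ∀ s ∈ Icc 0 t, zΨ s + z₁ s + z₂ s = z s := fun s hs => by
    refine S.toExtrap_injective ?_
    have hΨ' : S.toExtrap (zΨ s) = S.toExtrap (S.T.op s.toNNReal z₀) := by
      refine congrArg _ (resolvent_injective S.β_mem ?_)
      rw [mΨ.state s hs, S.isGenerator.resolvent_op S.β_mem]
      simp [C0Semigroup.conv]
    rw [map_add, map_add, hΨ', Fr.toExtrap_eq_of_isMild Fr.isom_B₁ m₁ hs,
      Fr.toExtrap_eq_of_isMild Fr.isom_B₂ m₂ hs, h.state s hs.1]
    simp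
  have hyv : ∀ᵐ s ∂vol t, y s = Fr.c (vΨ s + v₁ s + v₂ s) := by
    filter_upwards [hy, eΨ, e₁, e₂, Lp.coeFn_add (Ψ z₀ + F₁ h₁.toLp) (F₂ h₂.toLp),
      Lp.coeFn_add (Ψ z₀) (F₁ h₁.toLp)] with s a0 a1 a2 a3 a4 a5
    rw [a0, a4, Pi.add_apply, a5, Pi.add_apply, a1, a2, a3, map_add, map_add]
  have hm := (mΨ.add S.isGenerator m₁).add S.isGenerator m₂
  simp only [add_zero, zero_add] at hm
  refine ⟨_, hm.congr ?_ hz (Eventually.of_forall fun _ => rfl), hyv⟩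
  filter_upwards [hyv] with s hs
  rw [hs]

/-- Conversely, a mild solution of the feedback system defined for all times is a solution with
output `c v`. -/
lemma isSolution_of_isFeedbackMild {z₀ : X} {u₁ : ℝ → U₁} {z : ℝ → X} {v : ℝ → V}
    (hz : ContinuousOn z (Ici 0)) (hu : ∀ t, MemLp u₁ 2 (vol t))
    (hN : ∀ t, MemLp (fun s => S.N (z s) (Fr.c (v s))) 2 (vol t))
    (h : ∀ t ≥ 0, Fr.IsFeedbackMild t z₀ u₁ z v) :
    S.IsSolution z₀ u₁ z (fun s => Fr.c (v s)) where
  continuousOn := hz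
  memLp t := Fr.c.comp_memLp' (memLp_vol_mono (le_max_left t 0) (h _ (le_max_right t 0)).memLp)
  state t ht := by
    have hT := Fr.norm_op_le_one S.isGenerator
    have h1 := (h t ht).state t ⟨ht, le_rfl⟩
    refine S.isom.injective ?_
    rw [map_add, map_add, isom_toExtrap, isom_toExtrap, isom_Phi, isom_Phi, h1,
      S.isGenerator.resolvent_op S.β_mem, add_assoc]
    simp only [Fr.isom_B₁, Fr.isom_B₂, map_add]
    exact congrArg _ (C0Semigroup.conv_add hT
      (Fr.intervalIntegrable_J (Fr.b₁.comp_memLp' (hu t)) ⟨ht, le_rfl⟩)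
      (Fr.intervalIntegrable_J (Fr.b₂.comp_memLp' (hN t)) ⟨ht, le_rfl⟩))
  output := by
    obtain ⟨G₁, hG₁, -⟩ := Fr.exists_outputTransferFunction Fr.isom_B₁
    obtain ⟨G₂, hG₂, -⟩ := Fr.exists_outputTransferFunction Fr.isom_B₂
    refine ⟨G₁, G₂, hG₁, hG₂, fun t ht => ?_⟩
    obtain ⟨Ψ, hΨ, mΨ⟩ := Fr.exists_outputMap ht
    obtain ⟨F₁, hF₁, m₁⟩ := Fr.exists_inputOutputMap Fr.isom_B₁ ht
    obtain ⟨F₂, hF₂, m₂⟩ := Fr.exists_inputOutputMap Fr.isom_B₂ ht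
    refine ⟨Ψ, F₁, F₂, hΨ, hF₁ G₁ hG₁, hF₂ G₂ hG₂, hu t, hN t, ?_⟩
    obtain ⟨zΨ, vΨ, mΨ, eΨ⟩ := mΨ z₀
    obtain ⟨z₁, v₁, m₁, e₁⟩ := m₁ u₁ (hu t)
    obtain ⟨z₂, v₂, m₂, e₂⟩ := m₂ _ (hN t)
    have hm := (mΨ.add S.isGenerator m₁).add S.isGenerator m₂
    simp only [add_zero, zero_add] at hm
    have hv := ((h t ht.le).unique S.β_mem hm (Eventually.of_forall fun _ => rfl)).2
    filter_upwards [hv, eΨ, e₁, e₂, Lp.coeFn_add (Ψ z₀ + F₁ (hu t).toLp) (F₂ (hN t).toLp),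
      Lp.coeFn_add (Ψ z₀) (F₁ (hu t).toLp)] with s a0 a1 a2 a3 a4 a5
    rw [a0, a4, Pi.add_apply, a5, Pi.add_apply, a1, a2, a3, map_add, map_add]

end System.Factorization

namespace System.Factorization

variable {X U₁ U₂ Y : Type*}
  [NormedAddCommGroup X] [InnerProductSpace ℂ X] [CompleteSpace X]
  [NormedAddCommGroup U₁] [InnerProductSpace ℂ U₁] [CompleteSpace U₁]
  [NormedAddCommGroup U₂] [InnerProductSpace ℂ U₂] [CompleteSpace U₂]
  [NormedAddCommGroup Y] [InnerProductSpace ℂ Y] [CompleteSpace Y]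
  {S : System X U₁ U₂ Y}
  {V W : Type*} [NormedAddCommGroup V] [NormedSpace ℂ V] [CompleteSpace V]
  [NormedAddCommGroup W] [NormedSpace ℂ W] (Fr : S.Factorization V W)

/-! ### Existence of small solutions -/

section Existence

omit [CompleteSpace V] in
/-- The feedback law maps `L^∞(0, ∞; X) × L²(0, ∞; V)` to `L²(0, ∞; U₂)`. -/
lemma memLp_volInf_feedback {z : ℝ → X} {v : ℝ → V} {a b : ℝ} (hz : ContinuousOn z (Ici 0))
    (hza : ∀ t ≥ 0, ‖z t‖ ≤ a) (hv : ∀ t ≥ 0, MemLp v 2 (vol t))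
    (hvb : ∀ t ≥ 0, normL2w 0 (Ioo 0 t) v ≤ b) :
    MemLp (fun s => S.N (z s) (Fr.c (v s))) 2 volInf ∧
      normL2w 0 (Ioi 0) (fun s => S.N (z s) (Fr.c (v s))) ≤ ‖S.N‖ * a * ‖Fr.c‖ * b := by
  have ha : 0 ≤ a := (norm_nonneg _).trans (hza 0 le_rfl)
  have h := fun (t : ℝ) (ht : t > 0) => memLp_bilin (ν := 0) S.N Fr.c ha
    ((hz.mono (Ioo_subset_Ioi_self.trans Ioi_subset_Ici_self)).aestronglyMeasurable
      measurableSet_Ioo)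
    ((ae_restrict_mem measurableSet_Ioo).mono fun s hs => hza s hs.1.le) (hv t ht.le)
  refine memLp_volInf_of_bound (fun t ht => (h t ht).1) fun t ht => (h t ht).2.trans ?_
  gcongr
  exact hvb t ht.le

/-- For small data the bilinear feedback system has a small global solution. It is found as a fixed
point of the map that sends an input `f ∈ L²(0, ∞; U₂)` to `N(z, y)`, where `z` and `y` are the
state and the output of the linear system with the inputs `u₁` and `f`. -/
theorem exists_small_solution :
    ∃ K > 0, ∃ ε₀ > 0, ∀ ε > 0, ε ≤ ε₀ → ∀ (z₀ : X) (u₁ : ℝ → U₁), MemLp u₁ 2 volInf →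
      ‖z₀‖ + normL2w 0 (Ioi 0) u₁ ≤ ε →
      ∃ (z : ℝ → X) (v : ℝ → V), ContinuousOn z (Ici 0) ∧
        (∀ t ≥ 0, Fr.IsFeedbackMild t z₀ u₁ z v) ∧
        (∀ t, MemLp (fun s => S.N (z s) (Fr.c (v s))) 2 (vol t)) ∧
        (∀ t ≥ 0, ‖z t‖ ≤ K * ε) ∧ ∀ t ≥ 0, normL2w 0 (Ioo 0 t) v ≤ K * ε := by
  have hκ := Fr.κ_pos
  set σ : ℝ := √Fr.κ⁻¹ with hσ
  have hσ0 : 0 < σ := by positivity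
  have hσκ : σ * √Fr.κ = 1 := by
    rw [hσ, Real.sqrt_inv, inv_mul_cancel₀ (by positivity)]
  set K₁ : ℝ := 1 + σ * (‖Fr.b₁‖ + ‖Fr.b₂‖) with hK₁
  set P : ℝ := ‖S.N‖ * ‖Fr.c‖ * σ with hP
  have hK0 : 0 < K₁ := by positivity
  have hP0 : 0 ≤ P := by positivity
  refine ⟨K₁ * (1 + σ), by positivity, 1 / (8 * P * K₁ ^ 2 + 1), by positivity,
    fun ε hε hεle z₀ u₁ hu hsmall => ?_⟩
  have hsm : 8 * P * K₁ ^ 2 * ε ≤ 1 := by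
    rw [le_div_iff₀ (by positivity)] at hεle
    nlinarith
  -- the linear problem with the inputs `u₁` and `f`
  have hlin : ∀ f : Lp U₂ 2 (volInf), ∃ (z : ℝ → X) (v : ℝ → V), ContinuousOn z (Ici 0) ∧
      ∀ t ≥ 0, Fr.IsMild S.T t z₀ (fun s => Fr.b₁ (u₁ s) + Fr.b₂ (f s)) z v := fun f =>
    Fr.exists_isMild_global S.isGenerator S.β_mem z₀ fun t =>
      (Fr.b₁.comp_memLp' (memLp_vol_of_volInf hu t)).add
        (Fr.b₂.comp_memLp' (memLp_vol_of_volInf (Lp.memLp f) t))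
  choose z v hz hm using hlin
  have hbound : ∀ {f : Lp U₂ 2 (volInf)} {t : ℝ}, 0 ≤ t → normL2w 0 (Ioo 0 t) f ≤ ‖f‖ := by
    intro f t _
    rw [Lp.norm_def, ← normL2w_zero_eq]
    exact normL2w_mono_set Ioo_subset_Ioi_self (memW_zero_iff.2 (Lp.memLp f))
  -- the energy estimate bounds the state and the `V`-norm
  have henergy : ∀ {f : Lp U₂ 2 (volInf)}, ‖f‖ ≤ ε → ∀ t ≥ 0,
      ‖z f t‖ ≤ K₁ * ε ∧ normL2w 0 (Ioo 0 t) (v f) ≤ σ * (K₁ * ε) := by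
    intro f hf t ht
    have h1 := ((hm f t ht).hasEnergyBound S.isGenerator S.β_mem ht).norm_le ⟨ht, le_rfl⟩
    have h2 := normL2w_le_of_norm_le_add (ν := 0) (t := t)
      (h := fun s => Fr.b₁ (u₁ s) + Fr.b₂ (f s)) (norm_nonneg Fr.b₁) (norm_nonneg Fr.b₂)
      (memLp_vol_of_volInf hu t) (memLp_vol_of_volInf (Lp.memLp f) t)
      (Eventually.of_forall fun s => (norm_add_le _ _).trans
        (add_le_add (Fr.b₁.le_opNorm _) (Fr.b₂.le_opNorm _)))
    have h3 : normL2w 0 (Ioo 0 t) u₁ ≤ ε :=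
      (normL2w_mono_set Ioo_subset_Ioi_self (memW_zero_iff.2 hu)).trans
        (by linarith [norm_nonneg z₀])
    have h4 : normL2w 0 (Ioo 0 t) f ≤ ε := (hbound ht).trans hf
    have h5 : ‖z₀‖ + σ * normL2w 0 (Ioo 0 t) (fun s => Fr.b₁ (u₁ s) + Fr.b₂ (f s)) ≤ K₁ * ε := by
      have h6 : ‖z₀‖ ≤ ε := by linarith [normL2w_nonneg 0 (Ioi 0) u₁]
      calc _ ≤ ε + σ * (‖Fr.b₁‖ * ε + ‖Fr.b₂‖ * ε) := by
            gcongr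
            exact h2.trans (by gcongr)
        _ = K₁ * ε := by rw [hK₁]; ring
    refine ⟨h1.1.trans h5, ?_⟩
    calc _ = σ * (√Fr.κ * normL2w 0 (Ioo 0 t) (v f)) := by rw [← mul_assoc, hσκ, one_mul]
      _ ≤ _ := mul_le_mul_of_nonneg_left (h1.2.trans h5) hσ0.le
  have hdiff : ∀ f g : Lp U₂ 2 (volInf), ∀ t ≥ 0,
      ‖z f t - z g t‖ ≤ K₁ * ‖f - g‖ ∧
      normL2w 0 (Ioo 0 t) (fun s => v f s - v g s) ≤ σ * (K₁ * ‖f - g‖) := by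
    intro f g t ht
    have hd := (hm f t ht).sub S.isGenerator (hm g t ht)
    have h1 := (hd.hasEnergyBound S.isGenerator S.β_mem ht).norm_le ⟨ht, le_rfl⟩
    have h2 : normL2w 0 (Ioo 0 t) (fun s => Fr.b₁ (u₁ s) + Fr.b₂ (f s) -
        (Fr.b₁ (u₁ s) + Fr.b₂ (g s))) ≤ ‖Fr.b₂‖ * ‖f - g‖ := by
      refine (normL2w_le_mul (g := ⇑(f - g)) (norm_nonneg Fr.b₂)
        (memW_of_memLp (memLp_vol_of_volInf (Lp.memLp (f - g)) t)) ?_).trans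
        (by gcongr; exact hbound ht)
      filter_upwards [ae_mono (Measure.restrict_mono Ioo_subset_Ioi_self le_rfl)
        (Lp.coeFn_sub f g)] with s hs
      rw [hs, Pi.sub_apply, add_sub_add_left_eq_sub, ← map_sub]
      exact Fr.b₂.le_opNorm _
    have h5 : ‖z₀ - z₀‖ + σ * normL2w 0 (Ioo 0 t) (fun s => Fr.b₁ (u₁ s) + Fr.b₂ (f s) -
        (Fr.b₁ (u₁ s) + Fr.b₂ (g s))) ≤ K₁ * ‖f - g‖ := by
      rw [sub_self, norm_zero, zero_add]
      calc _ ≤ σ * (‖Fr.b₂‖ * ‖f - g‖) := by gcongr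
        _ = σ * ‖Fr.b₂‖ * ‖f - g‖ := by ring
        _ ≤ K₁ * ‖f - g‖ := by
          gcongr
          have : 0 ≤ σ * ‖Fr.b₁‖ := by positivity
          rw [hK₁]; linarith
    refine ⟨h1.1.trans h5, ?_⟩
    calc _ = σ * (√Fr.κ * normL2w 0 (Ioo 0 t) (fun s => v f s - v g s)) := by
          rw [← mul_assoc, hσκ, one_mul]
      _ ≤ _ := mul_le_mul_of_nonneg_left (h1.2.trans h5) hσ0.le
  have hN : ∀ {f : Lp U₂ 2 (volInf)}, ‖f‖ ≤ ε →
      MemLp (fun s => S.N (z f s) (Fr.c (v f s))) 2 volInf ∧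
      normL2w 0 (Ioi 0) (fun s => S.N (z f s) (Fr.c (v f s))) ≤ ε := by
    intro f hf
    obtain ⟨h1, h2⟩ := Fr.memLp_volInf_feedback (hz f) (fun t ht => (henergy hf t ht).1)
      (fun t ht => (hm f t ht).memLp) (fun t ht => (henergy hf t ht).2)
    refine ⟨h1, h2.trans ?_⟩
    calc _ = (P * K₁ ^ 2 * ε) * ε := by rw [hP]; ring
      _ ≤ 1 * ε := by gcongr; nlinarith [hsm]
      _ = ε := one_mul ε
  classical
  let Γ : Lp U₂ 2 (volInf) → Lp U₂ 2 (volInf) := fun f =>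
    if hf : ‖f‖ ≤ ε then (hN hf).1.toLp else 0
  have hΓ : ∀ {f} (hf : ‖f‖ ≤ ε), Γ f = (hN hf).1.toLp := fun hf => dif_pos hf
  obtain ⟨f, hf, hfix⟩ := exists_fixedPoint_of_contraction Γ hε.le (fun f hf => by
      rw [hΓ hf, Lp.norm_toLp, ← normL2w_zero_eq]
      exact (hN hf).2) (fun f g hf hg => by
      rw [hΓ hf, hΓ hg, ← MemLp.toLp_sub, Lp.norm_toLp, ← normL2w_zero_eq]
      obtain ⟨m1, n1⟩ := Fr.memLp_volInf_feedback ((hz f).sub (hz g))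
        (fun t ht => (hdiff f g t ht).1) (fun t ht => (hm f t ht).memLp)
        (fun t ht => (henergy hf t ht).2)
      obtain ⟨m2, n2⟩ := Fr.memLp_volInf_feedback (hz g)
        (fun t ht => (henergy hg t ht).1)
        (fun t ht => (hm f t ht).memLp.sub (hm g t ht).memLp)
        (fun t ht => (hdiff f g t ht).2)
      have e : ((fun s => S.N (z f s) (Fr.c (v f s))) - fun s => S.N (z g s) (Fr.c (v g s))) =
          fun s => S.N (z f s - z g s) (Fr.c (v f s)) +
            S.N (z g s) (Fr.c (v f s - v g s)) := by
        ext s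
        simp
      rw [e]
      refine (normL2w_add_le (memW_zero_iff.2 m1) (memW_zero_iff.2 m2)).trans
        ((add_le_add n1 n2).trans ?_)
      calc _ = (2 * P * K₁ ^ 2 * ε) * ‖f - g‖ := by rw [hP]; ring
        _ ≤ 1 / 2 * ‖f - g‖ := by gcongr; linarith)
  have hfN : ∀ᵐ s ∂volInf, f s = S.N (z f s) (Fr.c (v f s)) := by
    have h1 := (hN hf).1.coeFn_toLp
    rw [← hΓ hf, hfix] at h1
    exact h1
  refine ⟨z f, v f, hz f, fun t ht => (hm f t ht).congr ?_ (fun _ _ => rfl)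
    (Eventually.of_forall fun _ => rfl), fun t => memLp_vol_of_volInf (hN hf).1 t,
    fun t ht => (henergy hf t ht).1.trans ?_, fun t ht => (henergy hf t ht).2.trans ?_⟩
  · filter_upwards [ae_mono (Measure.restrict_mono Ioo_subset_Ioi_self le_rfl) hfN] with s hs
    rw [hs]
  · have : 0 ≤ σ * (K₁ * ε) := by positivity
    linarith
  · have : 0 ≤ K₁ * ε := by positivity
    linarith

end Existence

/-! ### Decay of small solutions -/

section Decay

variable {Fr} {t : ℝ} {z₀ : X} {u₁ : ℝ → U₁} {z : ℝ → X} {v : ℝ → V}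

/-- As long as the state is small, the energy dissipated by the linear part dominates the feedback
term, and the state decays exponentially. -/
lemma IsFeedbackMild.norm_le_exp (h : Fr.IsFeedbackMild t z₀ u₁ z v) (ht : 0 ≤ t)
    (hu : MemLp u₁ 2 (vol t)) {δ ν : ℝ} (hδ : ∀ s ∈ Icc 0 t, ‖z s‖ ≤ δ)
    (hδκ : 2 * (‖Fr.b₂‖ * (‖S.N‖ * δ * ‖Fr.c‖)) ≤ Fr.κ) (hν : 0 ≤ ν)
    (hνκ : 4 * ν * ‖Fr.j‖ ^ 2 ≤ Fr.κ) :
    ‖z t‖ ≤ ‖z₀‖ * Real.exp (-ν * t) +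
      √(2 * Fr.κ⁻¹) * ‖Fr.b₁‖ * Real.exp (-ν * t) * normL2w ν (Ioo 0 t) u₁ := by
  have hκ := Fr.κ_pos
  have hδ0 : 0 ≤ δ := (norm_nonneg _).trans (hδ 0 ⟨le_rfl, ht⟩)
  have hE := h.hasEnergyBound S.isGenerator S.β_mem ht ν t ⟨ht, le_rfl⟩
  have hv := h.memLp
  set q : ℝ := ‖Fr.b₂‖ * (‖S.N‖ * δ * ‖Fr.c‖) with hq
  have hq0 : 0 ≤ q := by positivity
  set x := normL2w ν (Ioo 0 t) v with hx
  set w := ‖Fr.b₁‖ * normL2w ν (Ioo 0 t) u₁ with hw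
  have hx0 : 0 ≤ x := normL2w_nonneg _ _ _
  have hw0 : 0 ≤ w := mul_nonneg (norm_nonneg _) (normL2w_nonneg _ _ _)
  have h1 : normL2w ν (Ioo 0 t) z ≤ ‖Fr.j‖ * x := by
    refine normL2w_le_mul (norm_nonneg _) (memW_of_memLp hv) ?_
    filter_upwards [h.ae_eq] with s hs
    rw [← hs]
    exact Fr.j.le_opNorm _
  have h2 : normL2w ν (Ioo 0 t) (fun s => Fr.b₁ (u₁ s) + Fr.b₂ (S.N (z s) (Fr.c (v s)))) ≤
      w + q * x := by
    refine normL2w_le_of_norm_le_add (norm_nonneg _) hq0 hu hv ?_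
    filter_upwards [ae_restrict_mem measurableSet_Ioo] with s hs
    refine (norm_add_le _ _).trans (add_le_add (Fr.b₁.le_opNorm _) ?_)
    calc _ ≤ ‖Fr.b₂‖ * (‖S.N‖ * ‖z s‖ * ‖Fr.c (v s)‖) :=
          (Fr.b₂.le_opNorm _).trans (by gcongr; exact S.N.le_opNorm₂ _ _)
      _ ≤ ‖Fr.b₂‖ * (‖S.N‖ * δ * (‖Fr.c‖ * ‖v s‖)) := by
          gcongr
          · exact hδ s (Ioo_subset_Icc_self hs)
          · exact Fr.c.le_opNorm _
      _ = q * ‖v s‖ := by rw [hq]; ring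
  have h3 : 2 * ν * normL2w ν (Ioo 0 t) z ^ 2 ≤ Fr.κ / 2 * x ^ 2 := by
    calc _ ≤ 2 * ν * (‖Fr.j‖ * x) ^ 2 := by
          gcongr
          exact normL2w_nonneg _ _ _
      _ = (4 * ν * ‖Fr.j‖ ^ 2) / 2 * x ^ 2 := by ring
      _ ≤ _ := by gcongr
  have h4 : Fr.κ⁻¹ * normL2w ν (Ioo 0 t)
      (fun s => Fr.b₁ (u₁ s) + Fr.b₂ (S.N (z s) (Fr.c (v s)))) ^ 2 ≤
        2 * Fr.κ⁻¹ * w ^ 2 + Fr.κ / 2 * x ^ 2 := by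
    have h5 : q ^ 2 ≤ (Fr.κ / 2) ^ 2 := by
      gcongr
      linarith
    calc _ ≤ Fr.κ⁻¹ * (w + q * x) ^ 2 := by
          gcongr
          exact normL2w_nonneg _ _ _
      _ ≤ Fr.κ⁻¹ * (2 * w ^ 2 + 2 * (q ^ 2 * x ^ 2)) := by
          gcongr ?_ * ?_
          nlinarith [sq_nonneg (w - q * x)]
      _ ≤ Fr.κ⁻¹ * (2 * w ^ 2 + 2 * ((Fr.κ / 2) ^ 2 * x ^ 2)) := by gcongr
      _ = _ := by field_simp
  have h5 : (Real.exp (ν * t) * ‖z t‖) ^ 2 ≤ (‖z₀‖ + √(2 * Fr.κ⁻¹) * w) ^ 2 := by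
    have e1 : (Real.exp (ν * t) * ‖z t‖) ^ 2 = Real.exp (2 * ν * t) * ‖z t‖ ^ 2 := by
      rw [mul_pow, ← Real.exp_nat_mul]
      congr 2
      push_cast
      ring
    have e2 : (√(2 * Fr.κ⁻¹) * w) ^ 2 = 2 * Fr.κ⁻¹ * w ^ 2 := by
      rw [mul_pow, Real.sq_sqrt (by positivity)]
    have e3 : 0 ≤ ‖z₀‖ * (√(2 * Fr.κ⁻¹) * w) := by positivity
    rw [e1]
    nlinarith
  have h6 := abs_le_of_sq_le_sq' h5 (by positivity) |>.2
  have h7 : ‖z t‖ = Real.exp (-ν * t) * (Real.exp (ν * t) * ‖z t‖) := by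
    rw [← mul_assoc, ← Real.exp_add]
    simp
  calc ‖z t‖ ≤ Real.exp (-ν * t) * (‖z₀‖ + √(2 * Fr.κ⁻¹) * w) := by
        rw [h7]
        gcongr
    _ = _ := by rw [hw]; ring

end Decay

/-! ### Uniqueness -/

section Uniqueness

omit [CompleteSpace V] in
/-- Interpolating the feedback law between `X` and `Y` with Young's inequality. -/
lemma exists_norm_feedback_le {M η : ℝ} (hM : 0 ≤ M) (hη : 0 < η) :
    ∃ C : ℝ, 0 ≤ C ∧ ∀ (z : X) (v : V), ‖z‖ ≤ M →
      ‖S.N z (Fr.c v)‖ ≤ η * ‖v‖ + C * ‖Fr.j v‖ := by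
  obtain ⟨K, hK, p, hp, hN⟩ := S.N_bound
  obtain ⟨C, hC, hy⟩ := exists_rpow_mul_rpow_le hp
    (show 0 < η / (K * M * ‖Fr.c‖ + 1) by positivity)
  refine ⟨K * M * C * ‖S.CX‖, by positivity, fun z v hz => (hN _ _).trans ?_⟩
  rw [Fr.incl_c]
  have h1 : K * M * (η / (K * M * ‖Fr.c‖ + 1)) * ‖Fr.c‖ ≤ η := by
    have : K * M * (η / (K * M * ‖Fr.c‖ + 1)) * ‖Fr.c‖ =
        (K * M * ‖Fr.c‖) / (K * M * ‖Fr.c‖ + 1) * η := by ring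
    rw [this]
    refine mul_le_of_le_one_left hη.le ((div_le_one (by positivity)).2 (by linarith))
  calc _ = K * ‖z‖ * (‖S.CX (Fr.j v)‖ ^ (1 - p) * ‖Fr.c v‖ ^ p) := by ring
    _ ≤ K * M * (η / (K * M * ‖Fr.c‖ + 1) * (‖Fr.c‖ * ‖v‖) + C * (‖S.CX‖ * ‖Fr.j v‖)) := by
      gcongr
      refine (hy _ _ (norm_nonneg _) (norm_nonneg _)).trans ?_
      gcongr
      · exact Fr.c.le_opNorm _
      · exact S.CX.le_opNorm _
    _ = K * M * (η / (K * M * ‖Fr.c‖ + 1)) * ‖Fr.c‖ * ‖v‖ + K * M * C * ‖S.CX‖ * ‖Fr.j v‖ := by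
      ring
    _ ≤ _ := by gcongr

/-- The energy inequality for the difference of two solutions, after the feedback term has been
split, forces the difference to vanish. -/
lemma eq_zero_of_energy_le {κ D x₂ x₃ y a b c l : ℝ} (hκ : 0 < κ)
    (hE : D ^ 2 + κ * x₂ ^ 2 ≤ -(2 * l) * x₃ ^ 2 + κ⁻¹ * y ^ 2) (hy : 0 ≤ y)
    (hyle : y ≤ a * D + b * x₂ + c * x₃) (ha : 12 * a ^ 2 ≤ κ) (hb : 0 ≤ b) (hbκ : 2 * b ≤ κ)
    (hl : 2 * l = 3 * κ⁻¹ * c ^ 2) : D = 0 := by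
  have h1 : y ^ 2 ≤ 3 * (a * D) ^ 2 + 3 * (b * x₂) ^ 2 + 3 * (c * x₃) ^ 2 := by
    refine (pow_le_pow_left₀ hy hyle 2).trans ?_
    nlinarith [sq_nonneg (a * D - b * x₂), sq_nonneg (a * D - c * x₃),
      sq_nonneg (b * x₂ - c * x₃)]
  have h2 := mul_le_mul_of_nonneg_left h1 (inv_nonneg.2 hκ.le)
  have hA₁ : κ⁻¹ * (3 * (a * D) ^ 2) ≤ D ^ 2 / 4 := by
    calc _ = κ⁻¹ * (12 * a ^ 2) * (D ^ 2 / 4) := by ring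
      _ ≤ κ⁻¹ * κ * (D ^ 2 / 4) := by gcongr
      _ = _ := by rw [inv_mul_cancel₀ hκ.ne', one_mul]
  have hA₂ : κ⁻¹ * (3 * (b * x₂) ^ 2) ≤ κ * x₂ ^ 2 := by
    have h3 : b ^ 2 ≤ (κ / 2) ^ 2 := by gcongr; linarith
    calc _ = κ⁻¹ * (3 * (b ^ 2 * x₂ ^ 2)) := by ring
      _ ≤ κ⁻¹ * (3 * ((κ / 2) ^ 2 * x₂ ^ 2)) := by gcongr
      _ = 3 / 4 * (κ * x₂ ^ 2) := by field_simp; ring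
      _ ≤ _ := by
        have : 0 ≤ κ * x₂ ^ 2 := by positivity
        linarith
  have hA₃ : κ⁻¹ * (3 * (c * x₃) ^ 2) = 2 * l * x₃ ^ 2 := by rw [hl]; ring
  nlinarith

variable {Fr} {t : ℝ} {z₀ : X} {u₁ : ℝ → U₁} {z z' : ℝ → X} {v v' : ℝ → V}

omit [CompleteSpace V] in
/-- The weighted `L²`-norm of the difference of two feedback terms. -/
lemma normL2w_feedback_sub_le {l D θ M η C a : ℝ} (hD : 0 ≤ D) (hη : 0 ≤ η) (hC : 0 ≤ C)
    (ha : 0 ≤ a)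
    (hv : MemLp v 2 (vol t)) (hv' : MemLp v' 2 (vol t)) (hz' : AEStronglyMeasurable z' (vol t))
    (hd : MemLp (fun s => z s - z' s) 2 (vol t)) (hj : ∀ᵐ s ∂vol t, Fr.j (v s - v' s) = z s - z' s)
    (hθ : normL2w 0 (Ioo 0 t) v ≤ θ) (hM0 : 0 ≤ M) (hM : ∀ s ∈ Ioo 0 t, ‖z' s‖ ≤ M)
    (hda : ∀ s ∈ Ioo 0 t, ‖z s - z' s‖ ≤ a)
    (hdD : ∀ s ∈ Ioo 0 t, Real.exp (-l * s) * ‖z s - z' s‖ ≤ D)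
    (hNC : ∀ (z : X) (v : V), ‖z‖ ≤ M → ‖S.N z (Fr.c v)‖ ≤ η * ‖v‖ + C * ‖Fr.j v‖) :
    normL2w (-l) (Ioo 0 t) (fun s => Fr.b₁ (u₁ s) + Fr.b₂ (S.N (z s) (Fr.c (v s))) -
      (Fr.b₁ (u₁ s) + Fr.b₂ (S.N (z' s) (Fr.c (v' s))))) ≤
      ‖Fr.b₂‖ * (‖S.N‖ * ‖Fr.c‖ * θ) * D +
        ‖Fr.b₂‖ * η * normL2w (-l) (Ioo 0 t) (fun s => v s - v' s) +
        ‖Fr.b₂‖ * C * normL2w (-l) (Ioo 0 t) (fun s => z s - z' s) := by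
  have hmem := ae_restrict_mem (μ := volume) (measurableSet_Ioo (a := (0 : ℝ)) (b := t))
  have hvd : MemLp (fun s => v s - v' s) 2 (vol t) := hv.sub hv'
  have hm₁ : MemLp (fun s => S.N (z s - z' s) (Fr.c (v s))) 2 (vol t) :=
    (memLp_bilin (ν := 0) S.N Fr.c ha hd.aestronglyMeasurable (hmem.mono hda) hv).1
  have hm₂ : MemLp (fun s => S.N (z' s) (Fr.c (v s - v' s))) 2 (vol t) :=
    (memLp_bilin (ν := 0) S.N Fr.c hM0 hz' (hmem.mono hM) hvd).1
  have hb₁ : MemLp (fun s => Fr.b₂ (S.N (z s - z' s) (Fr.c (v s)))) 2 (vol t) :=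
    Fr.b₂.comp_memLp' hm₁
  have hb₂ : MemLp (fun s => Fr.b₂ (S.N (z' s) (Fr.c (v s - v' s)))) 2 (vol t) :=
    Fr.b₂.comp_memLp' hm₂
  have h1 : normL2w (-l) (Ioo 0 t) (fun s => Fr.b₂ (S.N (z s - z' s) (Fr.c (v s)))) ≤
      ‖Fr.b₂‖ * (‖S.N‖ * ‖Fr.c‖ * θ) * D := by
    rw [normL2w_eq_zero_weight]
    calc _ ≤ ‖Fr.b₂‖ * (‖S.N‖ * ‖Fr.c‖ * D) * normL2w 0 (Ioo 0 t) v := by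
          refine normL2w_le_mul (by positivity) (memW_of_memLp hv) ?_
          filter_upwards [hmem] with s hs
          rw [norm_smul, Real.norm_eq_abs, Real.abs_exp]
          calc _ ≤ Real.exp (-l * s) *
                (‖Fr.b₂‖ * (‖S.N‖ * ‖z s - z' s‖ * (‖Fr.c‖ * ‖v s‖))) := by
                refine mul_le_mul_of_nonneg_left ?_ (Real.exp_pos _).le
                refine (Fr.b₂.le_opNorm _).trans ?_
                gcongr
                refine (S.N.le_opNorm₂ _ _).trans ?_
                gcongr
                exact Fr.c.le_opNorm _
            _ = ‖Fr.b₂‖ * (‖S.N‖ * ‖Fr.c‖ * (Real.exp (-l * s) * ‖z s - z' s‖)) * ‖v s‖ := by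
                ring
            _ ≤ _ := by
                gcongr
                exact hdD s hs
      _ ≤ ‖Fr.b₂‖ * (‖S.N‖ * ‖Fr.c‖ * D) * θ := by gcongr
      _ = _ := by ring
  have h2 : normL2w (-l) (Ioo 0 t) (fun s => Fr.b₂ (S.N (z' s) (Fr.c (v s - v' s)))) ≤
      ‖Fr.b₂‖ * η * normL2w (-l) (Ioo 0 t) (fun s => v s - v' s) +
        ‖Fr.b₂‖ * C * normL2w (-l) (Ioo 0 t) (fun s => z s - z' s) := by
    refine normL2w_le_of_norm_le_add (by positivity) (by positivity) hvd hd ?_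
    filter_upwards [hmem, hj] with s hs hj
    calc _ ≤ ‖Fr.b₂‖ * (η * ‖v s - v' s‖ + C * ‖Fr.j (v s - v' s)‖) :=
          (Fr.b₂.le_opNorm _).trans
            (mul_le_mul_of_nonneg_left (hNC _ _ (hM s hs)) (norm_nonneg _))
      _ = _ := by rw [hj]; ring
  have e : (fun s => Fr.b₁ (u₁ s) + Fr.b₂ (S.N (z s) (Fr.c (v s))) -
      (Fr.b₁ (u₁ s) + Fr.b₂ (S.N (z' s) (Fr.c (v' s))))) =
      fun s => Fr.b₂ (S.N (z s - z' s) (Fr.c (v s))) +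
        Fr.b₂ (S.N (z' s) (Fr.c (v s - v' s))) := by
    ext s
    rw [add_sub_add_left_eq_sub, ← map_sub, ← map_add]
    simp
  rw [e, add_assoc]
  exact (normL2w_add_le (memW_of_memLp hb₁) (memW_of_memLp hb₂)).trans (add_le_add h1 h2)

/-- A solution whose `L²(0, t; V)`-norm is small is unique on `[0, t]` among all solutions. The
energy estimate is applied to the difference, with a weight `e^{-l ·}` that absorbs the lower order
part of the feedback term. -/
lemma IsFeedbackMild.eq_of_normL2w_le (h : Fr.IsFeedbackMild t z₀ u₁ z v)
    (h' : Fr.IsFeedbackMild t z₀ u₁ z' v') (ht : 0 ≤ t) {θ : ℝ}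
    (hθ : normL2w 0 (Ioo 0 t) v ≤ θ)
    (hθκ : 12 * (‖Fr.b₂‖ * (‖S.N‖ * ‖Fr.c‖ * θ)) ^ 2 ≤ Fr.κ) :
    (∀ s ∈ Icc 0 t, z s = z' s) ∧ ∀ᵐ s ∂vol t, v s = v' s := by
  have hκ := Fr.κ_pos
  suffices hz : ∀ s ∈ Icc 0 t, z s = z' s by
    refine ⟨hz, ?_⟩
    filter_upwards [h.ae_eq, h'.ae_eq, ae_restrict_mem measurableSet_Ioo] with s e e' hs
    exact Fr.j_injective (by rw [e, e', hz s (Ioo_subset_Icc_self hs)])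
  have hd := h.sub S.isGenerator h'
  have hdc := hd.continuousOn S.isGenerator S.β_mem ht
  have hz'c := h'.continuousOn S.isGenerator S.β_mem ht
  obtain ⟨M, hM⟩ := isCompact_Icc.exists_bound_of_continuousOn hz'c
  obtain ⟨a, ha⟩ := isCompact_Icc.exists_bound_of_continuousOn hdc
  have hM0 : 0 ≤ M := (norm_nonneg _).trans (hM 0 ⟨le_rfl, ht⟩)
  have ha0 : 0 ≤ a := (norm_nonneg _).trans (ha 0 ⟨le_rfl, ht⟩)
  have hη : 0 < Fr.κ / (2 * (‖Fr.b₂‖ + 1)) := by positivity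
  obtain ⟨C, hC, hNC⟩ := Fr.exists_norm_feedback_le hM0 hη
  obtain ⟨l, hl⟩ : ∃ l : ℝ, 2 * l = 3 * Fr.κ⁻¹ * (‖Fr.b₂‖ * C) ^ 2 :=
    ⟨_, mul_div_cancel₀ _ two_ne_zero⟩
  obtain ⟨s₀, hs₀, hmax⟩ := isCompact_Icc.exists_isMaxOn (nonempty_Icc.2 ht)
    (show ContinuousOn (fun s => Real.exp (-l * s) * ‖z s - z' s‖) (Icc 0 t) from
      (by fun_prop : Continuous fun s : ℝ => Real.exp (-l * s)).continuousOn.mul hdc.norm)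
  have hIoo : Ioo 0 s₀ ⊆ Icc 0 t := Ioo_subset_Icc_self.trans (Icc_subset_Icc_right hs₀.2)
  have hE := hd.hasEnergyBound S.isGenerator S.β_mem ht (-l) s₀ hs₀
  have hle := normL2w_feedback_sub_le (Fr := Fr) (u₁ := u₁) (z := z) (z' := z') (l := l)
    (mul_nonneg (Real.exp_pos (-l * s₀)).le (norm_nonneg (z s₀ - z' s₀))) hη.le hC ha0
    (memLp_vol_mono hs₀.2 h.memLp) (memLp_vol_mono hs₀.2 h'.memLp)
    ((hz'c.mono hIoo).aestronglyMeasurable measurableSet_Ioo)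
    (memLp_vol_mono hs₀.2 ((Fr.j.comp_memLp' hd.memLp).ae_eq hd.ae_eq))
    (ae_vol_mono hs₀.2 hd.ae_eq)
    ((normL2w_mono_set (Ioo_subset_Ioo_right hs₀.2) (memW_of_memLp h.memLp)).trans hθ) hM0
    (fun s hs => hM s (hIoo hs)) (fun s hs => ha s (hIoo hs)) (fun s hs => hmax (hIoo hs)) hNC
  have hzero := eq_zero_of_energy_le hκ (D := Real.exp (-l * s₀) * ‖z s₀ - z' s₀‖) (l := l)
    (x₂ := normL2w (-l) (Ioo 0 s₀) (fun s => v s - v' s))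
    (x₃ := normL2w (-l) (Ioo 0 s₀) (fun s => z s - z' s)) (by
      rw [sub_self, norm_zero, zero_pow two_ne_zero, zero_add, mul_neg] at hE
      rw [mul_pow, ← Real.exp_nat_mul, show ((2 : ℕ) : ℝ) * (-l * s₀) = -(2 * l) * s₀ by
        push_cast; ring]
      exact hE) (normL2w_nonneg _ _ _) hle hθκ (by positivity) (by
      rw [mul_div_assoc', mul_div_assoc', div_le_iff₀ (by positivity)]
      nlinarith [norm_nonneg Fr.b₂]) hl
  intro s hs
  have h1 : Real.exp (-l * s) * ‖z s - z' s‖ ≤ 0 := (hmax hs).trans_eq hzero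
  exact sub_eq_zero.1 (norm_le_zero_iff.1 (nonpos_of_mul_nonpos_right h1 (Real.exp_pos _)))

end Uniqueness

end System.Factorization

/-! ### Well-posedness and stability for a factorized system -/

section Stability

lemma normL2w_zero_le {U : Type*} [NormedAddCommGroup U] [NormedSpace ℂ U] {ω : ℝ} (hω : 0 ≤ ω)
    {u : ℝ → U} (hu : MemL2w ω u) : normL2w 0 (Ioi 0) u ≤ normL2w ω (Ioi 0) u := by
  rw [normL2w_eq_zero_weight (ν := ω)]
  refine (normL2w_le_mul zero_le_one (memW_zero_iff.2 hu.2) ?_).trans_eq (one_mul _)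
  filter_upwards [ae_restrict_mem measurableSet_Ioi] with s hs
  rw [one_mul, norm_smul, Real.norm_eq_abs, Real.abs_exp]
  exact le_mul_of_one_le_left (norm_nonneg _) (Real.one_le_exp (mul_nonneg hω (le_of_lt hs)))

lemma isKL_mul_exp {ν : ℝ} (hν : 0 < ν) : IsKL fun s t => s * Real.exp (-ν * t) where
  continuousOn := by fun_prop
  nonneg s hs t _ := by positivity
  zero t _ := zero_mul _
  strictMono t _ := fun s _ s' _ h => mul_lt_mul_of_pos_right h (Real.exp_pos _)
  strictAnti s hs := fun t _ t' _ h =>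
    mul_lt_mul_of_pos_left (Real.exp_lt_exp.2 (by nlinarith)) hs
  tendsto s _ := by
    have h1 : Tendsto (fun t : ℝ => -ν * t) atTop atBot :=
      tendsto_id.const_mul_atTop_of_neg (by linarith)
    simpa using (Real.tendsto_exp_atBot.comp h1).const_mul s

lemma isKInfty_mul {c : ℝ} (hc : 0 < c) : IsKInfty fun r => c * r where
  continuousOn := by fun_prop
  zero := mul_zero c
  strictMono := fun _ _ _ _ h => mul_lt_mul_of_pos_left h hc
  tendsto := tendsto_id.const_mul_atTop hc

variable {X U₁ U₂ Y : Type*}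
  [NormedAddCommGroup X] [InnerProductSpace ℂ X] [CompleteSpace X]
  [NormedAddCommGroup U₁] [InnerProductSpace ℂ U₁] [CompleteSpace U₁]
  [NormedAddCommGroup U₂] [InnerProductSpace ℂ U₂] [CompleteSpace U₂]
  [NormedAddCommGroup Y] [InnerProductSpace ℂ Y] [CompleteSpace Y]
  {S : System X U₁ U₂ Y}
  {V W : Type*} [NormedAddCommGroup V] [NormedSpace ℂ V] [CompleteSpace V]
  [NormedAddCommGroup W] [NormedSpace ℂ W] (Fr : S.Factorization V W)

include Fr

/-- Existence, uniqueness and exponential decay for small data, with equal weight and decay rate. -/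
theorem System.Factorization.exists_unique_solution :
    ∃ ε > 0, ∃ ν > 0, ∃ c > 0, ∀ (z₀ : X) (u₁ : ℝ → U₁), MemL2w ν u₁ →
      ‖z₀‖ + normL2w ν (Ioi 0) u₁ ≤ ε →
      ∃ z y, S.IsSolution z₀ u₁ z y ∧
        (∀ z' y', S.IsSolution z₀ u₁ z' y' → EqOn z' z (Ici 0) ∧ y' =ᵐ[volInf] y) ∧
        ∀ t ≥ 0, ‖z t‖ ≤ ‖z₀‖ * Real.exp (-ν * t) +
          c * Real.exp (-ν * t) * normL2w ν (Ioo 0 t) u₁ := by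
  have hκ := Fr.κ_pos
  obtain ⟨K, hK, ε₀, hε₀, hex⟩ := Fr.exists_small_solution
  set q : ℝ := ‖Fr.b₂‖ * (‖S.N‖ * ‖Fr.c‖ * K) with hq
  have hq0 : 0 ≤ q := by positivity
  -- the size of the data for which both the decay and the uniqueness estimate apply
  set μ : ℝ := min (Fr.κ / 2) √(Fr.κ / 12) with hμ
  have hμ0 : 0 < μ := lt_min (by positivity) (by positivity)
  set ε : ℝ := min ε₀ (μ / (q + 1)) with hε
  have hε0 : 0 < ε := lt_min hε₀ (by positivity)
  have hqε : q * ε ≤ μ := by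
    have h1 : ε ≤ μ / (q + 1) := min_le_right _ _
    rw [le_div_iff₀ (by positivity)] at h1
    nlinarith
  have hqε0 : 0 ≤ q * ε := by positivity
  set ν : ℝ := Fr.κ / (4 * (‖Fr.j‖ ^ 2 + 1)) with hν
  have hν0 : 0 < ν := by positivity
  refine ⟨ε, hε0, ν, hν0, √(2 * Fr.κ⁻¹) * ‖Fr.b₁‖ + 1, by positivity, fun z₀ u₁ hu hsmall => ?_⟩
  obtain ⟨z, v, hz, hm, hN, hzb, hvb⟩ := hex ε hε0 (min_le_left _ _) z₀ u₁ hu.1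
    ((add_le_add_right (normL2w_zero_le hν0.le hu) _).trans hsmall)
  refine ⟨z, fun s => Fr.c (v s),
    Fr.isSolution_of_isFeedbackMild hz (memLp_vol_of_volInf hu.1) hN hm, fun z' y' h' => ?_,
    fun t ht => ?_⟩
  · have huniq : ∀ t > 0, (∀ s ∈ Icc 0 t, z s = z' s) ∧ ∀ᵐ s ∂vol t, y' s = Fr.c (v s) := by
      intro t ht
      obtain ⟨v', hm', hy'⟩ := Fr.exists_isFeedbackMild h' ht
      obtain ⟨h1, h2⟩ := (hm t ht.le).eq_of_normL2w_le hm' ht.le (hvb t ht.le) (by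
        have h3 : q * ε ≤ √(Fr.κ / 12) := hqε.trans (min_le_right _ _)
        have h4 := pow_le_pow_left₀ hqε0 h3 2
        rw [Real.sq_sqrt (by positivity)] at h4
        calc _ = 12 * (q * ε) ^ 2 := by rw [hq]; ring
          _ ≤ Fr.κ := by linarith)
      refine ⟨h1, ?_⟩
      filter_upwards [hy', h2] with s e1 e2
      rw [e1, e2]
    exact ⟨fun s hs => ((huniq (s + 1) (add_pos_of_nonneg_of_pos hs one_pos)).1 s
      ⟨hs, by linarith⟩).symm, ae_volInf_of_forall fun t ht => (huniq t ht).2⟩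
  · have h1 := (hm t ht).norm_le_exp ht (memLp_vol_of_volInf hu.1 t) (ν := ν)
      (fun s hs => hzb s hs.1) (by
        have h3 : q * ε ≤ Fr.κ / 2 := hqε.trans (min_le_left _ _)
        calc _ = 2 * (q * ε) := by rw [hq]; ring
          _ ≤ Fr.κ := by linarith) hν0.le (by
        have h3 : 4 * ν * ‖Fr.j‖ ^ 2 = Fr.κ * (‖Fr.j‖ ^ 2 / (‖Fr.j‖ ^ 2 + 1)) := by
          rw [hν]; field_simp
        rw [h3]
        exact mul_le_of_le_one_right hκ.le ((div_le_one (by positivity)).2 (by linarith)))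
    refine h1.trans ?_
    have := normL2w_nonneg ν (Ioo 0 t) u₁
    gcongr
    linarith

/-- Well-posedness, exponential decay and local input-to-state stability of a factorized system,
with `ω = ν` and the comparison functions `b(s, t) = s e^{-ν t}` and `g(r) = c r`. -/
theorem System.Factorization.stability :
    S.WellPosed ∧ ∃ ε > 0, ∃ ω > 0, ∃ ν ≥ ω, ∃ c > 0,
      (∀ (z₀ : X) (u₁ : ℝ → U₁), MemL2w ω u₁ → ‖z₀‖ + normL2w ω (Ioi 0) u₁ ≤ ε →
        ∃ z y, S.IsSolution z₀ u₁ z y ∧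
          (∀ z' y', S.IsSolution z₀ u₁ z' y' → EqOn z' z (Ici 0) ∧ y' =ᵐ[volInf] y) ∧
          ∀ t ≥ 0, ‖z t‖ ≤ ‖z₀‖ * Real.exp (-ν * t) +
            c * Real.exp (-ν * t) * normL2w ν (Ioo 0 t) u₁) ∧
      S.IsLocallyISS ω := by
  obtain ⟨ε, hε, ν, hν, c, hc, h⟩ := Fr.exists_unique_solution
  refine ⟨Fr.wellPosed, ε, hε, ν, hν, ν, le_rfl, c, hc, h, _, _, isKL_mul_exp hν,
    isKInfty_mul hc, ε, hε, fun z₀ u₁ hu hsmall => ?_⟩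
  obtain ⟨z, y, hzy, -, hbound⟩ := h z₀ u₁ hu hsmall
  refine ⟨z, y, hzy, fun t ht => (hbound t ht).trans ?_⟩
  have h1 : Real.exp (-ν * t) ≤ 1 := Real.exp_le_one_iff.2 (by nlinarith)
  have h2 : c * Real.exp (-ν * t) * normL2w ν (Ioo 0 t) u₁ ≤ c * 1 * normL2w ν (Ioo 0 t) u₁ := by
    have := normL2w_nonneg ν (Ioo 0 t) u₁
    gcongr
  rw [mul_one] at h2
  exact add_le_add_right h2 _

end Stability

/-! ### The factorizations of the two classes of systems -/

section Instances

variable {X U₁ U₂ Y : Type*}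
  [NormedAddCommGroup X] [InnerProductSpace ℂ X] [CompleteSpace X]
  [NormedAddCommGroup U₁] [InnerProductSpace ℂ U₁] [CompleteSpace U₁]
  [NormedAddCommGroup U₂] [InnerProductSpace ℂ U₂] [CompleteSpace U₂]
  [NormedAddCommGroup Y] [InnerProductSpace ℂ Y] [CompleteSpace Y]

section SelfAdjoint

variable {A : X →ₗ.[ℂ] X} (hA : IsSelfAdjointStrictlyNegative A)

lemma Half.denseRange_of : DenseRange (Half.of hA) :=
  (Half.denseRange_ofPre hA).comp (PreHalf.equiv hA).surjective.denseRange
    (Half.ofPre hA).continuous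

/-- The inner product of `X_{1/2}` is given by `⟨-A x, ·⟩` for `x ∈ D(A)`. -/
lemma Half.inner_of (x : A.domain) (v : Half hA) :
    inner ℂ (Half.of hA x) v = inner ℂ (-A x) (Half.toX hA v) := by
  refine (Half.denseRange_of hA).induction_on (p := fun v =>
    inner ℂ (Half.of hA x) v = inner ℂ (-A x) (Half.toX hA v)) v ?_ fun y => ?_
  · exact isClosed_eq (by fun_prop) (by fun_prop)
  · rw [Half.toX_of]
    exact UniformSpace.Completion.inner_coe (PreHalf.equiv hA x) (PreHalf.equiv hA y)

/-- The inner product of an element of the kernel with the dense subspace `D(A)` vanishes. -/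
lemma Half.toX_injective : Function.Injective (Half.toX hA) := by
  refine (injective_iff_map_eq_zero _).2 fun v hv => ?_
  have h1 : ∀ w, inner ℂ w v = 0 := fun w => by
    refine (Half.denseRange_of hA).induction_on (p := fun w => inner ℂ w v = 0) w
      (isClosed_eq (by fun_prop) continuous_const) fun x => ?_
    rw [Half.inner_of, hv, inner_zero_right]
  exact inner_self_eq_zero.1 (h1 v)

/-- The embedding `X ⊆ X_{-1/2}`. -/
noncomputable def NegHalf.of : X →L[ℂ] NegHalf hA :=
  (NegHalf.ofPre hA).comp ((PreNegHalf.equiv hA).toLinearMap.mkContinuous ‖Half.toX hA‖ fun x => by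
    refine (ContinuousLinearMap.opNorm_comp_le _ _).trans ?_
    rw [innerSL_apply_norm, mul_comm]
    exact le_rfl)

/-- The frame `X_{1/2} ⊆ X ⊆ X_{-1/2}` of a self-adjoint, strictly negative operator. -/
noncomputable def selfAdjointFrame {β : ℂ} (hβ : β ∈ resolventSet A) :
    GelfandFrame A β (Half hA) (NegHalf hA) where
  dense_domain := hA.1.dense_domain
  j := Half.toX hA
  j_injective := Half.toX_injective hA
  ι := (Half.ofPre hA).toLinearMap ∘ₗ (PreHalf.equiv hA).toLinearMap
  j_ι := Half.toX_of hA
  denseRange_ι := Half.denseRange_of hA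
  k := NegHalf.of hA
  denseRange_k := (NegHalf.denseRange_ofPre hA).comp (PreNegHalf.equiv hA).surjective.denseRange
    (NegHalf.ofPre hA).continuous
  norm_inner_le x v := by
    have h : ‖NegHalf.of hA x‖ = ‖(innerSL ℂ x).comp (Half.toX hA)‖ :=
      NegHalf.norm_ofPre hA (PreNegHalf.equiv hA x)
    rw [h]
    exact ((innerSL ℂ x).comp (Half.toX hA)).le_opNorm v
  J := (extrapResolvent hβ β).comp (NegHalf.toExtrap hA hβ)
  J_k x := by
    rw [ContinuousLinearMap.comp_apply]
    exact (congrArg _ (NegHalf.toExtrap_of hA hβ x)).trans (extrapResolvent_of hβ β x)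
  κ := 1
  κ_pos := one_pos
  coercive x := by
    have h := PreHalf.norm_sq_equiv hA x
    rw [← Half.norm_ofPre, inner_neg_left, Complex.neg_re] at h
    change _ ≤ -1 * ‖Half.ofPre hA (PreHalf.equiv hA x)‖ ^ 2
    linarith

end SelfAdjoint

/-- The trivial frame `X ⊆ X ⊆ X` of a densely defined, strictly dissipative operator. -/
noncomputable def dissipativeFrame {A : X →ₗ.[ℂ] X} {β : ℂ} (hd : Dense (A.domain : Set X))
    {κ : ℝ} (hκ : 0 < κ)
    (h : ∀ x : A.domain, (inner ℂ (A x) (x : X)).re ≤ -κ * ‖(x : X)‖ ^ 2) :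
    GelfandFrame A β X X where
  dense_domain := hd
  j := .id ℂ X
  j_injective := Function.injective_id
  ι := A.domain.subtype
  j_ι _ := rfl
  denseRange_ι := by
    simpa [DenseRange] using hd
  k := .id ℂ X
  denseRange_k := Function.surjective_id.denseRange
  norm_inner_le x v := norm_inner_le_norm x v
  J := resolvent A β
  J_k _ := rfl
  κ := κ
  κ_pos := hκ
  coercive := h

variable (S : System X U₁ U₂ Y)

lemma System.IsSelfAdjointType.exists_factorization (h : S.IsSelfAdjointType) :
    ∃ hA : IsSelfAdjointStrictlyNegative S.A,
      Nonempty (S.Factorization (Half hA) (NegHalf hA)) := by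
  obtain ⟨hA, ⟨B₁', h₁⟩, ⟨B₂', h₂⟩, C', hC⟩ := h
  exact ⟨hA, ⟨{
    selfAdjointFrame hA S.β_mem with
    b₁ := B₁'
    isom_B₁ := fun u => by rw [h₁]; rfl
    b₂ := B₂'
    isom_B₂ := fun u => by rw [h₂]; rfl
    c := C'
    c_ι := hC }⟩⟩

/-- A bounded perturbation `L` of a skew-adjoint operator inherits the dissipativity of `L`. -/
lemma re_inner_le_of_skewAdjoint {A₀ : X →ₗ.[ℂ] X} {L : X →L[ℂ] X} {w : ℝ}
    (hd : Dense (A₀.domain : Set X)) (hskew : A₀.adjoint = -A₀)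
    (hL : ∀ z, (inner ℂ (L z) z).re ≤ w * ‖z‖ ^ 2)
    (x : (A₀ + (L : X →ₗ[ℂ] X).toPMap ⊤).domain) :
    (inner ℂ ((A₀ + (L : X →ₗ[ℂ] X).toPMap ⊤) x) (x : X)).re ≤ w * ‖(x : X)‖ ^ 2 := by
  have hform := LinearPMap.adjoint_isFormalAdjoint hd
  rw [hskew] at hform
  have hx : (x : X) ∈ A₀.domain := x.2.1
  have h1 : inner ℂ (-A₀ ⟨x, hx⟩) (x : X) = inner ℂ (x : X) (A₀ ⟨x, hx⟩) :=
    hform ⟨x, hx⟩ ⟨x, hx⟩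
  have h2 : (inner ℂ (A₀ ⟨x, hx⟩) (x : X)).re = 0 := by
    have h3 := congrArg Complex.re h1
    rw [inner_neg_left, Complex.neg_re, ← inner_conj_symm (x : X), Complex.conj_re] at h3
    linarith
  have h4 : (A₀ + (L : X →ₗ[ℂ] X).toPMap ⊤) x = A₀ ⟨x, hx⟩ + L x := by
    rw [LinearPMap.add_apply]
    rfl
  rw [h4, inner_add_left, Complex.add_re, h2, zero_add]
  exact hL x

lemma System.IsSkewAdjointType.exists_factorization (h : S.IsSkewAdjointType) :
    Nonempty (S.Factorization X X) := by
  obtain ⟨⟨A₀, L, hd, hskew, ⟨w, hw, hL⟩, hS⟩, ⟨B₁', h₁⟩, ⟨B₂', h₂⟩, C', hC⟩ := h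
  have hdom : Dense (S.A.domain : Set X) := by
    rw [hS, LinearPMap.add_domain]
    simpa using hd
  have hdiss : ∀ x : S.A.domain, (inner ℂ (S.A x) (x : X)).re ≤ - -w * ‖(x : X)‖ ^ 2 := by
    rw [hS, neg_neg]
    exact re_inner_le_of_skewAdjoint hd hskew hL
  exact ⟨{
    dissipativeFrame (β := S.β) hdom (neg_pos.2 hw) hdiss with
    b₁ := B₁'
    isom_B₁ := fun u => by rw [h₁, System.isom_toExtrap]; rfl
    b₂ := B₂'
    isom_B₂ := fun u => by rw [h₂, System.isom_toExtrap]; rfl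
    c := C'
    c_ι := hC }⟩

end Instances

end BilinearFeedback

theorem mainTheorem1 {X U₁ U₂ Y : Type*}
    [NormedAddCommGroup X] [InnerProductSpace ℂ X] [CompleteSpace X]
    [NormedAddCommGroup U₁] [InnerProductSpace ℂ U₁] [CompleteSpace U₁]
    [NormedAddCommGroup U₂] [InnerProductSpace ℂ U₂] [CompleteSpace U₂]
    [NormedAddCommGroup Y] [InnerProductSpace ℂ Y] [CompleteSpace Y]
    (S : BilinearFeedback.System X U₁ U₂ Y)
    (hS : S.IsSelfAdjointType ∨ S.IsSkewAdjointType) :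
    S.WellPosed ∧
    ∃ ε > 0, ∃ ω > 0, ∃ ν ≥ ω, ∃ c > 0,
      (∀ (z₀ : X) (u₁ : ℝ → U₁), BilinearFeedback.MemL2w ω u₁ →
        ‖z₀‖ + BilinearFeedback.normL2w ω (Ioi 0) u₁ ≤ ε →
        ∃ z y, S.IsSolution z₀ u₁ z y ∧
          (∀ z' y', S.IsSolution z₀ u₁ z' y' →
            EqOn z' z (Ici 0) ∧ y' =ᵐ[BilinearFeedback.volInf] y) ∧
          ∀ t ≥ 0, ‖z t‖ ≤ ‖z₀‖ * Real.exp (-ν * t) +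
            c * Real.exp (-ν * t) * BilinearFeedback.normL2w ν (Ioo 0 t) u₁) ∧
      S.IsLocallyISS ω := by
  rcases hS with h | h
  · obtain ⟨_, ⟨Fr⟩⟩ := BilinearFeedback.System.IsSelfAdjointType.exists_factorization S h
    exact Fr.stability
  · obtain ⟨Fr⟩ := BilinearFeedback.System.IsSkewAdjointType.exists_factorization S h
    exact Fr.stability
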